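/- Let $(\mathcal K,[\cdot,\cdot])$ be a Krein space and let $N$ be a bounded normal operator on $\mathcal K$ (i.e. $NN^*=N^*N$ for the Krein space adjoint $N^*$) with real part $A=\frac{N+N^*}{2}$ and imaginary part $B=\frac{N-N^*}{2i}$. Assume that $N$ is definitizable and fix definitizing polynomials: nonzero $p,q\in\mathbb R[z]$ with $[p(A)x,x]\ge 0$ and $[q(B)x,x]\ge 0$ for all $x\in\mathcal K$. *Spaces and operators.* Let $\mathcal V_1,\mathcal V_2,\mathcal V$ be the Hilbert space completions of $\mathcal K/\ker p(A)$, $\mathcal K/\ker q(B)$, $\mathcal K/\ker(p(A)+q(B))$ with respect to $[p(A)\cdot,\cdot]$, $[q(B)\cdot,\cdot]$, $[(p(A)+q(B))\cdot,\cdot]$, and let $T_1,T_2,T$ be the (injective) adjoints, from $\mathcal V_1,\mathcal V_2,\mathcal V$ to $\mathcal K$, of the canonical maps of $\mathcal K$ into these spaces, so that $TT^*=p(A)+q(B)=T_1T_1^*+T_2T_2^*$. Let $R_j:\mathcal V_j\to\mathcal V$ be the adjoint of the continuous extension to $\mathcal V$ of $T^*x\mapsto T_j^*x$, so that $T_j=TR_j$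 ($j=1,2$). For $C$ in the commutant of $TT^*$ let $\Theta(C)=T^{-1}CT\in B(\mathcal V)$, and let $E$ be the spectral measure of the normal Hilbert space operator $\Theta(N)$. *Local algebras.* Let $\mathfrak d_p(\xi),\mathfrak d_q(\eta)$ be the orders of $\xi,\eta\in\mathbb C$ as zeros of $p,q$. Put $Z=\{z\in\mathbb C: p(\operatorname{Re}z)=0=q(\operatorname{Im}z)\}$ (the critical points) and $Z^i=(p^{-1}\{0\}\times q^{-1}\{0\})\setminus(\mathbb R\times\mathbb R)\subseteq\mathbb C^2$. The local algebra $\mathfrak C(z)$ is $\mathbb C$ for $z\in\sigma(\Theta(N))\setminus Z$. For $z\in Z$ it is the space of families $(a_{k,l})$ indexed by $(\{0,\dots,m-1\}\times\{0,\dots,n-1\})\cup\{(m,0),(0,n)\}$ with $m=\mathfrak d_p(\operatorname{Re}z)$, $n=\mathfrak d_q(\operatorname{Im}z)$; for $z=(\xi,\eta)\in Z^i$ it is the space of families indexed by $\{0,\dots,\mathfrak d_p(\xi)-1\}\times\{0,\dots,\mathfrak d_q(\eta)-1\}$. The multiplication is $(ab)_{k,l}=\sum_{c=0}^k\sum_{d=0}^l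 a_{c,d}b_{k-c,l-d}$, with unit $e$, $e_{0,0}=1$, $e_{k,l}=0$ otherwise. *Function class.* $\mathcal F_N$ is the set of functions $\phi$ on $(\sigma(\Theta(N))\cup Z)\,\dot\cup\,Z^i$ with $\phi(z)\in\mathfrak C(z)$ such that $\phi$ is Borel measurable and bounded on $\sigma(\Theta(N))\setminus Z$ and such that for each $w\in\sigma(\Theta(N))\cap Z$ $$\frac{\phi(z)-\sum_{k=0}^{\mathfrak d_p(\operatorname{Re}w)-1}\sum_{l=0}^{\mathfrak d_q(\operatorname{Im}w)-1}\phi(w)_{k,l}\operatorname{Re}(z-w)^k\operatorname{Im}(z-w)^l}{\max\big(|\operatorname{Re}(z-w)|^{\mathfrak d_p(\operatorname{Re}w)},|\operatorname{Im}(z-w)|^{\mathfrak d_q(\operatorname{Im}w)}\big)}$$ is bounded for $z\in\sigma(\Theta(N))\setminus\{w\}$ in some neighbourhood of $w$. A polynomial $s\in\mathbb C[z,w]$ gives $s_N\in\mathcal F_N$, where $s_N(\zeta)$ consists of the Taylor coefficients $\frac1{k!l!}\partial_z^k\partial_w^l s$ at $(\operatorname{Re}\zeta,\operatorname{Im}\zeta)$,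 respectively at $\zeta$ if $\zeta\in Z^i$, with $(k,l)$ in the index set of $\mathfrak C(\zeta)$ (just the value for $\zeta\in\sigma(\Theta(N))\setminus Z$). *Functional calculus.* For $\phi\in\mathcal F_N$ choose $s\in\mathbb C[z,w]$ and a function $g$ on $\sigma(\Theta(N))$, with values in $\mathbb C$ off $Z$ and in $\mathbb C^2$ on $Z$, bounded and measurable on $\sigma(\Theta(N))\setminus Z$, such that the entries with $k<\mathfrak d_p$, $l<\mathfrak d_q$ of $\phi-s_N$ vanish at all points of $Z\,\dot\cup\,Z^i$ and $\phi(z)=s_N(z)+(p_N+q_N)(z)\cdot g(z)$ on $\sigma(\Theta(N))$; here at $z\in Z$ the product multiplies the entry with index $(\mathfrak d_p(\operatorname{Re}z),0)$ by $g(z)_1$, the entry with index $(0,\mathfrak d_q(\operatorname{Im}z))$ by $g(z)_2$, and its other entries are $0$. Then $$\phi(N)=s(A,B)+T\Big(\int_{\sigma(\Theta(N))\setminus Z}g\,dE+\sum_{w\in\sigma(\Theta(N))\cap Z}\big(g(w)_1R_1R_1^*E\{w\}+g(w)_2R_2R_2^*E\{w\}\big)\Big)T^*,$$ which does not depend on the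 choice of $s$ and $g$. Finally let $$\sigma_N=\big(\sigma(\Theta(N))\cup(Z\cap\sigma(N))\big)\,\dot\cup\,\{(\alpha,\beta)\in Z^i:\ \alpha+i\beta,\ \bar\alpha+i\bar\beta\in\sigma(N)\}.$$ **Lemma.** If $\phi\in\mathcal F_N$ is such that $\phi(z)$ is invertible in $\mathfrak C(z)$ for all $z\in\sigma_N$, and such that $0$ does not belong to the closure of $\phi\big(\sigma(\Theta(N))\setminus Z\big)$, then $\phi(N)$ is a boundedly invertible operator on $\mathcal K$. -/

import Mathlib

open scoped ComplexOrder InnerProductSpace Topology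

noncomputable section

/-! ### Krein spaces -/

/-- A Krein space structure on a complex Hilbert space `K`: a fundamental symmetry `J`,
i.e. `J = J* = J⁻¹`. The indefinite inner product is `[x, y] = (J x, y)`, see `form`. Every Krein
space is of this form, with `(x, y) = [J x, y]` the Hilbert space inner product that belongs to a
fundamental decomposition. -/
structure KreinStructure (K : Type*) [NormedAddCommGroup K] [InnerProductSpace ℂ K]
    [CompleteSpace K] where
  J : K →L[ℂ] K
  isSelfAdjoint : IsSelfAdjoint J
  sq_eq_one : J * J = 1

namespace KreinStructure

variable {K : Type*} [NormedAddCommGroup K] [InnerProductSpace ℂ K] [CompleteSpace K]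
variable {H : Type*} [NormedAddCommGroup H] [InnerProductSpace ℂ H] [CompleteSpace H]
variable (κ : KreinStructure K)

/-- The indefinite inner product `[x, y]`, linear in `x` and conjugate linear in `y`
(Mathlib's `inner` is conjugate linear in its first argument). -/
def form (x y : K) : ℂ := inner ℂ y (κ.J x)

/-- The Krein space adjoint of a bounded operator on `K`. -/
def adj (C : K →L[ℂ] K) : K →L[ℂ] K := κ.J * ContinuousLinearMap.adjoint C * κ.J

/-- The adjoint `K → H` of a bounded operator `H → K` from a Hilbert space to the Krein space. -/
def adjTo (T : H →L[ℂ] K) : K →L[ℂ] H := ContinuousLinearMap.adjoint T ∘L κ.J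

/-- The adjoint `H → K` of a bounded operator `K → H` from the Krein space to a Hilbert space. -/
def adjFrom (ι : K →L[ℂ] H) : H →L[ℂ] K := κ.J ∘L ContinuousLinearMap.adjoint ι

lemma J_J (x : K) : κ.J (κ.J x) = x := by
  have := congrArg (fun A : K →L[ℂ] K => A x) κ.sq_eq_one
  simpa using this

lemma inner_J_left (x y : K) : inner ℂ (κ.J x) y = inner ℂ x (κ.J y) := by
  have h := κ.isSelfAdjoint
  rw [ContinuousLinearMap.isSelfAdjoint_iff'] at h
  rw [← ContinuousLinearMap.adjoint_inner_right, h]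

lemma form_adj (C : K →L[ℂ] K) (x y : K) : κ.form (C x) y = κ.form x (κ.adj C y) := by
  simp only [form, adj, mul_apply_eq_comp, inner_J_left, J_J,
    ContinuousLinearMap.adjoint_inner_left]

lemma form_adjTo (T : H →L[ℂ] K) (v : H) (x : K) :
    κ.form (T v) x = inner ℂ (κ.adjTo T x) v := by
  simp [form, adjTo, ContinuousLinearMap.adjoint_inner_left, inner_J_left]

lemma form_adjFrom (ι : K →L[ℂ] H) (v : H) (x : K) :
    κ.form (κ.adjFrom ι v) x = inner ℂ (ι x) v := by
  simp [form, adjFrom, ContinuousLinearMap.adjoint_inner_right, J_J]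

/-- `[G x, x] ≥ 0` for all `x` (in `ℂ`: real and nonnegative). -/
def IsNonneg (G : K →L[ℂ] K) : Prop := ∀ x, 0 ≤ κ.form (G x) x

lemma IsNonneg.add {κ : KreinStructure K} {G G' : K →L[ℂ] K} (h : κ.IsNonneg G)
    (h' : κ.IsNonneg G') : κ.IsNonneg (G + G') := by
  intro x
  have := add_nonneg (h x) (h' x)
  simpa [form, inner_add_right] using this

lemma IsNonneg.isPositive {κ : KreinStructure K} {G : K →L[ℂ] K} (h : κ.IsNonneg G) :
    (κ.J * G).IsPositive := by
  rw [ContinuousLinearMap.isPositive_iff_complex]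
  intro x
  have h1 := h x
  have h2 : inner ℂ ((κ.J * G) x) x = (starRingEnd ℂ) (κ.form (G x) x) := by
    simp [form]
  rw [h2]
  obtain ⟨ha, hb⟩ := Complex.nonneg_iff.mp h1
  refine ⟨?_, by simpa using ha⟩
  apply Complex.ext <;> simp [← hb]

/-! ### The Hilbert space completion of `K / ker G` with respect to `[G ., .]` -/

/-- The space `K`, to be equipped with the semi-inner product `[G x, y]`. -/
@[nolint unusedArguments]
def FormSpace (G : K →L[ℂ] K) (_hG : κ.IsNonneg G) : Type _ := K

variable {κ} {G : K →L[ℂ] K} {hG : κ.IsNonneg G}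

instance : AddCommGroup (κ.FormSpace G hG) := inferInstanceAs (AddCommGroup K)
instance : Module ℂ (κ.FormSpace G hG) := inferInstanceAs (Module ℂ K)

variable (κ G hG) in
/-- The identity map from `K` to `FormSpace`. -/
def toFormSpace : K →ₗ[ℂ] κ.FormSpace G hG := LinearMap.id

variable (κ G hG) in
/-- The identity map from `FormSpace` to `K`. -/
def ofFormSpace : κ.FormSpace G hG →ₗ[ℂ] K := LinearMap.id

variable (κ G hG) in
/-- The semi-inner product `[G x, y]`. -/
@[reducible]
def formCore : PreInnerProductSpace.Core ℂ (κ.FormSpace G hG) where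
  inner x y := κ.form (G (ofFormSpace κ G hG y)) (ofFormSpace κ G hG x)
  conj_inner_symm x y := by
    have h := hG.isPositive.isSymmetric (ofFormSpace κ G hG x) (ofFormSpace κ G hG y)
    simpa [form] using h
  re_inner_nonneg x := (Complex.nonneg_iff.mp (hG (ofFormSpace κ G hG x))).1
  add_left x y z := by simp [form]
  smul_left x y r := by simp [form, mul_comm]

instance : SeminormedAddCommGroup (κ.FormSpace G hG) :=
  @InnerProductSpace.Core.toSeminormedAddCommGroup ℂ _ _ _ _ (formCore κ G hG)

instance : InnerProductSpace ℂ (κ.FormSpace G hG) := InnerProductSpace.ofCore (formCore κ G hG)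

variable (κ G hG) in
/-- The Hilbert space completion of `K / ker G` with respect to `[G ., .]` (the completion of a
seminormed space is Hausdorff, so the kernel is divided out). -/
abbrev FormCompletion : Type _ := UniformSpace.Completion (κ.FormSpace G hG)

variable (κ G hG) in
lemma norm_toFormSpace_le (x : K) :
    ‖(UniformSpace.Completion.toComplₗᵢ (𝕜 := ℂ)).toLinearMap (toFormSpace κ G hG x)‖ ≤
      √‖κ.J * G‖ * ‖x‖ := by
  have h1 : ‖(UniformSpace.Completion.toComplₗᵢ (𝕜 := ℂ)).toLinearMap (toFormSpace κ G hG x)‖ =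
      √((κ.form (G x) x).re) := by
    rw [LinearIsometry.coe_toLinearMap, LinearIsometry.norm_map]
    rfl
  rw [h1, ← Real.sqrt_sq (norm_nonneg x), ← Real.sqrt_mul (norm_nonneg _)]
  apply Real.sqrt_le_sqrt
  calc (κ.form (G x) x).re ≤ ‖κ.form (G x) x‖ := Complex.re_le_norm _
    _ ≤ ‖x‖ * ‖(κ.J * G) x‖ := norm_inner_le_norm _ _
    _ ≤ ‖x‖ * (‖κ.J * G‖ * ‖x‖) := by
        gcongr
        exact (κ.J * G).le_opNorm x
    _ = ‖κ.J * G‖ * ‖x‖ ^ 2 := by ring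

variable (κ G hG) in
/-- The canonical bounded map of `K` into the completion of `K / ker G`. -/
def embForm : K →L[ℂ] κ.FormCompletion G hG :=
  LinearMap.mkContinuous
    ((UniformSpace.Completion.toComplₗᵢ (𝕜 := ℂ)).toLinearMap ∘ₗ toFormSpace κ G hG)
    (√‖κ.J * G‖) (norm_toFormSpace_le κ G hG)

end KreinStructure

/-! ### Spectral measures -/

/-- A projection valued measure on the Borel subsets of `ℂ`. -/
structure ProjMeasure (H : Type*) [NormedAddCommGroup H] [InnerProductSpace ℂ H]
    [CompleteSpace H] where
  proj : Set ℂ → (H →L[ℂ] H)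
  isStarProjection : ∀ Δ, MeasurableSet Δ → IsStarProjection (proj Δ)
  empty : proj ∅ = 0
  univ : proj Set.univ = 1
  hasSum : ∀ Δ : ℕ → Set ℂ, (∀ i, MeasurableSet (Δ i)) →
    Pairwise (Function.onFun Disjoint Δ) →
    ∀ x, HasSum (fun i => proj (Δ i) x) (proj (⋃ i, Δ i) x)

section SpectralMeasure

variable {H : Type*} [NormedAddCommGroup H] [InnerProductSpace ℂ H] [CompleteSpace H]

namespace ProjMeasure

lemma re_inner_nonneg (E : ProjMeasure H) (x : H) {Δ : Set ℂ} (hΔ : MeasurableSet Δ) :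
    0 ≤ (inner ℂ x (E.proj Δ x)).re := by
  have h := E.isStarProjection Δ hΔ
  have h1 : E.proj Δ (E.proj Δ x) = E.proj Δ x :=
    congrArg (fun A : H →L[ℂ] H => A x) h.isIdempotentElem.eq
  have h2 := h.isSelfAdjoint
  rw [ContinuousLinearMap.isSelfAdjoint_iff'] at h2
  rw [← h1, ← ContinuousLinearMap.adjoint_inner_left, h2]
  exact inner_self_nonneg (𝕜 := ℂ)

/-- The finite positive measure `Δ ↦ (E(Δ) x, x)`. -/
def measure (E : ProjMeasure H) (x : H) : MeasureTheory.Measure ℂ :=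
  MeasureTheory.Measure.ofMeasurable
    (fun Δ _ => ENNReal.ofReal (inner ℂ x (E.proj Δ x)).re)
    (by simp [E.empty])
    (by
      intro f hf hd
      have h := Complex.hasSum_re ((E.hasSum f hf hd x).mapL (innerSL ℂ x))
      simp only [innerSL_apply_apply] at h
      rw [← h.tsum_eq]
      exact ENNReal.ofReal_tsum_of_nonneg (fun i => E.re_inner_nonneg x (hf i)) h.summable)

/-- `E` is the spectral measure of the bounded (normal) operator `M`: it is carried by the
spectrum of `M`, and `M = ∫ z dE(z)`. -/
def IsSpectralMeasureOf (E : ProjMeasure H) (M : H →L[ℂ] H) : Prop :=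
  E.proj (spectrum ℂ M) = 1 ∧ ∀ x, inner ℂ x (M x) = ∫ z, z ∂(E.measure x)

open Classical in
/-- The Dirac measure at `0`; only used to see that projection valued measures exist. -/
instance : Nonempty (ProjMeasure H) :=
  ⟨{ proj := fun Δ => if (0 : ℂ) ∈ Δ then 1 else 0
     isStarProjection := by
       intro Δ _
       split_ifs
       · exact IsStarProjection.one _
       · exact IsStarProjection.zero _
     empty := by simp
     univ := by simp
     hasSum := by
       intro Δ _ hd x
       by_cases h : ∃ i, (0 : ℂ) ∈ Δ i
       · obtain ⟨i, hi⟩ := h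
         have hu : (0 : ℂ) ∈ ⋃ i, Δ i := Set.mem_iUnion.mpr ⟨i, hi⟩
         have := hasSum_single (f := fun j => (if (0 : ℂ) ∈ Δ j then (1 : H →L[ℂ] H) else 0) x) i
           (by
             intro j hj
             have : (0 : ℂ) ∉ Δ j := fun hj0 => Set.disjoint_left.mp (hd hj) hj0 hi
             simp [this])
         simpa [hi, hu] using this
       · have hu : (0 : ℂ) ∉ ⋃ i, Δ i := by simpa using h
         push Not at h
         simp [h] }⟩

open Classical in
/-- The integral `∫_Δ g dE` of a bounded Borel function: the unique bounded operator `D` with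
`(D x, x) = ∫_Δ g d(E x, x)` for all `x`. -/
def integral (E : ProjMeasure H) (Δ : Set ℂ) (g : ℂ → ℂ) : H →L[ℂ] H :=
  if h : ∃ D : H →L[ℂ] H, ∀ x, inner ℂ x (D x) = ∫ z in Δ, g z ∂(E.measure x)
  then h.choose else 0

end ProjMeasure

/-- The spectral measure of a bounded normal operator on a Hilbert space (unique on Borel sets). -/
def spectralMeasure (M : H →L[ℂ] H) : ProjMeasure H :=
  Classical.epsilon fun E => E.IsSpectralMeasureOf M

end SpectralMeasure

/-! ### The local algebras -/

/-- The index set `({0,…,m-1} × {0,…,n-1}) ∪ {(m,0), (0,n)}` of `𝒜_{m,n}`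
(for `m = n = 0` this is `{(0,0)}` and `𝒜_{0,0} = ℂ`). -/
def indexA (m n : ℕ) : Finset (ℕ × ℕ) :=
  (Finset.range m ×ˢ Finset.range n) ∪ {(m, 0), (0, n)}

/-- The index set `{0,…,m-1} × {0,…,n-1}` of `ℬ_{m,n}`. -/
def indexB (m n : ℕ) : Finset (ℕ × ℕ) := Finset.range m ×ˢ Finset.range n

/-- Families `(a_{k,l})_{(k,l) ∈ I}` of complex numbers with componentwise addition, and with the
truncated Cauchy product as multiplication. -/
def LocAlg (I : Finset (ℕ × ℕ)) : Type := I → ℂ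

namespace LocAlg

variable {I : Finset (ℕ × ℕ)}

instance : AddCommGroup (LocAlg I) := inferInstanceAs (AddCommGroup (I → ℂ))

/-- The entry with index `(k,l)`, zero if `(k,l)` is not in the index set. -/
def coeff (a : LocAlg I) (k l : ℕ) : ℂ := if h : (k, l) ∈ I then a ⟨(k, l), h⟩ else 0

/-- `(a b)_{k,l} = ∑_{c ≤ k} ∑_{d ≤ l} a_{c,d} b_{k-c,l-d}`. -/
instance : Mul (LocAlg I) where
  mul a b := fun i => ∑ c ∈ Finset.range (i.1.1 + 1), ∑ d ∈ Finset.range (i.1.2 + 1),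
    a.coeff c d * b.coeff (i.1.1 - c) (i.1.2 - d)

/-- The unit `e`: `e_{0,0} = 1` and all other entries vanish. -/
instance : One (LocAlg I) where
  one := fun i => if i.1 = (0, 0) then 1 else 0

/-- `a` has a multiplicative inverse. -/
def IsInvertible (a : LocAlg I) : Prop := ∃ b : LocAlg I, a * b = 1 ∧ b * a = 1

end LocAlg

/-! ### Definitizable normal operators -/

section Definitizable

variable {K : Type*} [NormedAddCommGroup K] [InnerProductSpace ℂ K] [CompleteSpace K]

/-- `p(C)` for a real polynomial `p`. -/
def realPolyEval (p : Polynomial ℝ) (C : K →L[ℂ] K) : K →L[ℂ] K :=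
  Polynomial.aeval C (p.map Complex.ofRealHom)

/-- `s(A, B)` for `s ∈ ℂ[z, w]` and commuting operators `A`, `B`. -/
def mvPolyEval (s : MvPolynomial (Fin 2) ℂ) (A B : K →L[ℂ] K) : K →L[ℂ] K :=
  ∑ m ∈ s.support, s.coeff m • (A ^ m 0 * B ^ m 1)

namespace KreinStructure

variable (κ : KreinStructure K)

/-- The nonzero real polynomial `p` is definitizing for `C`: `[p(C) x, x] ≥ 0` for all `x`. -/
def IsDefinitizing (p : Polynomial ℝ) (C : K →L[ℂ] K) : Prop :=
  p ≠ 0 ∧ κ.IsNonneg (realPolyEval p C)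

/-- The real part `(N + N*) / 2`. -/
def realPart (N : K →L[ℂ] K) : K →L[ℂ] K := (1 / 2 : ℂ) • (N + κ.adj N)

/-- The imaginary part `(N - N*) / (2 i)`. -/
def imagPart (N : K →L[ℂ] K) : K →L[ℂ] K := (1 / (2 * Complex.I) : ℂ) • (N - κ.adj N)

end KreinStructure

/-- A bounded normal definitizable operator `N` on a Krein space, together with definitizing
polynomials `p` and `q` of its real and imaginary part. -/
structure DefinitizableNormal (κ : KreinStructure K) where
  N : K →L[ℂ] K
  normal : N * κ.adj N = κ.adj N * N
  p : Polynomial ℝ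
  q : Polynomial ℝ
  definitizing_p : κ.IsDefinitizing p (κ.realPart N)
  definitizing_q : κ.IsDefinitizing q (κ.imagPart N)

namespace DefinitizableNormal

variable {κ : KreinStructure K} (D : DefinitizableNormal κ)

/-- `A = Re N`. -/
def A : K →L[ℂ] K := κ.realPart D.N

/-- `B = Im N`. -/
def B : K →L[ℂ] K := κ.imagPart D.N

/-- `p(A)`. -/
def pA : K →L[ℂ] K := realPolyEval D.p D.A

/-- `q(B)`. -/
def qB : K →L[ℂ] K := realPolyEval D.q D.B

lemma nonneg_pA : κ.IsNonneg D.pA := D.definitizing_p.2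

lemma nonneg_qB : κ.IsNonneg D.qB := D.definitizing_q.2

lemma nonneg_sum : κ.IsNonneg (D.pA + D.qB) := D.nonneg_pA.add D.nonneg_qB

/-- The completion of `K / ker p(A)` with respect to `[p(A) ., .]`. -/
abbrev V₁ : Type _ := κ.FormCompletion D.pA D.nonneg_pA

/-- The completion of `K / ker q(B)` with respect to `[q(B) ., .]`. -/
abbrev V₂ : Type _ := κ.FormCompletion D.qB D.nonneg_qB

/-- The completion of `K / ker (p(A) + q(B))` with respect to `[(p(A) + q(B)) ., .]`. -/
abbrev V : Type _ := κ.FormCompletion (D.pA + D.qB) D.nonneg_sum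

/-- The adjoint `V₁ → K` of the canonical map `K → V₁`. -/
def T₁ : D.V₁ →L[ℂ] K := κ.adjFrom (KreinStructure.embForm κ D.pA D.nonneg_pA)

/-- The adjoint `V₂ → K` of the canonical map `K → V₂`. -/
def T₂ : D.V₂ →L[ℂ] K := κ.adjFrom (KreinStructure.embForm κ D.qB D.nonneg_qB)

/-- The adjoint `V → K` of the canonical map `K → V`. -/
def T : D.V →L[ℂ] K := κ.adjFrom (KreinStructure.embForm κ (D.pA + D.qB) D.nonneg_sum)

/-- The adjoint of the continuous extension `V → V₁` of `T* x ↦ T₁* x`. -/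
def R₁ : D.V₁ →L[ℂ] D.V :=
  ContinuousLinearMap.adjoint
    ((κ.adjTo D.T₁).toLinearMap.extendOfNorm (κ.adjTo D.T).toLinearMap)

/-- The adjoint of the continuous extension `V → V₂` of `T* x ↦ T₂* x`. -/
def R₂ : D.V₂ →L[ℂ] D.V :=
  ContinuousLinearMap.adjoint
    ((κ.adjTo D.T₂).toLinearMap.extendOfNorm (κ.adjTo D.T).toLinearMap)

open Classical in
/-- `Θ(C) = T⁻¹ C T` for `C` in the commutant of `T T*`: the unique bounded operator on `V` with
`T Θ(C) = C T` (recall that `T` is injective). -/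
def Θ (C : K →L[ℂ] K) : D.V →L[ℂ] D.V :=
  if h : ∃ S : D.V →L[ℂ] D.V, D.T ∘L S = C ∘L D.T then h.choose else 0

/-- `Ξ(S) = T S T*`. -/
def Ξ (S : D.V →L[ℂ] D.V) : K →L[ℂ] K := D.T ∘L S ∘L κ.adjTo D.T

/-- `σ(Θ(N))`. -/
def specΘ : Set ℂ := spectrum ℂ (D.Θ D.N)

/-- The spectral measure of `Θ(N)`. -/
def E : ProjMeasure D.V := spectralMeasure (D.Θ D.N)

/-- The order of `ξ ∈ ℂ` as a zero of `p`. -/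
def dp (ξ : ℂ) : ℕ := (D.p.map Complex.ofRealHom).rootMultiplicity ξ

/-- The order of `η ∈ ℂ` as a zero of `q`. -/
def dq (η : ℂ) : ℕ := (D.q.map Complex.ofRealHom).rootMultiplicity η

/-- `p(ξ) = 0` and `q(η) = 0`. -/
def IsZeroPair (ξ η : ℂ) : Prop := Polynomial.aeval ξ D.p = 0 ∧ Polynomial.aeval η D.q = 0

/-- The critical points `Z_p^ℝ + i Z_q^ℝ`. -/
def Zreal : Set ℂ := {z | D.IsZeroPair z.re z.im}

/-- `Z^i = (p⁻¹{0} × q⁻¹{0}) \ (ℝ × ℝ)`. -/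
def Zimag : Set (ℂ × ℂ) := {w | D.IsZeroPair w.1 w.2 ∧ ¬ (w.1.im = 0 ∧ w.2.im = 0)}

/-- The disjoint union of `σ(Θ(N)) ∪ (Z_p^ℝ + i Z_q^ℝ)` and `Z^i`. -/
abbrev Dom : Type := ↥(D.specΘ ∪ D.Zreal) ⊕ ↥D.Zimag

/-- The pair `(Re z, Im z)` for a point `z` of the plane, and `(ξ, η)` itself on `Z^i`. -/
def coord : D.Dom → ℂ × ℂ
  | Sum.inl z => (((z : ℂ).re : ℂ), ((z : ℂ).im : ℂ))
  | Sum.inr w => w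

open Classical in
/-- The index set of the local algebra at a point: that of `𝒜_{dp(Re z), dq(Im z)}` at the critical
points, that of `𝒜_{0,0} = ℂ` at the other points of `σ(Θ(N))`, that of `ℬ_{dp(ξ), dq(η)}` on
`Z^i`. -/
def index : D.Dom → Finset (ℕ × ℕ)
  | Sum.inl z => if (z : ℂ) ∈ D.Zreal then indexA (D.dp (z : ℂ).re) (D.dq (z : ℂ).im)
      else indexA 0 0
  | Sum.inr w => indexB (D.dp (w : ℂ × ℂ).1) (D.dq (w : ℂ × ℂ).2)

/-- The class `ℳ_N`: functions `φ` with `φ(ζ)` in the local algebra at `ζ`. -/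
abbrev Symbol : Type := ∀ ζ : D.Dom, LocAlg (D.index ζ)

open Classical in
/-- The entry `φ(z)_{k,l}` at a point `z ∈ σ(Θ(N)) ∪ (Z_p^ℝ + i Z_q^ℝ)` (zero elsewhere). -/
def planeCoeff (φ : D.Symbol) (z : ℂ) (k l : ℕ) : ℂ :=
  if h : z ∈ D.specΘ ∪ D.Zreal then (φ (Sum.inl ⟨z, h⟩)).coeff k l else 0

/-- The complex value `φ(z)` at a point of `σ(Θ(N)) \ (Z_p^ℝ + i Z_q^ℝ)`, where the local algebra
is `ℂ`. -/
def planeVal (φ : D.Symbol) (z : ℂ) : ℂ := D.planeCoeff φ z 0 0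

/-- The ideal `ℛ`: the entries with index in `{0,…,dp-1} × {0,…,dq-1}` vanish at all points of
`Z_p^ℝ + i Z_q^ℝ` and of `Z^i`. -/
def InR (ψ : D.Symbol) : Prop :=
  ∀ ζ : D.Dom, D.IsZeroPair (D.coord ζ).1 (D.coord ζ).2 →
    ∀ k < D.dp (D.coord ζ).1, ∀ l < D.dq (D.coord ζ).2, (ψ ζ).coeff k l = 0

/-- The element `s_N` of `ℳ_N` given by a polynomial `s ∈ ℂ[z,w]`:
`s_N(ζ)_{k,l} = (1 / (k! l!)) (∂^{k+l} s / ∂z^k ∂w^l)(ξ, η)` with `(ξ, η)` the coordinates of `ζ`. -/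
def ofPoly (s : MvPolynomial (Fin 2) ℂ) : D.Symbol := fun ζ i =>
  (1 / ((i.1.1.factorial : ℂ) * (i.1.2.factorial : ℂ))) *
    MvPolynomial.eval ![(D.coord ζ).1, (D.coord ζ).2]
      ((MvPolynomial.pderiv 0)^[i.1.1] ((MvPolynomial.pderiv 1)^[i.1.2] s))

/-- `p(z)` as an element of `ℂ[z,w]`. -/
def pPoly : MvPolynomial (Fin 2) ℂ :=
  Polynomial.aeval (MvPolynomial.X 0) (D.p.map Complex.ofRealHom)

/-- `q(w)` as an element of `ℂ[z,w]`. -/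
def qPoly : MvPolynomial (Fin 2) ℂ :=
  Polynomial.aeval (MvPolynomial.X 1) (D.q.map Complex.ofRealHom)

/-- The class `ℱ_N`: `φ` is Borel measurable and bounded on `σ(Θ(N)) \ (Z_p^ℝ + i Z_q^ℝ)`, and at
each critical point `w` of `σ(Θ(N))` the difference to the Taylor type polynomial given by `φ(w)`
is `O(max(|Re (z-w)|^dp, |Im (z-w)|^dq))`. -/
def InF (φ : D.Symbol) : Prop :=
  (Measurable fun z : ↥(D.specΘ \ D.Zreal) => D.planeVal φ z) ∧
  (∃ C : ℝ, ∀ z ∈ D.specΘ \ D.Zreal, ‖D.planeVal φ z‖ ≤ C) ∧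
  ∀ w ∈ D.specΘ ∩ D.Zreal, ∃ U ∈ 𝓝 w, ∃ C : ℝ, ∀ z ∈ (D.specΘ ∩ U) \ {w},
    ‖D.planeVal φ z - ∑ k ∈ Finset.range (D.dp w.re), ∑ l ∈ Finset.range (D.dq w.im),
        D.planeCoeff φ w k l * ((z - w).re : ℂ) ^ k * ((z - w).im : ℂ) ^ l‖ /
      max (|(z - w).re| ^ D.dp w.re) (|(z - w).im| ^ D.dq w.im) ≤ C

open Classical in
/-- The product `a · g(z)` at `z ∈ σ(Θ(N))`, where `a` is in the local algebra at `z` and where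
`g(z)` is the number `g z` at non-critical and the pair `h z ∈ ℂ²` at critical points: the usual
product at non-critical points; at critical points the entry `a_{dp,0}` is multiplied by the first
component, `a_{0,dq}` by the second one, and all other entries of the product are zero. -/
def mulRem (g : ℂ → ℂ) (h : ℂ → ℂ × ℂ) (z : ↥(D.specΘ ∪ D.Zreal))
    (a : LocAlg (D.index (Sum.inl z))) : LocAlg (D.index (Sum.inl z)) := fun i =>
  if (z : ℂ) ∈ D.Zreal then
    if i.1 = (D.dp (z : ℂ).re, 0) then a i * (h z).1
    else if i.1 = (0, D.dq (z : ℂ).im) then a i * (h z).2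
    else 0
  else a i * g z

/-- `φ(z) = s_N(z) + (p_N + q_N)(z) · g(z)` on `σ(Θ(N))`, with `φ - s_N ∈ ℛ` and a function `g`
on `σ(Θ(N))` that is `ℂ`-valued (here `g`), bounded and Borel measurable off the critical points and
`ℂ²`-valued (here `h`) at the critical points. -/
structure IsDecomposition (φ : D.Symbol) (s : MvPolynomial (Fin 2) ℂ) (g : ℂ → ℂ)
    (h : ℂ → ℂ × ℂ) : Prop where
  sub_mem : D.InR (φ - D.ofPoly s)
  measurable : Measurable fun z : ↥(D.specΘ \ D.Zreal) => g z
  bounded : ∃ C : ℝ, ∀ z ∈ D.specΘ \ D.Zreal, ‖g z‖ ≤ C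
  eq : ∀ (z : ℂ) (hz : z ∈ D.specΘ), φ (Sum.inl ⟨z, Or.inl hz⟩) =
    D.ofPoly s (Sum.inl ⟨z, Or.inl hz⟩) +
      D.mulRem g h ⟨z, Or.inl hz⟩ ((D.ofPoly D.pPoly + D.ofPoly D.qPoly) (Sum.inl ⟨z, Or.inl hz⟩))

/-- `∫^{R₁,R₂}_{σ(Θ(N))} g dE`, the values of `g` at critical points being the pairs `h w`. -/
def integralR (g : ℂ → ℂ) (h : ℂ → ℂ × ℂ) : D.V →L[ℂ] D.V :=
  D.E.integral (D.specΘ \ D.Zreal) g +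
    ∑ᶠ w ∈ D.specΘ ∩ D.Zreal,
      ((h w).1 • (D.R₁ ∘L ContinuousLinearMap.adjoint D.R₁ ∘L D.E.proj {w}) +
        (h w).2 • (D.R₂ ∘L ContinuousLinearMap.adjoint D.R₂ ∘L D.E.proj {w}))

open Classical in
/-- `φ(N) = s(A, B) + Ξ(∫^{R₁,R₂} g dE)` for a decomposition `φ = s_N + (p_N + q_N) · g`
(such a decomposition exists for `φ ∈ ℱ_N`, and the result does not depend on it). -/
def funCalc (φ : D.Symbol) : K →L[ℂ] K :=
  if H : ∃ t : MvPolynomial (Fin 2) ℂ × (ℂ → ℂ) × (ℂ → ℂ × ℂ),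
      D.IsDecomposition φ t.1 t.2.1 t.2.2
  then mvPolyEval H.choose.1 D.A D.B + D.Ξ (D.integralR H.choose.2.1 H.choose.2.2)
  else 0

/-- `σ_N = (σ(Θ(N)) ∪ ((Z_p^ℝ + i Z_q^ℝ) ∩ σ(N))) ∪
{(α, β) ∈ Z^i : α + i β ∈ σ(N), conj α + i conj β ∈ σ(N)}`. -/
def σN : Set D.Dom :=
  {ζ | match ζ with
    | Sum.inl z => (z : ℂ) ∈ D.specΘ ∪ (D.Zreal ∩ spectrum ℂ D.N)
    | Sum.inr w => (w : ℂ × ℂ).1 + Complex.I * (w : ℂ × ℂ).2 ∈ spectrum ℂ D.N ∧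
        (starRingEnd ℂ) (w : ℂ × ℂ).1 + Complex.I * (starRingEnd ℂ) (w : ℂ × ℂ).2 ∈
          spectrum ℂ D.N}

end DefinitizableNormal

end Definitizable

end

/-! Fix a decomposition `φ = s_N + (p_N + q_N) · g`, let `G` be the integral of `g` with its `R₁`,
`R₂` terms, so that `φ(N) = s(A,B) + T G T*`. Since `T* T = Θ(T T*)`, compressing to `V` gives
`Θ(φ(N)) = s(Θ(A),Θ(B)) + G Θ(T T*)`. The operator `Θ(T T*)` has symbol `p(Re z) + q(Im z)`, which
vanishes at critical points, so it kills the discrete terms of `G`. Hence `Θ(φ(N)) = ∫ f dE`, where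
`f` is `φ` off the critical points and the entry `φ(w)_{0,0}` at a critical point `w` of `σ(Θ(N))`.
The two hypotheses on `φ` keep `f` away from `0` on `σ(Θ(N))`. With `Y = ∫ f⁻¹ dE` one gets `φ(N) ·
T Y T* = T T* = p(A) + q(B)`.

Gelfand theory in the bicommutant of a commuting set finishes the argument (`isUnit_of_joint_zeros`,
`IsDecomposition.isUnit`). Suppose that a character `χ` kills `φ(N)`. Then it kills `p(A) + q(B)`.
Both `(T G T*)²` and `p(A)²` are multiples of `p(A) + q(B)`, so `χ` kills `T G T*` and `p(A)`, hence
also `q(B)` and `s(A,B)`. Therefore `(α, β) = (χ(A), χ(B))` is a common zero of `p` and `q` with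
`s(α, β) = 0`. But `α + iβ` lies in `σ(N)` and `α - iβ` in `σ(N*)`, so the pair represents a point
of `σ_N`. There `s(α, β)` is the entry with index `(0,0)` of an invertible element, which is
nonzero: a contradiction.

Three ingredients are needed. The spectral theorem and the bounded Borel calculus come from the
continuous functional calculus by Riesz representation (`exists_isSpectralMeasureOf`,
`IsIntegral.mul`). Boundedness of `Θ(C)` is an iterated Cauchy-Schwarz argument
(`exists_comp_embForm`). A decomposition exists (`exists_isDecomposition`) because Hermite
interpolation provides `s`, and because division by `p + q` stays bounded: `Θ(p(A)) = R₁R₁* Θ(p(A) +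
q(B))` with a contraction `R₁R₁*` forces `|p(Re z)| ≤ |p(Re z) + q(Im z)|` on `σ(Θ(N))`, and
likewise for `q`. -/

noncomputable section

/-! ### Extending a representation of `C(X)` to indicator functions -/

section FunctionalRepresentation

open MeasureTheory Filter

variable {H : Type*} [NormedAddCommGroup H] [InnerProductSpace ℂ H] [CompleteSpace H]
variable {X : Type*} [MetricSpace X] [CompactSpace X]

/-- A continuous real function as a continuous complex function. -/
def ContinuousMap.toComplex (f : C(X, ℝ)) : C(X, ℂ) := ⟨fun z => (f z : ℂ), by fun_prop⟩

variable (Φ : C(X, ℂ) →⋆ₐ[ℂ] (H →L[ℂ] H))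

omit [CompactSpace X] in
lemma inner_starAlgHom_star_mul (f g : C(X, ℂ)) (x : H) :
    inner ℂ x (Φ (star f * g) x) = inner ℂ (Φ f x) (Φ g x) := by
  rw [map_mul, map_star, mul_apply_eq_comp, ContinuousLinearMap.star_eq_adjoint,
    ContinuousLinearMap.adjoint_inner_right]

/-- The positive functional `f ↦ (Φ(f) x, x)`. -/
def vectorState (x : H) : CompactlySupportedContinuousMap X ℝ →ₚ[ℝ] ℝ :=
  PositiveLinearMap.mk₀
    { toFun := fun f => (inner ℂ x (Φ f.toContinuousMap.toComplex x)).re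
      map_add' := by
        intro f g
        have : (f + g).toContinuousMap.toComplex =
            f.toContinuousMap.toComplex + g.toContinuousMap.toComplex := by
          ext z; simp [ContinuousMap.toComplex]
        simp [this]
      map_smul' := by
        intro c f
        have : (c • f).toContinuousMap.toComplex = (c : ℂ) • f.toContinuousMap.toComplex := by
          ext z; simp [ContinuousMap.toComplex]
        change (inner ℂ x (Φ (c • f).toContinuousMap.toComplex x)).re =
          c * (inner ℂ x (Φ f.toContinuousMap.toComplex x)).re
        rw [this, map_smul, smul_apply, inner_smul_right, Complex.re_ofReal_mul] }
    (by
      intro f hf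
      -- Positivity: with `g = √f` the functional takes the value `‖Φ(g) x‖²` at `f`.
      set g : C(X, ℂ) := ⟨fun z => (√(f z) : ℂ), by fun_prop⟩ with hg
      have : f.toContinuousMap.toComplex = star g * g := by
        ext z
        have h0 : (0 : ℝ) ≤ f z := hf z
        simp only [ContinuousMap.toComplex, hg, ContinuousMap.coe_mk, ContinuousMap.mul_apply,
          ContinuousMap.star_apply, Complex.star_def, Complex.conj_ofReal]
        rw [← Complex.ofReal_mul, Real.mul_self_sqrt h0]
        rfl
      change 0 ≤ (inner ℂ x (Φ f.toContinuousMap.toComplex x)).re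
      rw [this, inner_starAlgHom_star_mul]
      exact inner_self_nonneg (𝕜 := ℂ))

variable [MeasurableSpace X] [BorelSpace X]

/-- The measure representing `f ↦ (Φ(f) x, x)`. -/
def stateMeasure (x : H) : Measure X := RealRMK.rieszMeasure (vectorState Φ x)

instance (x : H) : IsFiniteMeasure (stateMeasure Φ x) := by
  unfold stateMeasure
  infer_instance

/-- The Riesz measure only sees real parts for real `f`. Such `f` are self-adjoint, so `(Φ(f) x, x)`
is already real; complex `f` are split into real and imaginary parts. -/
lemma integral_stateMeasure (f : C(X, ℂ)) (x : H) :
    ∫ z, f z ∂(stateMeasure Φ x) = inner ℂ x (Φ f x) := by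
  have hreal : ∀ g : C(X, ℝ), ∫ z, (g z : ℂ) ∂(stateMeasure Φ x) =
      inner ℂ x (Φ g.toComplex x) := by
    intro g
    have h1 := RealRMK.integral_rieszMeasure (vectorState Φ x)
      (CompactlySupportedContinuousMap.continuousMapEquiv g)
    have h2 : ((inner ℂ x (Φ g.toComplex x)).re : ℂ) = inner ℂ x (Φ g.toComplex x) := by
      have hs : star g.toComplex = g.toComplex := by
        ext z; simp [ContinuousMap.toComplex]
      rw [← Complex.conj_eq_iff_re, inner_conj_symm]
      conv_rhs => rw [← hs, map_star, ContinuousLinearMap.star_eq_adjoint,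
        ContinuousLinearMap.adjoint_inner_right]
    rw [← h2, integral_complex_ofReal]
    congr 1
  have hint : ∀ g : C(X, ℝ), Integrable (fun z => (g z : ℂ)) (stateMeasure Φ x) := by
    intro g
    exact (Continuous.integrable_of_hasCompactSupport (f := fun z => (g z : ℂ)) (by fun_prop)
      (HasCompactSupport.of_compactSpace _))
  set fr : C(X, ℝ) := ⟨fun z => (f z).re, by fun_prop⟩ with hfr
  set fi : C(X, ℝ) := ⟨fun z => (f z).im, by fun_prop⟩ with hfi
  have hf : f = fr.toComplex + Complex.I • fi.toComplex := by
    ext z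
    simp [ContinuousMap.toComplex, hfr, hfi, mul_comm Complex.I, Complex.re_add_im]
  have hf' : ∀ z, f z = (fr z : ℂ) + Complex.I * (fi z : ℂ) := by
    intro z
    simp [hfr, hfi, mul_comm Complex.I, Complex.re_add_im]
  simp_rw [hf']
  rw [integral_add (hint fr) ((hint fi).const_mul _), integral_const_mul, hreal, hreal]
  conv_rhs => rw [hf]
  simp

/-- `‖Φ(f) x‖²` is the vector state at `f̄ f`. This isometry out of `L²` is what allows passing from
continuous functions to indicator functions. -/
lemma enorm_starAlgHom_apply (f : C(X, ℂ)) (x : H) :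
    ‖Φ f x‖ₑ = eLpNorm f 2 (stateMeasure Φ x) := by
  have hmem : MemLp f 2 (stateMeasure Φ x) :=
    f.continuous.memLp_of_hasCompactSupport (HasCompactSupport.of_compactSpace _)
  have h1 : (‖Φ f x‖ : ℂ) ^ 2 = ∫ z, ((‖f z‖ ^ 2 : ℝ) : ℂ) ∂(stateMeasure Φ x) := by
    refine (inner_self_eq_norm_sq_to_K (𝕜 := ℂ) (Φ f x)).symm.trans ?_
    rw [← inner_starAlgHom_star_mul, ← integral_stateMeasure]
    congr 1
    ext z
    simp [Complex.conj_mul']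
  rw [integral_complex_ofReal] at h1
  have h2 : ‖Φ f x‖ ^ 2 = ∫ z, ‖f z‖ ^ 2 ∂(stateMeasure Φ x) := by exact_mod_cast h1
  rw [hmem.eLpNorm_eq_integral_rpow_norm (by simp) (by simp), ← ofReal_norm]
  congr 1
  simp only [ENNReal.toReal_ofNat, Real.rpow_ofNat]
  rw [← h2, ← one_div, ← Real.sqrt_eq_rpow, Real.sqrt_sq (norm_nonneg _)]

/-- The filter of approximation in the mean square, with respect to all vector states, to the
indicator function of `Δ` by continuous functions. -/
def indicatorFilter (Δ : Set X) : Filter C(X, ℂ) :=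
  ⨅ x : H, comap (fun f : C(X, ℂ) => eLpNorm (⇑f - Δ.indicator 1) 2 (stateMeasure Φ x)) (𝓝 0)

variable {Δ : Set X}

/-- Finitely many vectors can be served at once: approximate the indicator in `L²` of the sum of
their state measures, which dominates each of them. Having one filter for all vectors makes the
limit operator linear. -/
lemma indicatorFilter_neBot (hΔ : MeasurableSet Δ) : (indicatorFilter Φ Δ).NeBot := by
  rw [neBot_iff, Ne, ← empty_mem_iff_bot, indicatorFilter, mem_iInf]
  rintro ⟨I, hI, V, hV, hempty⟩
  have := hI.to_subtype
  have hev : ∀ i : I, ∀ᶠ ε : ENNReal in 𝓝[>] 0, ∀ f : C(X, ℂ),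
      eLpNorm (⇑f - Δ.indicator 1) 2 (stateMeasure Φ i) ≤ ε → f ∈ V i := by
    intro i
    obtain ⟨U, hU, hUV⟩ := mem_comap.mp (hV i)
    obtain ⟨δ, hδ, hδU⟩ := ENNReal.nhds_zero_basis_Iic.mem_iff.mp hU
    filter_upwards [mem_nhdsWithin_of_mem_nhds (Iic_mem_nhds hδ)] with ε hε f hf
    exact hUV (hδU (hf.trans hε))
  obtain ⟨ε, hε, hε0⟩ := ((eventually_all.mpr hev).and self_mem_nhdsWithin).exists
  have hmem : MemLp (Δ.indicator (1 : X → ℂ)) 2 (∑ i ∈ hI.toFinset, stateMeasure Φ i) :=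
    (memLp_const (1 : ℂ)).indicator hΔ
  obtain ⟨g, hg, -⟩ := hmem.exists_boundedContinuous_eLpNorm_sub_le (by simp) hε0.ne'
  have hgV : g.toContinuousMap ∈ ⋂ i, V i := by
    refine Set.mem_iInter.mpr fun i => hε i _ ?_
    rw [eLpNorm_sub_comm]
    refine le_trans (eLpNorm_mono_measure _ ?_) hg
    exact Finset.single_le_sum (f := fun i => stateMeasure Φ i) (fun _ _ => Measure.zero_le _)
      (hI.mem_toFinset.mpr i.2)
  rw [← hempty] at hgV
  exact hgV

lemma tendsto_indicatorFilter (Δ : Set X) (x : H) :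
    Tendsto (fun f : C(X, ℂ) => eLpNorm (⇑f - Δ.indicator 1) 2 (stateMeasure Φ x))
      (indicatorFilter Φ Δ) (𝓝 0) :=
  tendsto_iff_comap.mpr (iInf_le _ x)

lemma memLp_continuousMap (f : C(X, ℂ)) (x : H) : MemLp f 2 (stateMeasure Φ x) :=
  f.continuous.memLp_of_hasCompactSupport (HasCompactSupport.of_compactSpace _)

lemma memLp_indicator_one (hΔ : MeasurableSet Δ) (x : H) :
    MemLp (Δ.indicator (1 : X → ℂ)) 2 (stateMeasure Φ x) :=
  (memLp_const (1 : ℂ)).indicator hΔ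

lemma tendsto_eLpNorm_indicatorFilter (hΔ : MeasurableSet Δ) (x : H) :
    Tendsto (fun f : C(X, ℂ) => eLpNorm f 2 (stateMeasure Φ x))
      (indicatorFilter Φ Δ) (𝓝 (eLpNorm (Δ.indicator (1 : X → ℂ)) 2 (stateMeasure Φ x))) := by
  have h0 := tendsto_indicatorFilter Φ Δ x
  have hm := memLp_indicator_one Φ hΔ x
  refine tendsto_of_tendsto_of_tendsto_of_le_of_le (g := fun f : C(X, ℂ) =>
      eLpNorm (Δ.indicator (1 : X → ℂ)) 2 (stateMeasure Φ x) -
        eLpNorm (⇑f - Δ.indicator 1) 2 (stateMeasure Φ x))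
    (h := fun f : C(X, ℂ) => eLpNorm (⇑f - Δ.indicator 1) 2 (stateMeasure Φ x) +
      eLpNorm (Δ.indicator (1 : X → ℂ)) 2 (stateMeasure Φ x)) ?_ ?_ ?_ ?_
  · simpa using ENNReal.Tendsto.sub (tendsto_const_nhds (x :=
      eLpNorm (Δ.indicator (1 : X → ℂ)) 2 (stateMeasure Φ x))) h0 (Or.inl hm.eLpNorm_ne_top)
  · simpa using h0.add_const (eLpNorm (Δ.indicator (1 : X → ℂ)) 2 (stateMeasure Φ x))
  · intro f
    rw [tsub_le_iff_right, eLpNorm_sub_comm, add_comm]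
    have := eLpNorm_add_le (μ := stateMeasure Φ x) (p := 2)
      (hm.sub (memLp_continuousMap Φ f x)).1 (memLp_continuousMap Φ f x).1 (by norm_num)
    simpa [add_comm] using this
  · intro f
    have := eLpNorm_add_le (μ := stateMeasure Φ x) (p := 2)
      ((memLp_continuousMap Φ f x).sub hm).1 hm.1 (by norm_num)
    simpa using this

lemma tendsto_integral_indicatorFilter (hΔ : MeasurableSet Δ) (x : H) :
    Tendsto (fun f : C(X, ℂ) => ∫ z, f z ∂(stateMeasure Φ x))
      (indicatorFilter Φ Δ) (𝓝 ((stateMeasure Φ x).real Δ : ℂ)) := by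
  have h1 : ((stateMeasure Φ x).real Δ : ℂ) =
      ∫ z, Δ.indicator (1 : X → ℂ) z ∂(stateMeasure Φ x) := by
    rw [integral_indicator hΔ]
    simp
  rw [h1]
  refine tendsto_integral_of_L1' _ (memLp_indicator_one Φ hΔ x).1
    (Eventually.of_forall fun f => (memLp_continuousMap Φ f x).integrable (by norm_num)) ?_
  have h0 := tendsto_indicatorFilter Φ Δ x
  refine tendsto_of_tendsto_of_tendsto_of_le_of_le tendsto_const_nhds (h := fun f : C(X, ℂ) =>
      eLpNorm (⇑f - Δ.indicator 1) 2 (stateMeasure Φ x) *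
      (stateMeasure Φ x) Set.univ ^ (1 / (1 : ENNReal).toReal - 1 / (2 : ENNReal).toReal)) ?_
      (fun f => zero_le) ?_
  · have := ENNReal.Tendsto.mul_const (b := (stateMeasure Φ x) Set.univ ^
      (1 / (1 : ENNReal).toReal - 1 / (2 : ENNReal).toReal)) h0 (Or.inr ?_)
    · simpa using this
    · exact ENNReal.rpow_ne_top_of_nonneg (by norm_num) (measure_ne_top _ _)
  · intro f
    exact eLpNorm_le_eLpNorm_mul_rpow_measure_univ (by norm_num)
      ((memLp_continuousMap Φ f x).sub (memLp_indicator_one Φ hΔ x)).1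

/-- By the `L²` isometry the vectors `Φ(f) x` form a Cauchy filter as soon as the functions `f`
approach the indicator in `L²`. -/
lemma exists_tendsto_indicatorFilter (hΔ : MeasurableSet Δ) (x : H) :
    ∃ y, Tendsto (fun f => Φ f x) (indicatorFilter Φ Δ) (𝓝 y) := by
  have := indicatorFilter_neBot Φ hΔ
  apply CompleteSpace.complete
  refine EMetric.cauchy_iff.mpr ⟨(this.map _).ne, fun ε hε => ?_⟩
  have hev := (tendsto_order.1 (tendsto_indicatorFilter Φ Δ x)).2 (ε / 2) (ENNReal.half_pos hε.ne')
  refine ⟨_, image_mem_map hev, ?_⟩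
  rintro _ ⟨f, hf, rfl⟩ _ ⟨g, hg, rfl⟩
  have h1 : edist (Φ f x) (Φ g x) = eLpNorm (⇑f - ⇑g) 2 (stateMeasure Φ x) := by
    rw [edist_eq_enorm_sub, ← ContinuousMap.coe_sub, ← enorm_starAlgHom_apply, map_sub]
    rfl
  have hm := memLp_indicator_one Φ hΔ x
  have h2 := eLpNorm_sub_le (μ := stateMeasure Φ x) (p := 2)
    ((memLp_continuousMap Φ f x).sub hm).1 ((memLp_continuousMap Φ g x).sub hm).1 (by norm_num)
  rw [sub_sub_sub_cancel_right] at h2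
  rw [h1]
  calc _ ≤ _ := h2
    _ < ε / 2 + ε / 2 := ENNReal.add_lt_add hf hg
    _ = ε := ENNReal.add_halves ε

lemma stateMeasure_real_univ (x : H) : (stateMeasure Φ x).real Set.univ = ‖x‖ ^ 2 := by
  have := integral_stateMeasure Φ 1 x
  simp only [ContinuousMap.one_apply, integral_const, map_one, one_apply_eq_self] at this
  have h3 : inner ℂ x x = ((‖x‖ ^ 2 : ℝ) : ℂ) := by
    rw [inner_self_eq_norm_sq_to_K]; norm_cast
  rw [h3] at this
  have h4 : ((stateMeasure Φ x).real Set.univ : ℂ) = ((‖x‖ ^ 2 : ℝ) : ℂ) := by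
    simpa using this
  exact_mod_cast h4

/-- For a Borel set `Δ`, the extension of the representation `Φ` to the indicator function. -/
lemma exists_indicator_operator (hΔ : MeasurableSet Δ) : ∃ P : H →L[ℂ] H, ∀ x,
    inner ℂ x (P x) = ((stateMeasure Φ x).real Δ : ℂ) ∧ ‖P x‖ ^ 2 = (stateMeasure Φ x).real Δ := by
  have := indicatorFilter_neBot Φ hΔ
  choose P hP using exists_tendsto_indicatorFilter Φ hΔ
  have hin : ∀ x, inner ℂ x (P x) = ((stateMeasure Φ x).real Δ : ℂ) := by
    intro x
    refine tendsto_nhds_unique (tendsto_const_nhds.inner (hP x)) ?_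
    simpa only [integral_stateMeasure] using tendsto_integral_indicatorFilter Φ hΔ x
  have hnorm : ∀ x, ‖P x‖ ^ 2 = (stateMeasure Φ x).real Δ := by
    intro x
    have h1 : ‖P x‖ₑ = eLpNorm (Δ.indicator (1 : X → ℂ)) 2 (stateMeasure Φ x) := by
      refine tendsto_nhds_unique (hP x).enorm ?_
      simpa only [enorm_starAlgHom_apply] using tendsto_eLpNorm_indicatorFilter Φ hΔ x
    have h2 : ‖P x‖ₑ ^ 2 = stateMeasure Φ x Δ := by
      rw [h1]
      have := eLpNorm_indicator_const (μ := stateMeasure Φ x) (c := (1 : ℂ)) hΔ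
        (p := 2) (by norm_num) (by norm_num)
      change eLpNorm (Δ.indicator fun _ => (1 : ℂ)) 2 (stateMeasure Φ x) ^ 2 = _
      rw [this, enorm_one, one_mul, ← ENNReal.rpow_natCast, ← ENNReal.rpow_mul]
      simp
    rw [Measure.real, ← h2]
    simp
  have hle : ∀ x, ‖P x‖ ≤ 1 * ‖x‖ := by
    intro x
    have h1 := stateMeasure_real_univ Φ x
    have h2 : ‖P x‖ ^ 2 ≤ ‖x‖ ^ 2 := by
      rw [hnorm, ← h1]
      exact measureReal_mono (Set.subset_univ _)
    rw [one_mul]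
    exact le_of_sq_le_sq h2 (norm_nonneg _)
  -- A pointwise limit of linear maps along a single filter is linear.
  refine ⟨LinearMap.mkContinuous (linearMapOfTendsto P (fun f => (Φ f).toLinearMap)
    (tendsto_pi_nhds.mpr hP)) 1 hle, fun x => ⟨hin x, hnorm x⟩⟩

end FunctionalRepresentation

/-! ### Spectral measures of normal operators -/

section Existence

open MeasureTheory Filter

variable {H : Type*} [NormedAddCommGroup H] [InnerProductSpace ℂ H] [CompleteSpace H]

omit [CompleteSpace H] in
lemma ContinuousLinearMap.ext_inner_self {S T : H →L[ℂ] H}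
    (h : ∀ x, inner ℂ x (S x) = inner ℂ x (T x)) : S = T := by
  have := (ext_inner_map S.toLinearMap T.toLinearMap).mp fun x => by
    have := congrArg (starRingEnd ℂ) (h x)
    simpa using this
  exact ContinuousLinearMap.coe_injective this

/-- A projection valued measure from a family of finite measures that are given by operators. -/
def ProjMeasure.ofMeasures (μ : H → Measure ℂ) [∀ x, IsFiniteMeasure (μ x)]
    (huniv : ∀ x, (μ x).real Set.univ = ‖x‖ ^ 2)
    (P : Set ℂ → (H →L[ℂ] H))
    (hP : ∀ Δ, MeasurableSet Δ → ∀ x, inner ℂ x (P Δ x) = ((μ x).real Δ : ℂ))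
    (hP' : ∀ Δ, MeasurableSet Δ → ∀ x, ‖P Δ x‖ ^ 2 = (μ x).real Δ) : ProjMeasure H where
  proj := P
  isStarProjection Δ hΔ := by
    have hsa : ContinuousLinearMap.adjoint (P Δ) = P Δ := by
      refine ContinuousLinearMap.ext_inner_self fun x => ?_
      rw [ContinuousLinearMap.adjoint_inner_right, ← inner_conj_symm, hP Δ hΔ]
      simp
    refine ⟨?_, ContinuousLinearMap.isSelfAdjoint_iff'.mpr hsa⟩
    -- `(P x, P x)` and `(P x, x)` are both the measure of `Δ`, and `P` is self-adjoint, so `P² =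
    -- P`.
    refine ContinuousLinearMap.ext_inner_self fun x => ?_
    rw [mul_apply_eq_comp, ← ContinuousLinearMap.adjoint_inner_left, hsa, hP Δ hΔ, ← hP' Δ hΔ,
      inner_self_eq_norm_sq_to_K]
    simp
  empty := ContinuousLinearMap.ext_inner_self fun x => by
    rw [hP _ MeasurableSet.empty]
    simp
  univ := ContinuousLinearMap.ext_inner_self fun x => by
    rw [hP _ MeasurableSet.univ, huniv, one_apply_eq_self, inner_self_eq_norm_sq_to_K]
    simp
  hasSum Δ hΔ hd x := by
    have hfin : ∀ s : Finset ℕ, MeasurableSet (⋃ i ∈ s, Δ i) := fun s =>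
      s.measurableSet_biUnion fun i _ => hΔ i
    have hunion : MeasurableSet (⋃ i, Δ i) := MeasurableSet.iUnion hΔ
    have hreal : ∀ s : Finset ℕ, ∀ y, ∑ i ∈ s, (μ y).real (Δ i) = (μ y).real (⋃ i ∈ s, Δ i) := by
      intro s y
      rw [measureReal_biUnion_finset (fun i _ j _ hij => hd hij) fun i _ => hΔ i]
    have hsub : ∀ s : Finset ℕ, P (⋃ i, Δ i) - ∑ i ∈ s, P (Δ i) =
        P ((⋃ i, Δ i) \ ⋃ i ∈ s, Δ i) := by
      intro s
      refine ContinuousLinearMap.ext_inner_self fun y => ?_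
      rw [hP _ (hunion.diff (hfin s)), measureReal_sdiff
        (Set.iUnion₂_subset fun i _ => Set.subset_iUnion Δ i) (hfin s), ← hreal]
      simp only [sub_apply, sum_apply, inner_sub_right,
        inner_sum, hP _ hunion, hP _ (hΔ _)]
      push_cast
      rfl
    have hs : HasSum (fun i => (μ x).real (Δ i)) ((μ x).real (⋃ i, Δ i)) := by
      have h1 := measure_iUnion (μ := μ x) hd hΔ
      have h2 : ∑' i, μ x (Δ i) ≠ ⊤ := by rw [← h1]; exact measure_ne_top _ _
      have h3 := ENNReal.hasSum_toReal h2
      rwa [← ENNReal.tsum_toReal_eq fun i => measure_ne_top _ _, ← h1] at h3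
    refine tendsto_iff_norm_sub_tendsto_zero.mpr ?_
    -- The remainder of the series is again some `P Δ' x`, whose norm is the square root of `μ x
    -- Δ'`. Strong convergence is thus countable additivity of `μ x`.
    have h4 : Tendsto (fun s : Finset ℕ => √((μ x).real (⋃ i, Δ i) - ∑ i ∈ s, (μ x).real (Δ i)))
        atTop (𝓝 0) := by
      have := ((tendsto_const_nhds (x := (μ x).real (⋃ i, Δ i))).sub hs).sqrt
      simpa using this
    refine h4.congr fun s => ?_
    have h5 := congrArg (fun A : H →L[ℂ] H => A x) (hsub s)
    simp only [sub_apply, sum_apply] at h5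
    rw [norm_sub_rev, h5, ← Real.sqrt_sq (norm_nonneg (P ((⋃ i, Δ i) \ ⋃ i ∈ s, Δ i) x)),
      hP' _ (hunion.diff (hfin s)), measureReal_sdiff
        (Set.iUnion₂_subset fun i _ => Set.subset_iUnion Δ i) (hfin s), hreal]

lemma ProjMeasure.measure_apply (E : ProjMeasure H) (x : H) {Δ : Set ℂ} (hΔ : MeasurableSet Δ) :
    E.measure x Δ = ENNReal.ofReal (inner ℂ x (E.proj Δ x)).re :=
  Measure.ofMeasurable_apply Δ hΔ

/-- The spectral theorem: a bounded normal operator has a spectral measure. -/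
theorem exists_isSpectralMeasureOf (M : H →L[ℂ] H) (hM : IsStarNormal M) :
    ∃ E : ProjMeasure H, E.IsSpectralMeasureOf M := by
  classical
  let Φ : C(spectrum ℂ M, ℂ) →⋆ₐ[ℂ] (H →L[ℂ] H) := cfcHom hM
  have hcoe : Measurable ((↑) : spectrum ℂ M → ℂ) := measurable_subtype_coe
  have hpre : ∀ Δ : Set ℂ, MeasurableSet Δ → MeasurableSet ((↑) ⁻¹' Δ : Set (spectrum ℂ M)) :=
    fun Δ hΔ => hcoe hΔ
  let P : Set ℂ → (H →L[ℂ] H) := fun Δ => if hΔ : MeasurableSet Δ then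
    (exists_indicator_operator Φ (hpre Δ hΔ)).choose else 0
  have hP : ∀ Δ (hΔ : MeasurableSet Δ), P Δ = (exists_indicator_operator Φ (hpre Δ hΔ)).choose :=
    fun Δ hΔ => dif_pos hΔ
  have hmap : ∀ Δ, MeasurableSet Δ → ∀ x, ((stateMeasure Φ x).map ((↑) : spectrum ℂ M → ℂ)).real Δ =
      (stateMeasure Φ x).real ((↑) ⁻¹' Δ) := fun Δ hΔ x => map_measureReal_apply hcoe hΔ
  have hone : ∀ x, (stateMeasure Φ x).real Set.univ = ‖x‖ ^ 2 := stateMeasure_real_univ Φ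
  have hin : ∀ Δ, MeasurableSet Δ → ∀ x, inner ℂ x (P Δ x) =
      (((stateMeasure Φ x).map ((↑) : spectrum ℂ M → ℂ)).real Δ : ℂ) := by
    intro Δ hΔ x
    rw [hP Δ hΔ, hmap Δ hΔ]
    exact ((exists_indicator_operator Φ (hpre Δ hΔ)).choose_spec x).1
  have hnorm : ∀ Δ, MeasurableSet Δ → ∀ x, ‖P Δ x‖ ^ 2 =
      ((stateMeasure Φ x).map ((↑) : spectrum ℂ M → ℂ)).real Δ := by
    intro Δ hΔ x
    rw [hP Δ hΔ, hmap Δ hΔ]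
    exact ((exists_indicator_operator Φ (hpre Δ hΔ)).choose_spec x).2
  have huniv : ∀ x, ((stateMeasure Φ x).map ((↑) : spectrum ℂ M → ℂ)).real Set.univ =
      ‖x‖ ^ 2 := by
    intro x
    rw [hmap _ MeasurableSet.univ, Set.preimage_univ, hone]
  let E := ProjMeasure.ofMeasures (fun x => (stateMeasure Φ x).map ((↑) : spectrum ℂ M → ℂ))
    huniv P hin hnorm
  have hE : ∀ x, E.measure x = (stateMeasure Φ x).map ((↑) : spectrum ℂ M → ℂ) := by
    intro x
    ext Δ hΔ
    rw [E.measure_apply x hΔ]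
    change ENNReal.ofReal (inner ℂ x (P Δ x)).re = _
    rw [hin Δ hΔ, Complex.ofReal_re, ofReal_measureReal]
  refine ⟨E, ?_, fun x => ?_⟩
  · have hσ : MeasurableSet (spectrum ℂ M) := (spectrum.isClosed M).measurableSet
    refine ContinuousLinearMap.ext_inner_self fun x => ?_
    change inner ℂ x (P _ x) = _
    rw [hin _ hσ, hmap _ hσ, Subtype.coe_preimage_self, hone, one_apply_eq_self,
      inner_self_eq_norm_sq_to_K]
    simp
  · rw [hE, integral_map hcoe.aemeasurable (by fun_prop)]
    have := integral_stateMeasure Φ ((ContinuousMap.id ℂ).restrict (spectrum ℂ M)) x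
    rw [cfcHom_id hM] at this
    exact this.symm

end Existence

/-! ### Bounded Borel functions and uniform approximation -/

section BoundedBorel

open MeasureTheory Filter

/-- A bounded Borel function on the plane. -/
def IsBoundedBorel (f : ℂ → ℂ) : Prop := Measurable f ∧ ∃ C : ℝ, ∀ z, ‖f z‖ ≤ C

namespace IsBoundedBorel

variable {f g : ℂ → ℂ}

lemma const (c : ℂ) : IsBoundedBorel fun _ => c := ⟨measurable_const, ‖c‖, fun _ => le_rfl⟩

lemma add (hf : IsBoundedBorel f) (hg : IsBoundedBorel g) : IsBoundedBorel (f + g) := by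
  obtain ⟨hm, C, hC⟩ := hf
  obtain ⟨hm', C', hC'⟩ := hg
  exact ⟨hm.add hm', C + C', fun z => (norm_add_le _ _).trans (add_le_add (hC z) (hC' z))⟩

lemma mul (hf : IsBoundedBorel f) (hg : IsBoundedBorel g) : IsBoundedBorel (f * g) := by
  obtain ⟨hm, C, hC⟩ := hf
  obtain ⟨hm', C', hC'⟩ := hg
  refine ⟨hm.mul hm', C * C', fun z => ?_⟩
  rw [Pi.mul_apply, norm_mul]
  exact mul_le_mul (hC z) (hC' z) (norm_nonneg _) ((norm_nonneg _).trans (hC z))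

lemma smul (hf : IsBoundedBorel f) (c : ℂ) : IsBoundedBorel (c • f) := (const c).mul hf

lemma sub (hf : IsBoundedBorel f) (hg : IsBoundedBorel g) : IsBoundedBorel (f - g) := by
  have := hf.add (hg.smul (-1))
  rwa [neg_one_smul, ← sub_eq_add_neg] at this

lemma conj (hf : IsBoundedBorel f) : IsBoundedBorel fun z => (starRingEnd ℂ) (f z) := by
  obtain ⟨hm, C, hC⟩ := hf
  exact ⟨Complex.continuous_conj.measurable.comp hm, C, fun z => by simpa using hC z⟩

lemma integrable (hf : IsBoundedBorel f) (μ : Measure ℂ) [IsFiniteMeasure μ] :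
    Integrable f μ := by
  obtain ⟨hm, C, hC⟩ := hf
  exact Integrable.of_bound hm.aestronglyMeasurable C (Eventually.of_forall hC)

lemma of_simpleFunc (f : SimpleFunc ℂ ℂ) : IsBoundedBorel f :=
  ⟨f.measurable, f.exists_forall_norm_le⟩

/-- Bounded Borel functions are uniform limits of simple functions. -/
lemma exists_simpleFunc (hf : IsBoundedBorel f) {ε : ℝ} (hε : 0 < ε) :
    ∃ g : SimpleFunc ℂ ℂ, ∀ z, ‖f z - g z‖ ≤ ε := by
  obtain ⟨hm, C, hC⟩ := hf
  -- The values are rounded down to a grid of mesh `δ`. Real and imaginary part each contribute at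
  -- most `δ` to the error, and boundedness leaves only finitely many grid points.
  set δ := ε / 2 with hδ
  have hδ0 : 0 < δ := by positivity
  let F : ℤ × ℤ → ℂ := fun k => ⟨δ * k.1, δ * k.2⟩
  let k : ℂ → ℤ × ℤ := fun z => (⌊(f z).re / δ⌋, ⌊(f z).im / δ⌋)
  have hk : Measurable k := by
    refine Measurable.prodMk ?_ ?_
    · exact Int.measurable_floor.comp ((Complex.measurable_re.comp hm).div_const δ)
    · exact Int.measurable_floor.comp ((Complex.measurable_im.comp hm).div_const δ)
  have hfloor : ∀ t : ℝ, |t| ≤ C → ⌊t / δ⌋ ∈ Set.Icc ⌊-C / δ⌋ ⌊C / δ⌋ := by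
    intro t ht
    rw [abs_le] at ht
    exact ⟨Int.floor_le_floor (by gcongr; exact ht.1), Int.floor_le_floor (by gcongr; exact ht.2)⟩
  have hfin : (Set.range (F ∘ k)).Finite := by
    refine ((Set.finite_Icc ⌊-C / δ⌋ ⌊C / δ⌋).prod (Set.finite_Icc ⌊-C / δ⌋ ⌊C / δ⌋)).image F
      |>.subset ?_
    rintro _ ⟨z, rfl⟩
    exact ⟨k z, ⟨hfloor _ ((Complex.abs_re_le_norm _).trans (hC z)),
      hfloor _ ((Complex.abs_im_le_norm _).trans (hC z))⟩, rfl⟩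
  have hmeas : Measurable (F ∘ k) := (measurable_of_countable F).comp hk
  refine ⟨⟨F ∘ k, fun z => hmeas (measurableSet_singleton z), hfin⟩, fun z => ?_⟩
  have herr : ∀ t : ℝ, |t - δ * ⌊t / δ⌋| ≤ δ := by
    intro t
    have h1 := Int.floor_le (t / δ)
    have h2 := Int.lt_floor_add_one (t / δ)
    rw [le_div_iff₀ hδ0] at h1
    rw [div_lt_iff₀ hδ0] at h2
    rw [abs_le]
    constructor <;> linarith
  refine (Complex.norm_le_abs_re_add_abs_im _).trans ?_
  have h1 := herr (f z).re
  have h2 := herr (f z).im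
  change |(f z).re - δ * ⌊(f z).re / δ⌋| + |(f z).im - δ * ⌊(f z).im / δ⌋| ≤ ε
  linarith

/-- Simple functions are sums of indicators and are uniformly dense, so stability under sums and
uniform limits is all that is needed beyond indicators. -/
lemma induction {P : (ℂ → ℂ) → Prop}
    (indicator : ∀ (c : ℂ) (Δ : Set ℂ), MeasurableSet Δ → P (Δ.indicator fun _ => c))
    (add : ∀ f g, IsBoundedBorel f → IsBoundedBorel g → P f → P g → P (f + g))
    (lim : ∀ f, IsBoundedBorel f → (∀ ε > 0, ∃ g, IsBoundedBorel g ∧ P g ∧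
      ∀ z, ‖f z - g z‖ ≤ ε) → P f) (hf : IsBoundedBorel f) : P f := by
  have hsimple : ∀ g : SimpleFunc ℂ ℂ, P g := by
    refine SimpleFunc.induction ?_ ?_
    · intro c Δ hΔ
      have : (⇑(SimpleFunc.piecewise Δ hΔ (SimpleFunc.const ℂ c) (SimpleFunc.const ℂ 0)) : ℂ → ℂ) =
          Δ.indicator fun _ => c := by
        ext z
        simp [Set.indicator, Set.piecewise]
      rw [this]
      exact indicator c Δ hΔ
    · intro f g _ hf hg
      exact add f g (of_simpleFunc f) (of_simpleFunc g) hf hg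
  refine lim f hf fun ε hε => ?_
  obtain ⟨g, hg⟩ := hf.exists_simpleFunc hε
  exact ⟨g, of_simpleFunc g, hsimple g, hg⟩

end IsBoundedBorel

end BoundedBorel

/-! ### Operator norm and quadratic form -/

section Numerical

variable {H : Type*} [NormedAddCommGroup H] [InnerProductSpace ℂ H] [CompleteSpace H]

-- Polarization expresses `(D y, x)` by four values of the quadratic form. When `‖x‖ = ‖y‖`, the
-- parallelogram law bounds their sum by `8 |C| ‖y‖²`; division by `4` leaves the factor `2`.
omit [CompleteSpace H] in
lemma ContinuousLinearMap.opNorm_le_of_inner_self_le {D : H →L[ℂ] H} {C : ℝ}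
    (h : ∀ x, ‖inner ℂ x (D x)‖ ≤ C * ‖x‖ ^ 2) : ‖D‖ ≤ 2 * |C| := by
  refine D.opNorm_le_bound (by positivity) fun y => ?_
  by_cases hy : D y = 0
  · rw [hy, norm_zero]; positivity
  have hDy : ‖D y‖ ≠ 0 := norm_ne_zero_iff.mpr hy
  have h' : ∀ z, ‖inner ℂ (D z) z‖ ≤ |C| * ‖z‖ ^ 2 := fun z => by
    rw [norm_inner_symm]
    exact (h z).trans (by gcongr; exact le_abs_self C)
  -- The vector `D y` rescaled to the length of `y`, so that pairing it with `D y` gives `‖y‖ ‖D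
  -- y‖`.
  set x := ((‖y‖ / ‖D y‖ : ℝ) : ℂ) • D y with hx
  have hxn : ‖x‖ = ‖y‖ := by
    rw [hx, norm_smul, Complex.norm_real, norm_div, norm_norm, norm_norm, div_mul_cancel₀ _ hDy]
  have h1 := inner_map_polarization D.toLinearMap x y
  have h2 : ‖inner ℂ (D y) x‖ = ‖y‖ * ‖D y‖ := by
    rw [hx, inner_smul_right, norm_mul, inner_self_eq_norm_sq_to_K]
    simp
    field_simp
  have hpar1 := parallelogram_law_with_norm ℂ x y
  have hpar2 := parallelogram_law_with_norm ℂ x (Complex.I • y)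
  have hI : ‖Complex.I • y‖ = ‖y‖ := by simp [norm_smul]
  rw [hI] at hpar2
  have h3 : ‖inner ℂ (D y) x‖ ≤ 2 * |C| * ‖y‖ ^ 2 := by
    simp only [ContinuousLinearMap.coe_coe] at h1
    rw [h1, norm_div]
    have h4 := norm_sub_le (inner ℂ (D (x + y)) (x + y)) (inner ℂ (D (x - y)) (x - y))
    have h5 := norm_add_le (inner ℂ (D (x + y)) (x + y) - inner ℂ (D (x - y)) (x - y))
      (Complex.I * inner ℂ (D (x + Complex.I • y)) (x + Complex.I • y))
    have h6 := norm_sub_le (inner ℂ (D (x + y)) (x + y) - inner ℂ (D (x - y)) (x - y) +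
      Complex.I * inner ℂ (D (x + Complex.I • y)) (x + Complex.I • y))
      (Complex.I * inner ℂ (D (x - Complex.I • y)) (x - Complex.I • y))
    simp only [norm_mul, Complex.norm_I, one_mul] at h5 h6
    have h7 := h' (x + y)
    have h8 := h' (x - y)
    have h9 := h' (x + Complex.I • y)
    have h10 := h' (x - Complex.I • y)
    rw [hxn] at hpar1 hpar2
    have h11 : ‖(4 : ℂ)‖ = 4 := by simp
    rw [h11, div_le_iff₀ (by norm_num)]
    nlinarith [abs_nonneg C]
  rw [h2] at h3
  by_cases hy0 : ‖y‖ = 0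
  · rw [norm_eq_zero] at hy0
    simp [hy0] at hy
  · have : 0 < ‖y‖ := lt_of_le_of_ne (norm_nonneg _) (Ne.symm hy0)
    nlinarith

end Numerical

/-! ### Integration with respect to a projection valued measure -/

namespace ProjMeasure

open MeasureTheory Filter

variable {H : Type*} [NormedAddCommGroup H] [InnerProductSpace ℂ H] [CompleteSpace H]
variable (E : ProjMeasure H)

lemma adjoint_proj {Δ : Set ℂ} (hΔ : MeasurableSet Δ) :
    ContinuousLinearMap.adjoint (E.proj Δ) = E.proj Δ :=
  ContinuousLinearMap.isSelfAdjoint_iff'.mp (E.isStarProjection Δ hΔ).isSelfAdjoint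

lemma proj_mul_self {Δ : Set ℂ} (hΔ : MeasurableSet Δ) : E.proj Δ * E.proj Δ = E.proj Δ :=
  (E.isStarProjection Δ hΔ).isIdempotentElem.eq

instance (x : H) : IsFiniteMeasure (E.measure x) :=
  ⟨by rw [E.measure_apply x MeasurableSet.univ]; exact ENNReal.ofReal_lt_top⟩

lemma inner_proj_eq_re {Δ : Set ℂ} (hΔ : MeasurableSet Δ) (x : H) :
    inner ℂ x (E.proj Δ x) = ((inner ℂ x (E.proj Δ x)).re : ℂ) := by
  rw [eq_comm, ← Complex.conj_eq_iff_re, inner_conj_symm, ← ContinuousLinearMap.adjoint_inner_right,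
    E.adjoint_proj hΔ]

lemma inner_proj {Δ : Set ℂ} (hΔ : MeasurableSet Δ) (x : H) :
    inner ℂ x (E.proj Δ x) = ((E.measure x).real Δ : ℂ) := by
  rw [Measure.real, E.measure_apply x hΔ, ENNReal.toReal_ofReal (E.re_inner_nonneg x hΔ),
    ← E.inner_proj_eq_re hΔ]

lemma measure_real_univ (x : H) : (E.measure x).real Set.univ = ‖x‖ ^ 2 := by
  have := E.inner_proj MeasurableSet.univ x
  rw [E.univ, one_apply_eq_self, inner_self_eq_norm_sq_to_K] at this
  exact Complex.ofReal_injective (by simpa using this.symm)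

lemma proj_union {Δ Δ' : Set ℂ} (hΔ : MeasurableSet Δ) (hΔ' : MeasurableSet Δ')
    (hd : Disjoint Δ Δ') : E.proj (Δ ∪ Δ') = E.proj Δ + E.proj Δ' := by
  refine ContinuousLinearMap.ext_inner_self fun x => ?_
  rw [add_apply, inner_add_right, E.inner_proj hΔ, E.inner_proj hΔ', E.inner_proj (hΔ.union hΔ'),
    measureReal_union hd hΔ']
  push_cast
  rfl

/-- Since the sum of the projections `P`, `Q` is idempotent, `PQ + QP = 0`. Multiplication by `P`
from the left and from the right shows `PQ = -PQP = QP`, hence `2PQ = 0`. -/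
lemma proj_mul_of_disjoint {Δ Δ' : Set ℂ} (hΔ : MeasurableSet Δ) (hΔ' : MeasurableSet Δ')
    (hd : Disjoint Δ Δ') : E.proj Δ * E.proj Δ' = 0 := by
  have h := E.proj_mul_self (hΔ.union hΔ')
  have h1 := E.proj_mul_self hΔ
  have h2 := E.proj_mul_self hΔ'
  rw [E.proj_union hΔ hΔ' hd] at h
  generalize E.proj Δ = P at *
  generalize E.proj Δ' = Q at *
  have h3 : P * Q + Q * P = 0 := by
    have : (P + Q) * (P + Q) = P * P + Q * Q + (P * Q + Q * P) := by noncomm_ring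
    rw [this, h1, h2] at h
    simpa using h
  have h4 : P * Q + P * Q * P = 0 := by
    have := congrArg (P * ·) h3
    simpa [mul_add, ← mul_assoc, h1] using this
  have h5 : P * Q * P + Q * P = 0 := by
    have := congrArg (· * P) h3
    simpa [add_mul, mul_assoc, h1] using this
  have h6 : P * Q = Q * P := by
    rw [eq_neg_of_add_eq_zero_left h4, eq_neg_of_add_eq_zero_right h5]
  rw [← h6, ← two_smul ℂ] at h3
  exact (smul_eq_zero.mp h3).resolve_left two_ne_zero

lemma proj_inter {Δ Δ' : Set ℂ} (hΔ : MeasurableSet Δ) (hΔ' : MeasurableSet Δ') :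
    E.proj Δ * E.proj Δ' = E.proj (Δ ∩ Δ') := by
  have h1 : E.proj Δ' = E.proj (Δ ∩ Δ') + E.proj (Δ' \ Δ) := by
    rw [← E.proj_union (hΔ.inter hΔ') (hΔ'.diff hΔ), Set.inter_comm, Set.inter_union_sdiff]
    exact Set.disjoint_left.mpr fun z h h' => h'.2 h.1
  have h2 : E.proj Δ = E.proj (Δ ∩ Δ') + E.proj (Δ \ Δ') := by
    rw [← E.proj_union (hΔ.inter hΔ') (hΔ.diff hΔ'), Set.inter_union_sdiff]
    exact Set.disjoint_left.mpr fun z h h' => h'.2 h.2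
  rw [h1, mul_add, E.proj_mul_of_disjoint hΔ (hΔ'.diff hΔ) Set.disjoint_sdiff_right, add_zero, h2,
    add_mul, E.proj_mul_self (hΔ.inter hΔ'), E.proj_mul_of_disjoint (hΔ.diff hΔ') (hΔ.inter hΔ'),
    add_zero]
  exact Set.disjoint_left.mpr fun z h h' => h.2 h'.2

lemma measure_proj {Δ : Set ℂ} (hΔ : MeasurableSet Δ) (x : H) :
    E.measure (E.proj Δ x) = (E.measure x).restrict Δ := by
  ext Δ' hΔ'
  rw [Measure.restrict_apply hΔ', E.measure_apply _ hΔ', E.measure_apply _ (hΔ'.inter hΔ),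
    Set.inter_comm, ← E.proj_inter hΔ hΔ', ← ContinuousLinearMap.adjoint_inner_right,
    E.adjoint_proj hΔ]
  congr 3
  have : E.proj Δ * (E.proj Δ' * E.proj Δ) = E.proj Δ * E.proj Δ' := by
    rw [E.proj_inter hΔ' hΔ, E.proj_inter hΔ (hΔ'.inter hΔ), E.proj_inter hΔ hΔ']
    congr 1
    ext z
    simp only [Set.mem_inter_iff]
    tauto
  exact congrArg (fun A : H →L[ℂ] H => A x) this

/-- `D = ∫ f dE`. -/
def IsIntegral (f : ℂ → ℂ) (D : H →L[ℂ] H) : Prop :=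
  ∀ x, inner ℂ x (D x) = ∫ z, f z ∂(E.measure x)

variable {E} {f g : ℂ → ℂ} {D D' : H →L[ℂ] H}

namespace IsIntegral

lemma unique (h : E.IsIntegral f D) (h' : E.IsIntegral f D') : D = D' :=
  ContinuousLinearMap.ext_inner_self fun x => (h x).trans (h' x).symm

lemma add (hf : IsBoundedBorel f) (hg : IsBoundedBorel g) (h : E.IsIntegral f D)
    (h' : E.IsIntegral g D') : E.IsIntegral (f + g) (D + D') := fun x => by
  simp only [Pi.add_apply]
  rw [add_apply, inner_add_right, h x, h' x, integral_add (hf.integrable _) (hg.integrable _)]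

lemma smul (c : ℂ) (h : E.IsIntegral f D) : E.IsIntegral (c • f) (c • D) := fun x => by
  simp only [Pi.smul_apply]
  rw [smul_apply, inner_smul_right, h x, integral_smul, smul_eq_mul]

lemma sub (hf : IsBoundedBorel f) (hg : IsBoundedBorel g) (h : E.IsIntegral f D)
    (h' : E.IsIntegral g D') : E.IsIntegral (f - g) (D - D') := fun x => by
  simp only [Pi.sub_apply]
  rw [sub_apply, inner_sub_right, h x, h' x, integral_sub (hf.integrable _) (hg.integrable _)]

lemma adjoint (h : E.IsIntegral f D) :
    E.IsIntegral (fun z => (starRingEnd ℂ) (f z)) (ContinuousLinearMap.adjoint D) := fun x => by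
  rw [ContinuousLinearMap.adjoint_inner_right, ← inner_conj_symm, h x, integral_conj]

lemma indicator_const (c : ℂ) {Δ : Set ℂ} (hΔ : MeasurableSet Δ) :
    E.IsIntegral (Δ.indicator fun _ => c) (c • E.proj Δ) := fun x => by
  rw [smul_apply, inner_smul_right, E.inner_proj hΔ, integral_indicator hΔ]
  simp [mul_comm]

/-- The factor `2` is lost in passing from the quadratic form to the norm. It is harmless: the bound
serves to turn uniform convergence of functions into norm convergence of operators. -/
lemma norm_le (h : E.IsIntegral f D) {C : ℝ} (hC : ∀ z, ‖f z‖ ≤ C) : ‖D‖ ≤ 2 * |C| := by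
  refine ContinuousLinearMap.opNorm_le_of_inner_self_le fun x => ?_
  rw [h x, ← E.measure_real_univ]
  exact norm_integral_le_of_norm_le_const (Eventually.of_forall hC)

end IsIntegral

/-- Commutation with the spectral projections is carried through the induction because it survives
sums and norm limits; together with uniqueness it then holds for every integral. -/
lemma exists_isIntegral_commute (E : ProjMeasure H) (hf : IsBoundedBorel f) :
    ∃ D, E.IsIntegral f D ∧ ∀ Δ, MeasurableSet Δ → Commute D (E.proj Δ) := by
  refine hf.induction (P := fun f => ∃ D, E.IsIntegral f D ∧
    ∀ Δ, MeasurableSet Δ → Commute D (E.proj Δ)) ?_ ?_ ?_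
  · intro c Δ hΔ
    refine ⟨_, IsIntegral.indicator_const c hΔ, fun Δ' hΔ' => Commute.smul_left ?_ c⟩
    rw [commute_iff_eq, E.proj_inter hΔ hΔ', E.proj_inter hΔ' hΔ, Set.inter_comm]
  · rintro f g hf hg ⟨D, hD, hDc⟩ ⟨D', hD', hDc'⟩
    exact ⟨D + D', hD.add hf hg hD', fun Δ hΔ => (hDc Δ hΔ).add_left (hDc' Δ hΔ)⟩
  · intro f hf hlim
    choose g hgb hg hfg using fun n : ℕ => hlim (1 / (n + 1)) (by positivity)
    choose D hD hDc using hg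
    -- The `m`-th and `n`-th approximants differ by at most `2/(m+1)`, and `norm_le` doubles this.
    have hdist : ∀ m n, m ≤ n → dist (D m) (D n) ≤ 4 * (1 / (m + 1)) := by
      intro m n hmn
      rw [dist_eq_norm]
      refine (((hD m).sub (hgb m) (hgb n) (hD n)).norm_le (C := 2 * (1 / (m + 1))) ?_).trans ?_
      · intro z
        have h1 := hfg m z
        have h2 := hfg n z
        have h3 : (1 : ℝ) / (n + 1) ≤ 1 / (m + 1) := by gcongr
        have h4 := norm_sub_le (f z - g n z) (f z - g m z)
        rw [sub_sub_sub_cancel_left] at h4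
        simp only [Pi.sub_apply]
        linarith
      · rw [abs_of_nonneg (by positivity)]
        linarith
    have hcau : CauchySeq D := by
      refine cauchySeq_of_le_tendsto_0 (fun n : ℕ => 8 * (1 / ((n : ℝ) + 1))) ?_ ?_
      · intro n m N hn hm
        have h1 := hdist N n hn
        have h2 := hdist N m hm
        have h3 := dist_triangle_left (D n) (D m) (D N)
        linarith
      · simpa using (tendsto_one_div_add_atTop_nhds_zero_nat (𝕜 := ℝ)).const_mul 8
    obtain ⟨D₀, hD₀⟩ := cauchySeq_tendsto_of_complete hcau
    refine ⟨D₀, fun x => ?_, fun Δ hΔ => ?_⟩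
    · have h1 : Tendsto (fun n => inner ℂ x (D n x)) atTop (𝓝 (inner ℂ x (D₀ x))) :=
        tendsto_const_nhds.inner (((ContinuousLinearMap.apply ℂ H x).continuous.tendsto D₀).comp hD₀)
      refine tendsto_nhds_unique h1 ?_
      simp_rw [hD _ x]
      rw [tendsto_iff_norm_sub_tendsto_zero]
      refine squeeze_zero (g := fun n : ℕ => 1 / ((n : ℝ) + 1) * (E.measure x).real Set.univ)
        (fun _ => norm_nonneg _) (fun n => ?_) ?_
      · rw [← integral_sub ((hgb n).integrable _) (hf.integrable _)]
        refine norm_integral_le_of_norm_le_const (Eventually.of_forall fun z => ?_)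
        rw [norm_sub_rev]
        exact hfg n z
      · simpa using (tendsto_one_div_add_atTop_nhds_zero_nat (𝕜 := ℝ)).mul_const
          ((E.measure x).real Set.univ)
    · refine tendsto_nhds_unique (hD₀.mul_const (E.proj Δ)) ?_
      simp_rw [fun n => (hDc n Δ hΔ).eq]
      exact hD₀.const_mul (E.proj Δ)

lemma exists_isIntegral (E : ProjMeasure H) (hf : IsBoundedBorel f) : ∃ D, E.IsIntegral f D :=
  (E.exists_isIntegral_commute hf).imp fun _ h => h.1

lemma IsIntegral.commute_proj (hf : IsBoundedBorel f) (h : E.IsIntegral f D) {Δ : Set ℂ}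
    (hΔ : MeasurableSet Δ) : Commute D (E.proj Δ) := by
  obtain ⟨D', hD', hc⟩ := E.exists_isIntegral_commute hf
  rw [h.unique hD']
  exact hc Δ hΔ

/-- As `D` commutes with `E(Δ)`, the form of `D E(Δ)` at `x` is that of `D` at `E(Δ) x`, and the
measure of `E(Δ) x` is that of `x` restricted to `Δ`. -/
lemma IsIntegral.mul_proj (hf : IsBoundedBorel f) (h : E.IsIntegral f D) {Δ : Set ℂ}
    (hΔ : MeasurableSet Δ) : E.IsIntegral (Δ.indicator f) (D * E.proj Δ) := fun x => by
  have h1 : D * E.proj Δ = E.proj Δ * (D * E.proj Δ) := by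
    rw [← mul_assoc, ← (h.commute_proj hf hΔ).eq, mul_assoc, E.proj_mul_self hΔ]
  rw [h1, mul_apply_eq_comp, ← ContinuousLinearMap.adjoint_inner_left, E.adjoint_proj hΔ,
    mul_apply_eq_comp, h (E.proj Δ x), E.measure_proj hΔ, integral_indicator hΔ]

/-- Multiplicativity for an indicator in the second factor is `mul_proj`; induction over bounded
Borel functions extends it to general `g` with `f` fixed. -/
lemma IsIntegral.mul (hf : IsBoundedBorel f) (hg : IsBoundedBorel g) (h : E.IsIntegral f D)
    (h' : E.IsIntegral g D') : E.IsIntegral (f * g) (D * D') := by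
  refine hg.induction (P := fun g => ∀ D', E.IsIntegral g D' → E.IsIntegral (f * g) (D * D'))
    ?_ ?_ ?_ D' h'
  · intro c Δ hΔ D' h'
    rw [h'.unique (IsIntegral.indicator_const c hΔ), mul_smul_comm]
    have : f * (Δ.indicator fun _ => c) = c • Δ.indicator f := by
      ext z
      by_cases hz : z ∈ Δ <;> simp [hz, mul_comm]
    rw [this]
    exact (h.mul_proj hf hΔ).smul c
  · intro g₁ g₂ hg₁ hg₂ h₁ h₂ D' h'
    obtain ⟨D₁, hD₁⟩ := E.exists_isIntegral hg₁
    obtain ⟨D₂, hD₂⟩ := E.exists_isIntegral hg₂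
    rw [h'.unique (hD₁.add hg₁ hg₂ hD₂), mul_add, mul_add]
    exact (h₁ D₁ hD₁).add (hf.mul hg₁) (hf.mul hg₂) (h₂ D₂ hD₂)
  · intro g hg hlim D' h' x
    obtain ⟨C, hC⟩ := hf.2
    have hC0 : 0 ≤ C := (norm_nonneg _).trans (hC 0)
    set K : ℝ := ‖x‖ * ‖D‖ * 2 * ‖x‖ + C * (E.measure x).real Set.univ with hK
    have hbound : ∀ ε > 0, ‖inner ℂ x ((D * D') x) - ∫ z, (f * g) z ∂(E.measure x)‖ ≤ ε * K := by
      intro ε hε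
      obtain ⟨g', hg', hP, hgg'⟩ := hlim ε hε
      obtain ⟨D₁, hD₁⟩ := E.exists_isIntegral hg'
      have h1 := hP D₁ hD₁ x
      have h2 := (h'.sub hg hg' hD₁).norm_le hgg'
      rw [abs_of_pos hε] at h2
      have h3 : ‖inner ℂ x ((D * D') x) - inner ℂ x ((D * D₁) x)‖ ≤ ε * (‖x‖ * ‖D‖ * 2 * ‖x‖) := by
        rw [← inner_sub_right, ← sub_apply, ← mul_sub]
        calc _ ≤ ‖x‖ * ‖(D * (D' - D₁)) x‖ := norm_inner_le_norm _ _
          _ ≤ ‖x‖ * (‖D‖ * (2 * ε) * ‖x‖) := by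
              gcongr
              refine (ContinuousLinearMap.le_opNorm _ _).trans ?_
              gcongr
              refine (norm_mul_le _ _).trans ?_
              gcongr
          _ = _ := by ring
      have h4 : ‖∫ z, (f * g') z ∂(E.measure x) - ∫ z, (f * g) z ∂(E.measure x)‖ ≤
          ε * (C * (E.measure x).real Set.univ) := by
        rw [← integral_sub ((hf.mul hg').integrable _) ((hf.mul hg).integrable _), ← mul_assoc]
        refine norm_integral_le_of_norm_le_const (Eventually.of_forall fun z => ?_)
        rw [Pi.mul_apply, Pi.mul_apply, ← mul_sub, norm_mul, mul_comm ε]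
        have := hgg' z
        rw [norm_sub_rev] at this
        exact mul_le_mul (hC z) this (norm_nonneg _) hC0
      rw [← h1] at h4
      calc _ ≤ _ := norm_sub_le_norm_sub_add_norm_sub _ (inner ℂ x ((D * D₁) x)) _
        _ ≤ _ := add_le_add h3 h4
        _ = ε * K := by rw [hK]; ring
    rw [← sub_eq_zero, ← norm_le_zero_iff]
    have hlim0 : Tendsto (fun ε : ℝ => ε * K) (𝓝[>] 0) (𝓝 0) := by
      have : Tendsto (fun ε : ℝ => ε * K) (𝓝 0) (𝓝 (0 * K)) := tendsto_id.mul_const K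
      rw [zero_mul] at this
      exact this.mono_left nhdsWithin_le_nhds
    exact ge_of_tendsto hlim0 (eventually_mem_nhdsWithin.mono fun ε hε => hbound ε hε)

lemma IsIntegral.commute (hf : IsBoundedBorel f) (hg : IsBoundedBorel g) (h : E.IsIntegral f D)
    (h' : E.IsIntegral g D') : Commute D D' := by
  have h1 := h.mul hf hg h'
  rw [mul_comm] at h1
  exact h1.unique (h'.mul hg hf h)

lemma isIntegral_integral (E : ProjMeasure H) {Δ : Set ℂ} (hΔ : MeasurableSet Δ)
    (hg : IsBoundedBorel (Δ.indicator g)) : E.IsIntegral (Δ.indicator g) (E.integral Δ g) := by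
  have h : ∃ D : H →L[ℂ] H, ∀ x, inner ℂ x (D x) = ∫ z in Δ, g z ∂(E.measure x) := by
    obtain ⟨D, hD⟩ := E.exists_isIntegral hg
    exact ⟨D, fun x => by rw [hD x, integral_indicator hΔ]⟩
  intro x
  rw [integral_indicator hΔ, integral, dif_pos h]
  exact h.choose_spec x

/-! ### Spectral measures and eigenvectors -/

section Spectral

variable {M : H →L[ℂ] H}

lemma measurableSet_spectrum (M : H →L[ℂ] H) : MeasurableSet (spectrum ℂ M) :=
  (spectrum.isClosed M).measurableSet

/-- Polynomials are unbounded on the plane. Cutting them off to the compact spectrum, which carries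
`E`, places them in the bounded calculus without changing the operators. -/
lemma isBoundedBorel_indicator_spectrum (M : H →L[ℂ] H) {f : ℂ → ℂ} (hf : Continuous f) :
    IsBoundedBorel ((spectrum ℂ M).indicator f) := by
  refine ⟨hf.measurable.indicator (measurableSet_spectrum M), ?_⟩
  obtain ⟨C, hC⟩ := (spectrum.isCompact (𝕜 := ℂ) M).exists_bound_of_continuousOn hf.continuousOn
  refine ⟨max C 0, fun z => ?_⟩
  by_cases hz : z ∈ spectrum ℂ M
  · simpa [hz] using Or.inl (hC z hz)
  · simp [hz]

lemma IsSpectralMeasureOf.isIntegral_one (hE : E.IsSpectralMeasureOf M) :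
    E.IsIntegral ((spectrum ℂ M).indicator fun _ => 1) 1 := by
  have := IsIntegral.indicator_const (E := E) 1 (measurableSet_spectrum M)
  rwa [hE.1, one_smul] at this

lemma IsSpectralMeasureOf.isIntegral_self (hE : E.IsSpectralMeasureOf M) :
    E.IsIntegral ((spectrum ℂ M).indicator fun z => z) M := by
  intro x
  rw [hE.2 x, integral_indicator (measurableSet_spectrum M), ← E.measure_proj
    (measurableSet_spectrum M), hE.1, one_apply_eq_self]

/-- For an eigenvector, `∫ |z - w|² d(E y, y) = ‖(M - w) y‖² = 0`, so the measure of `y` sits at the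
point `w`. -/
lemma IsSpectralMeasureOf.proj_apply_eq_self (hE : E.IsSpectralMeasureOf M) {w : ℂ} {y : H}
    (hy : M y = w • y) : E.proj {w} y = y := by
  have hσ := measurableSet_spectrum M
  have hb1 := isBoundedBorel_indicator_spectrum M continuous_id
  have hb2 := isBoundedBorel_indicator_spectrum M (continuous_const (y := (1 : ℂ)))
  have h1 := hE.isIntegral_self.sub hb1 (hb2.smul w) (hE.isIntegral_one.smul w)
  have hb := hb1.sub (hb2.smul w)
  have h2 := (h1.adjoint.mul hb.conj hb h1) y
  have hw : MeasurableSet ({w} : Set ℂ) := measurableSet_singleton w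
  have h0 : (M - w • 1) y = 0 := by simp [hy]
  rw [mul_apply_eq_comp, h0, map_zero, inner_zero_right] at h2
  have h3 : ∫ z, ((spectrum ℂ M).indicator (fun z => ‖z - w‖ ^ 2) z) ∂(E.measure y) = 0 := by
    rw [← Complex.ofReal_inj, ← integral_complex_ofReal, Complex.ofReal_zero, h2]
    congr 1
    ext z
    by_cases hz : z ∈ spectrum ℂ M
    · simp [hz, -map_sub, Complex.conj_mul']
    · simp [hz]
  have hint : Integrable ((spectrum ℂ M).indicator (fun z => ‖z - w‖ ^ 2)) (E.measure y) := by
    have := ((hb.conj.mul hb).integrable (E.measure y)).norm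
    refine this.congr (Eventually.of_forall fun z => ?_)
    by_cases hz : z ∈ spectrum ℂ M
    · simp [hz, sq, -map_sub]
    · simp [hz]
  rw [integral_eq_zero_iff_of_nonneg (fun z => Set.indicator_nonneg (fun _ _ => by positivity) z)
    hint] at h3
  have h4 : E.measure y {w}ᶜ = 0 := by
    have hσ0 : E.measure y (spectrum ℂ M)ᶜ = 0 := by
      have h5 := E.proj_mul_of_disjoint hσ.compl hσ disjoint_compl_left
      rw [hE.1, mul_one] at h5
      rw [E.measure_apply y hσ.compl, h5]
      simp
    refine measure_mono_null (t := (spectrum ℂ M)ᶜ ∪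
      {z | ¬ (spectrum ℂ M).indicator (fun z => ‖z - w‖ ^ 2) z = 0}) ?_
      (measure_union_null hσ0 h3)
    intro z hz
    by_cases hzσ : z ∈ spectrum ℂ M
    · right
      simpa [hzσ, sub_eq_zero] using hz
    · left; exact hzσ
  have h6 : E.proj {w}ᶜ y = 0 := by
    have h7 : inner ℂ y (E.proj {w}ᶜ y) = 0 := by
      rw [E.inner_proj hw.compl, Measure.real, h4]
      simp
    rw [← E.proj_mul_self hw.compl, mul_apply_eq_comp, ← ContinuousLinearMap.adjoint_inner_left,
      E.adjoint_proj hw.compl, inner_self_eq_zero] at h7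
    exact h7
  have h8 := E.proj_union hw hw.compl disjoint_compl_right
  rw [Set.union_compl_self, E.univ] at h8
  have h9 := congrArg (fun A : H →L[ℂ] H => A y) h8
  simp only [one_apply_eq_self, add_apply, h6, add_zero] at h9
  exact h9.symm

lemma IsSpectralMeasureOf.mul_proj_singleton (hE : E.IsSpectralMeasureOf M) (w : ℂ) :
    M * E.proj {w} = w • E.proj {w} := by
  have hw : MeasurableSet ({w} : Set ℂ) := measurableSet_singleton w
  have hb1 := isBoundedBorel_indicator_spectrum M continuous_id
  by_cases hwσ : w ∈ spectrum ℂ M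
  · refine (hE.isIntegral_self.mul_proj hb1 hw).unique ?_
    have : (({w} : Set ℂ).indicator ((spectrum ℂ M).indicator id)) =
        ({w} : Set ℂ).indicator fun _ => w := by
      ext z
      by_cases hz : z = w
      · subst hz; simp [hwσ]
      · simp [hz]
    rw [this]
    exact IsIntegral.indicator_const w hw
  · have h := E.proj_mul_of_disjoint (measurableSet_spectrum M) hw
      (Set.disjoint_singleton_right.mpr hwσ)
    rw [hE.1, one_mul] at h
    simp [h]

/-- Self-adjoint operators that commute with `M` commute with the eigenprojections. -/
lemma IsSpectralMeasureOf.commute_proj_singleton (hE : E.IsSpectralMeasureOf M) {C : H →L[ℂ] H}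
    (hC : ContinuousLinearMap.adjoint C = C) (hCM : Commute C M) (w : ℂ) :
    Commute C (E.proj {w}) := by
  have hw : MeasurableSet ({w} : Set ℂ) := measurableSet_singleton w
  -- `C` maps the range of `E{w}` into the eigenspace of `M` at `w`, hence back into that range.
  -- Comparing with the adjoint identity gives commutation.
  have h1 : E.proj {w} * (C * E.proj {w}) = C * E.proj {w} := by
    ext x
    refine hE.proj_apply_eq_self ?_
    have h2 : M * (C * E.proj {w}) = w • (C * E.proj {w}) := by
      rw [← mul_assoc, ← hCM.eq, mul_assoc, hE.mul_proj_singleton, mul_smul_comm]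
    exact congrArg (fun A : H →L[ℂ] H => A x) h2
  have h3 := congrArg star h1
  simp only [star_mul, ContinuousLinearMap.star_eq_adjoint, hC, E.adjoint_proj hw] at h3
  rw [commute_iff_eq, ← h1, ← mul_assoc, h3]

end Spectral

end ProjMeasure

/-! ### Krein space adjoints and lifting operators to the form completion -/

namespace KreinStructure

open Filter

variable {K : Type*} [NormedAddCommGroup K] [InnerProductSpace ℂ K] [CompleteSpace K]
variable {H : Type*} [NormedAddCommGroup H] [InnerProductSpace ℂ H] [CompleteSpace H]
variable (κ : KreinStructure K)

lemma J_mul_J : κ.J * κ.J = 1 := κ.sq_eq_one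

lemma adjoint_J : ContinuousLinearMap.adjoint κ.J = κ.J :=
  ContinuousLinearMap.isSelfAdjoint_iff'.mp κ.isSelfAdjoint

lemma star_J : star κ.J = κ.J := κ.isSelfAdjoint

lemma adj_eq (C : K →L[ℂ] K) : κ.adj C = κ.J * star C * κ.J := rfl

lemma J_mul_cancel (C : K →L[ℂ] K) : κ.J * (κ.J * C) = C := by
  rw [← mul_assoc, κ.J_mul_J, one_mul]

lemma adj_adj (C : K →L[ℂ] K) : κ.adj (κ.adj C) = C := by
  simp only [adj_eq, star_mul, star_star, star_J, mul_assoc, J_mul_J, J_mul_cancel, mul_one]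

lemma adj_mul (C C' : K →L[ℂ] K) : κ.adj (C * C') = κ.adj C' * κ.adj C := by
  simp only [adj_eq, star_mul, mul_assoc, J_mul_cancel]

lemma adj_add (C C' : K →L[ℂ] K) : κ.adj (C + C') = κ.adj C + κ.adj C' := by
  simp only [adj_eq, star_add, mul_add, add_mul]

lemma adj_sub (C C' : K →L[ℂ] K) : κ.adj (C - C') = κ.adj C - κ.adj C' := by
  simp only [adj_eq, star_sub, mul_sub, sub_mul]

lemma adj_one : κ.adj 1 = 1 := by
  simp only [adj_eq, star_one, mul_one, J_mul_J]

lemma adj_smul (c : ℂ) (C : K →L[ℂ] K) : κ.adj (c • C) = (starRingEnd ℂ c) • κ.adj C := by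
  simp only [adj_eq, star_smul, mul_smul_comm, smul_mul_assoc]
  rfl

lemma adj_pow (C : K →L[ℂ] K) (n : ℕ) : κ.adj (C ^ n) = κ.adj C ^ n := by
  induction n with
  | zero => simp [adj_one]
  | succ n ih => rw [pow_succ, adj_mul, ih, pow_succ']

lemma isUnit_adj {C : K →L[ℂ] K} (h : IsUnit C) : IsUnit (κ.adj C) := by
  obtain ⟨u, rfl⟩ := h
  refine isUnit_iff_exists.mpr ⟨κ.adj (u⁻¹ : (K →L[ℂ] K)ˣ), ?_, ?_⟩
  · rw [← adj_mul, Units.inv_mul, adj_one]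
  · rw [← adj_mul, Units.mul_inv, adj_one]

variable {κ} {G : K →L[ℂ] K} (hG : κ.IsNonneg G)

include hG in
lemma IsNonneg.adj_eq_self : κ.adj G = G := by
  have h : star (κ.J * G) = κ.J * G := hG.isPositive.isSelfAdjoint
  rw [star_mul, star_J] at h
  rw [adj_eq, mul_assoc, h, J_mul_cancel]

include hG in
lemma IsNonneg.commute_adj {C : K →L[ℂ] K} (hC : Commute C G) : Commute (κ.adj C) G := by
  have h := congrArg κ.adj hC.eq
  rw [adj_mul, adj_mul, hG.adj_eq_self] at h
  exact h.symm

lemma inner_embForm (x y : K) :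
    inner ℂ (embForm κ G hG x) (embForm κ G hG y) = κ.form (G y) x :=
  UniformSpace.Completion.inner_coe _ _

lemma denseRange_embForm : DenseRange (embForm κ G hG) := by
  have h : DenseRange ((↑) : κ.FormSpace G hG → κ.FormCompletion G hG) :=
    UniformSpace.Completion.denseRange_coe
  exact h

lemma adjTo_adjFrom (ι : K →L[ℂ] H) : κ.adjTo (κ.adjFrom ι) = ι := by
  ext x
  simp only [adjTo, adjFrom, ContinuousLinearMap.adjoint_comp, adjoint_J,
    ContinuousLinearMap.adjoint_adjoint, ContinuousLinearMap.comp_apply, J_J]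

lemma adjoint_embForm_comp :
    ContinuousLinearMap.adjoint (embForm κ G hG) ∘L embForm κ G hG = κ.J * G := by
  ext x
  refine ext_inner_left ℂ fun y => ?_
  rw [ContinuousLinearMap.comp_apply, ContinuousLinearMap.adjoint_inner_right, inner_embForm]
  rfl

lemma adjFrom_embForm_comp : κ.adjFrom (embForm κ G hG) ∘L embForm κ G hG = G := by
  rw [adjFrom, ContinuousLinearMap.comp_assoc, adjoint_embForm_comp]
  exact κ.J_mul_cancel G

lemma adjFrom_embForm_injective : Function.Injective (κ.adjFrom (embForm κ G hG)) := by
  refine (injective_iff_map_eq_zero _).mpr fun v hv => ?_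
  have h : ContinuousLinearMap.adjoint (embForm κ G hG) v = 0 := by
    have := congrArg κ.J hv
    simpa [adjFrom, J_J] using this
  refine (denseRange_embForm hG).eq_zero_of_inner_left (𝕜 := ℂ) fun x => ?_
  rw [← ContinuousLinearMap.adjoint_inner_left, h, inner_zero_left]

/-- `[G C x, C x] = [G C*C x, x]` with the Krein adjoint `C*`, because `C*` commutes with `G` as
well; then Cauchy-Schwarz in the completion. -/
lemma norm_embForm_sq_le {C : K →L[ℂ] K} (hC : Commute C G) (x : K) :
    ‖embForm κ G hG (C x)‖ ^ 2 ≤ ‖embForm κ G hG x‖ * ‖embForm κ G hG ((κ.adj C * C) x)‖ := by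
  have h1 : inner ℂ (embForm κ G hG (C x)) (embForm κ G hG (C x)) =
      inner ℂ (embForm κ G hG x) (embForm κ G hG ((κ.adj C * C) x)) := by
    have h2 : G (κ.adj C (C x)) = κ.adj C (G (C x)) :=
      congrArg (fun A : K →L[ℂ] K => A (C x)) (hG.commute_adj hC).eq.symm
    rw [inner_embForm, inner_embForm, mul_apply_eq_comp, h2, κ.form_adj (κ.adj C), adj_adj]
  rw [inner_self_eq_norm_sq_to_K] at h1
  have h2 := norm_inner_le_norm (𝕜 := ℂ) (embForm κ G hG x) (embForm κ G hG ((κ.adj C * C) x))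
  rw [← h1] at h2
  simpa using h2

lemma le_of_forall_mul_pow_two_pow_le {a t r c : ℝ} (ht : 0 ≤ t) (hr : 0 < r)
    (h : ∀ n : ℕ, r * a ^ 2 ^ n ≤ t ^ 2 ^ n * c) : a ≤ t := by
  by_contra! hat
  rcases ht.eq_or_lt with rfl | ht
  · have := h 0
    simp only [pow_zero, pow_one, zero_mul] at this
    nlinarith
  · have h1 : Tendsto (fun n : ℕ => (a / t) ^ 2 ^ n) atTop atTop :=
      (tendsto_pow_atTop_atTop_of_one_lt ((one_lt_div ht).mpr hat)).comp
        (tendsto_pow_atTop_atTop_of_one_lt (by norm_num : (1 : ℕ) < 2))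
    obtain ⟨n, hn⟩ := (h1.eventually_gt_atTop (c / r)).exists
    rw [div_pow, div_lt_div_iff₀ hr (by positivity)] at hn
    have := h n
    linarith

/-- The argument of Krein, Reid and Lax: the Cauchy-Schwarz bound is iterated along the powers
`C^(2^n)`, whose images are estimated crudely by `‖C‖^(2^n)` times a constant. The constant
disappears after taking roots of order `2^n`. -/
lemma norm_embForm_le_of_selfAdjoint {C : K →L[ℂ] K} (hC : Commute C G) (hC' : κ.adj C = C)
    (x : K) : ‖embForm κ G hG (C x)‖ ≤ ‖C‖ * ‖embForm κ G hG x‖ := by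
  rcases (norm_nonneg (embForm κ G hG x)).eq_or_lt with h0 | h0
  · have h1 := norm_embForm_sq_le hG hC x
    rw [← h0, zero_mul] at h1
    rw [← h0, mul_zero]
    nlinarith [norm_nonneg (embForm κ G hG (C x))]
  refine le_of_forall_mul_pow_two_pow_le (r := ‖embForm κ G hG x‖)
    (c := ‖embForm κ G hG‖ * ‖x‖) (by positivity) h0 fun n => ?_
  have h1 : ∀ n : ℕ, ‖embForm κ G hG x‖ * ‖embForm κ G hG (C x)‖ ^ 2 ^ n ≤
      ‖embForm κ G hG x‖ ^ 2 ^ n * ‖embForm κ G hG ((C ^ 2 ^ n) x)‖ := by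
    intro n
    induction n with
    | zero => simp
    | succ n ih =>
      have h2 := norm_embForm_sq_le hG (hC.pow_left (2 ^ n)) x
      rw [adj_pow, hC', ← pow_add, ← two_mul, ← pow_succ'] at h2
      refine le_of_mul_le_mul_left ?_ h0
      calc ‖embForm κ G hG x‖ * (‖embForm κ G hG x‖ * ‖embForm κ G hG (C x)‖ ^ 2 ^ (n + 1))
          = (‖embForm κ G hG x‖ * ‖embForm κ G hG (C x)‖ ^ 2 ^ n) ^ 2 := by ring
        _ ≤ (‖embForm κ G hG x‖ ^ 2 ^ n * ‖embForm κ G hG ((C ^ 2 ^ n) x)‖) ^ 2 := by gcongr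
        _ = ‖embForm κ G hG x‖ ^ 2 ^ (n + 1) * ‖embForm κ G hG ((C ^ 2 ^ n) x)‖ ^ 2 := by ring
        _ ≤ ‖embForm κ G hG x‖ ^ 2 ^ (n + 1) * (‖embForm κ G hG x‖ *
            ‖embForm κ G hG ((C ^ 2 ^ (n + 1)) x)‖) := by gcongr
        _ = _ := by ring
  have h3 : ‖embForm κ G hG ((C ^ 2 ^ n) x)‖ ≤ ‖embForm κ G hG‖ * (‖C‖ ^ 2 ^ n * ‖x‖) := by
    refine ((embForm κ G hG).le_opNorm _).trans ?_
    gcongr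
    refine ((C ^ 2 ^ n).le_opNorm x).trans ?_
    gcongr
    exact norm_pow_le' C (by positivity)
  calc _ ≤ _ := h1 n
    _ ≤ ‖embForm κ G hG x‖ ^ 2 ^ n * (‖embForm κ G hG‖ * (‖C‖ ^ 2 ^ n * ‖x‖)) := by gcongr
    _ = _ := by ring

lemma norm_embForm_le {C : K →L[ℂ] K} (hC : Commute C G) (x : K) :
    ‖embForm κ G hG (C x)‖ ≤ √‖κ.adj C * C‖ * ‖embForm κ G hG x‖ := by
  refine le_of_sq_le_sq ?_ (by positivity)
  have h1 := norm_embForm_sq_le hG hC x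
  have h2 := norm_embForm_le_of_selfAdjoint hG ((hG.commute_adj hC).mul_left hC)
    (by rw [adj_mul, adj_adj]) x
  rw [mul_pow, Real.sq_sqrt (norm_nonneg _)]
  nlinarith [norm_nonneg (embForm κ G hG x)]

/-- The seminorm estimate extends `ι x ↦ ι (C x)` from the dense range of `ι`, the canonical map
into the completion. The second relation holds on that range because `adjFrom ι` composed with `ι`
is `G`, which commutes with `C`. -/
lemma exists_comp_embForm {C : K →L[ℂ] K} (hC : Commute C G) :
    ∃ L : κ.FormCompletion G hG →L[ℂ] κ.FormCompletion G hG,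
      L ∘L embForm κ G hG = embForm κ G hG ∘L C ∧
      κ.adjFrom (embForm κ G hG) ∘L L = C ∘L κ.adjFrom (embForm κ G hG) := by
  let f : K →ₗ[ℂ] κ.FormCompletion G hG := (embForm κ G hG ∘L C).toLinearMap
  have hL : ∀ x, f.extendOfNorm (embForm κ G hG).toLinearMap (embForm κ G hG x) =
      embForm κ G hG (C x) := fun x =>
    LinearMap.extendOfNorm_eq (f := f) (e := (embForm κ G hG).toLinearMap)
      (denseRange_embForm hG) ⟨_, norm_embForm_le hG hC⟩ x
  refine ⟨f.extendOfNorm (embForm κ G hG).toLinearMap, ContinuousLinearMap.ext hL, ?_⟩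
  refine DFunLike.coe_injective ((denseRange_embForm hG).equalizer
    (ContinuousLinearMap.continuous _) (ContinuousLinearMap.continuous _) ?_)
  ext x
  have h1 : ∀ y, κ.adjFrom (embForm κ G hG) (embForm κ G hG y) = G y := fun y =>
    congrArg (fun A : K →L[ℂ] K => A y) (adjFrom_embForm_comp hG)
  simp only [Function.comp_apply, ContinuousLinearMap.comp_apply, hL, h1]
  exact (congrArg (fun A : K →L[ℂ] K => A x) hC.eq).symm

end KreinStructure

/-! ### The maps `Θ` and `Ξ` -/

namespace DefinitizableNormal

variable {K : Type*} [NormedAddCommGroup K] [InnerProductSpace ℂ K] [CompleteSpace K]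
variable {κ : KreinStructure K} (D : DefinitizableNormal κ)

/-- The canonical map `T*` of `K` into `V`. -/
def emb : K →L[ℂ] D.V := KreinStructure.embForm κ (D.pA + D.qB) D.nonneg_sum

lemma adjTo_T : κ.adjTo D.T = D.emb := KreinStructure.adjTo_adjFrom _

lemma denseRange_emb : DenseRange D.emb := KreinStructure.denseRange_embForm _

lemma T_injective : Function.Injective D.T := KreinStructure.adjFrom_embForm_injective _

lemma T_emb (x : K) : D.T (D.emb x) = (D.pA + D.qB) x :=
  congrArg (fun A : K →L[ℂ] K => A x) (KreinStructure.adjFrom_embForm_comp D.nonneg_sum)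

lemma Ξ_apply (S : D.V →L[ℂ] D.V) (x : K) : D.Ξ S x = D.T (S (D.emb x)) := by
  rw [Ξ, adjTo_T]
  rfl

/-- `T*` has dense range and `T` is injective. Operator identities on `V` may therefore be verified
after applying `Ξ`, that is, on `K`. -/
lemma Ξ_injective : Function.Injective D.Ξ := by
  intro S S' h
  refine DFunLike.coe_injective (D.denseRange_emb.equalizer
    (ContinuousLinearMap.continuous _) (ContinuousLinearMap.continuous _) ?_)
  ext x
  have := congrArg (fun A : K →L[ℂ] K => A x) h
  simp only [Ξ_apply] at this
  exact D.T_injective this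

lemma Ξ_one : D.Ξ 1 = D.pA + D.qB := by
  ext x
  rw [Ξ_apply, one_apply_eq_self, T_emb]

lemma Ξ_add (S S' : D.V →L[ℂ] D.V) : D.Ξ (S + S') = D.Ξ S + D.Ξ S' := by
  ext x
  simp [Ξ_apply]

variable {C C' : K →L[ℂ] K}

/-- Injectivity of `T` leaves only one solution, so the chosen operator is the continuous extension;
this supplies the relation with `T*` too. -/
lemma exists_Θ (hC : Commute C (D.pA + D.qB)) :
    D.T ∘L D.Θ C = C ∘L D.T ∧ D.Θ C ∘L D.emb = D.emb ∘L C := by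
  obtain ⟨L, hL, hL'⟩ := KreinStructure.exists_comp_embForm D.nonneg_sum hC
  have h : ∃ S : D.V →L[ℂ] D.V, D.T ∘L S = C ∘L D.T := ⟨L, hL'⟩
  have h1 : D.T ∘L D.Θ C = C ∘L D.T := by
    rw [Θ, dif_pos h]
    exact h.choose_spec
  have h2 : D.Θ C = L := by
    ext v
    refine D.T_injective ?_
    exact congrArg (fun A : D.V →L[ℂ] K => A v) (h1.trans hL'.symm)
  exact ⟨h1, by rw [h2]; exact hL⟩

lemma T_Θ (hC : Commute C (D.pA + D.qB)) (v : D.V) : D.T (D.Θ C v) = C (D.T v) :=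
  congrArg (fun A : D.V →L[ℂ] K => A v) (D.exists_Θ hC).1

lemma Θ_emb (hC : Commute C (D.pA + D.qB)) (x : K) : D.Θ C (D.emb x) = D.emb (C x) :=
  congrArg (fun A : K →L[ℂ] D.V => A x) (D.exists_Θ hC).2

lemma mul_Ξ (hC : Commute C (D.pA + D.qB)) (S : D.V →L[ℂ] D.V) :
    C * D.Ξ S = D.Ξ (D.Θ C * S) := by
  ext x
  simp only [mul_apply_eq_comp, Ξ_apply, D.T_Θ hC]

lemma Ξ_mul (hC : Commute C (D.pA + D.qB)) (S : D.V →L[ℂ] D.V) :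
    D.Ξ S * C = D.Ξ (S * D.Θ C) := by
  ext x
  simp only [mul_apply_eq_comp, Ξ_apply, D.Θ_emb hC]

lemma Θ_eq (hC : Commute C (D.pA + D.qB)) {S : D.V →L[ℂ] D.V}
    (h : ∀ v, D.T (S v) = C (D.T v)) : D.Θ C = S := by
  ext v
  refine D.T_injective ?_
  rw [D.T_Θ hC, h]

/-- In other words `T* T = Θ(T T*)`, since `T (T* T) = (T T*) T`. This governs products of operators
of the form `T S T*`. -/
lemma emb_T (v : D.V) : D.emb (D.T v) = D.Θ (D.pA + D.qB) v := by
  refine D.T_injective ?_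
  rw [T_emb, D.T_Θ (Commute.refl _)]

lemma Ξ_mul_Ξ (S S' : D.V →L[ℂ] D.V) :
    D.Ξ S * D.Ξ S' = D.Ξ (S * D.Θ (D.pA + D.qB) * S') := by
  ext x
  simp only [mul_apply_eq_comp, Ξ_apply, emb_T]

lemma Θ_add (hC : Commute C (D.pA + D.qB)) (hC' : Commute C' (D.pA + D.qB)) :
    D.Θ (C + C') = D.Θ C + D.Θ C' :=
  D.Θ_eq (hC.add_left hC') fun v => by
    simp only [add_apply, map_add, D.T_Θ hC, D.T_Θ hC']

lemma Θ_smul (c : ℂ) (hC : Commute C (D.pA + D.qB)) : D.Θ (c • C) = c • D.Θ C :=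
  D.Θ_eq (hC.smul_left c) fun v => by
    simp only [smul_apply, map_smul, D.T_Θ hC]

lemma Θ_mul (hC : Commute C (D.pA + D.qB)) (hC' : Commute C' (D.pA + D.qB)) :
    D.Θ (C * C') = D.Θ C * D.Θ C' :=
  D.Θ_eq (hC.mul_left hC') fun v => by
    simp only [mul_apply_eq_comp, D.T_Θ hC, D.T_Θ hC']

lemma Θ_one : D.Θ 1 = 1 := D.Θ_eq (Commute.one_left _) fun _ => rfl

lemma Θ_pow (hC : Commute C (D.pA + D.qB)) (n : ℕ) : D.Θ (C ^ n) = D.Θ C ^ n := by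
  induction n with
  | zero => simp [Θ_one]
  | succ n ih => rw [pow_succ, D.Θ_mul (hC.pow_left n) hC, ih, pow_succ]

lemma commute_Θ (hC : Commute C (D.pA + D.qB)) (hC' : Commute C' (D.pA + D.qB))
    (h : Commute C C') : Commute (D.Θ C) (D.Θ C') := by
  rw [commute_iff_eq, ← D.Θ_mul hC hC', ← D.Θ_mul hC' hC, h.eq]

/-- The Hilbert space adjoint of `Θ(C) T* = T* C`, with `J` inserted, is the relation that
characterizes `Θ` at the Krein adjoint. This makes `Θ(N)` normal on the Hilbert space `V`. -/
lemma adjoint_Θ (hC : Commute C (D.pA + D.qB)) :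
    ContinuousLinearMap.adjoint (D.Θ C) = D.Θ (κ.adj C) := by
  have hC' := D.nonneg_sum.commute_adj hC
  refine (D.Θ_eq hC' fun v => ?_).symm
  have hT : ∀ v, D.T v = κ.J (ContinuousLinearMap.adjoint D.emb v) := fun v => rfl
  have h := congrArg ContinuousLinearMap.adjoint (D.exists_Θ hC).2
  rw [ContinuousLinearMap.adjoint_comp, ContinuousLinearMap.adjoint_comp] at h
  have h1 : ∀ v, ContinuousLinearMap.adjoint D.emb (ContinuousLinearMap.adjoint (D.Θ C) v) =
      ContinuousLinearMap.adjoint C (ContinuousLinearMap.adjoint D.emb v) := fun v =>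
    congrArg (fun A : D.V →L[ℂ] K => A v) h
  rw [hT, hT, h1, KreinStructure.adj, mul_apply_eq_comp, mul_apply_eq_comp, κ.J_J]

/-! ### The operators `R_j R_j*` -/

lemma adjTo_T₁ : κ.adjTo D.T₁ = KreinStructure.embForm κ D.pA D.nonneg_pA :=
  KreinStructure.adjTo_adjFrom _

lemma adjTo_T₂ : κ.adjTo D.T₂ = KreinStructure.embForm κ D.qB D.nonneg_qB :=
  KreinStructure.adjTo_adjFrom _

lemma norm_embForm_mono {G G' : K →L[ℂ] K} (hG : κ.IsNonneg G) (hG' : κ.IsNonneg G')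
    (h : κ.IsNonneg (G' - G)) (x : K) :
    ‖KreinStructure.embForm κ G hG x‖ ≤ 1 * ‖KreinStructure.embForm κ G' hG' x‖ := by
  rw [one_mul]
  refine le_of_sq_le_sq ?_ (norm_nonneg _)
  have h1 := KreinStructure.inner_embForm hG x x
  have h2 := KreinStructure.inner_embForm hG' x x
  have h3 := (Complex.nonneg_iff.mp (h x)).1
  have h4 : κ.form ((G' - G) x) x = κ.form (G' x) x - κ.form (G x) x := by
    simp [KreinStructure.form]
  rw [h4, ← h1, ← h2, inner_self_eq_norm_sq_to_K, inner_self_eq_norm_sq_to_K] at h3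
  have h5 : ((‖KreinStructure.embForm κ G' hG' x‖ : ℂ) ^ 2 -
      (‖KreinStructure.embForm κ G hG x‖ : ℂ) ^ 2).re =
      ‖KreinStructure.embForm κ G' hG' x‖ ^ 2 - ‖KreinStructure.embForm κ G hG x‖ ^ 2 := by
    norm_cast
  exact sub_nonneg.mp (h5 ▸ h3)

lemma norm_emb₁_le (x : K) : ‖κ.adjTo D.T₁ x‖ ≤ 1 * ‖κ.adjTo D.T x‖ := by
  rw [adjTo_T₁, adjTo_T]
  exact norm_embForm_mono _ _ (by rw [add_sub_cancel_left]; exact D.nonneg_qB) x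

lemma norm_emb₂_le (x : K) : ‖κ.adjTo D.T₂ x‖ ≤ 1 * ‖κ.adjTo D.T x‖ := by
  rw [adjTo_T₂, adjTo_T]
  exact norm_embForm_mono _ _ (by rw [add_sub_cancel_right]; exact D.nonneg_pA) x

lemma denseRange_adjTo_T : DenseRange (κ.adjTo D.T) := by
  rw [adjTo_T]
  exact D.denseRange_emb

lemma adjoint_R₁_emb (x : K) :
    ContinuousLinearMap.adjoint D.R₁ (D.emb x) = KreinStructure.embForm κ D.pA D.nonneg_pA x := by
  rw [← adjTo_T, ← adjTo_T₁, R₁, ContinuousLinearMap.adjoint_adjoint]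
  exact LinearMap.extendOfNorm_eq (f := (κ.adjTo D.T₁).toLinearMap)
    (e := (κ.adjTo D.T).toLinearMap) D.denseRange_adjTo_T ⟨1, D.norm_emb₁_le⟩ x

lemma adjoint_R₂_emb (x : K) :
    ContinuousLinearMap.adjoint D.R₂ (D.emb x) = KreinStructure.embForm κ D.qB D.nonneg_qB x := by
  rw [← adjTo_T, ← adjTo_T₂, R₂, ContinuousLinearMap.adjoint_adjoint]
  exact LinearMap.extendOfNorm_eq (f := (κ.adjTo D.T₂).toLinearMap)
    (e := (κ.adjTo D.T).toLinearMap) D.denseRange_adjTo_T ⟨1, D.norm_emb₂_le⟩ x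

/-- `R₁ R₁*`. -/
def S₁ : D.V →L[ℂ] D.V := D.R₁ ∘L ContinuousLinearMap.adjoint D.R₁

/-- `R₂ R₂*`. -/
def S₂ : D.V →L[ℂ] D.V := D.R₂ ∘L ContinuousLinearMap.adjoint D.R₂

lemma adjoint_S₁ : ContinuousLinearMap.adjoint D.S₁ = D.S₁ := by
  rw [S₁, ContinuousLinearMap.adjoint_comp, ContinuousLinearMap.adjoint_adjoint]

lemma adjoint_S₂ : ContinuousLinearMap.adjoint D.S₂ = D.S₂ := by
  rw [S₂, ContinuousLinearMap.adjoint_comp, ContinuousLinearMap.adjoint_adjoint]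

/-- From `R* T* = ι` one gets `T R = J ι*`, hence `T R R* T* = J ι* ι = G`. Both factorizations, of
`p(A)` and of `q(B)`, are instances. -/
lemma Ξ_eq_of_adjoint_emb {H : Type*} [NormedAddCommGroup H] [InnerProductSpace ℂ H]
    [CompleteSpace H] {R : H →L[ℂ] D.V} {ι : K →L[ℂ] H} {G : K →L[ℂ] K}
    (h : ∀ x, ContinuousLinearMap.adjoint R (D.emb x) = ι x)
    (hι : ContinuousLinearMap.adjoint ι ∘L ι = κ.J * G) :
    D.Ξ (R ∘L ContinuousLinearMap.adjoint R) = G := by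
  have h1 : ContinuousLinearMap.adjoint R ∘L D.emb = ι := ContinuousLinearMap.ext h
  have h2 : ContinuousLinearMap.adjoint D.emb ∘L R = ContinuousLinearMap.adjoint ι := by
    rw [← h1, ContinuousLinearMap.adjoint_comp, ContinuousLinearMap.adjoint_adjoint]
  have hT : ∀ v, D.T v = κ.J (ContinuousLinearMap.adjoint D.emb v) := fun v => rfl
  ext x
  have h3 := congrArg (fun A : H →L[ℂ] K => A (ι x)) h2
  have h4 := congrArg (fun A : K →L[ℂ] K => A x) hι
  simp only [ContinuousLinearMap.comp_apply, mul_apply_eq_comp] at h3 h4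
  rw [Ξ_apply, hT, ContinuousLinearMap.comp_apply, h, h3, h4, κ.J_J]

lemma Ξ_S₁ : D.Ξ D.S₁ = D.pA :=
  D.Ξ_eq_of_adjoint_emb D.adjoint_R₁_emb (KreinStructure.adjoint_embForm_comp D.nonneg_pA)

lemma Ξ_S₂ : D.Ξ D.S₂ = D.qB :=
  D.Ξ_eq_of_adjoint_emb D.adjoint_R₂_emb (KreinStructure.adjoint_embForm_comp D.nonneg_qB)

lemma norm_adjoint_R₁_le : ‖ContinuousLinearMap.adjoint D.R₁‖ ≤ 1 := by
  rw [R₁, ContinuousLinearMap.adjoint_adjoint]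
  exact LinearMap.opNorm_extendOfNorm_le (f := (κ.adjTo D.T₁).toLinearMap)
    (e := (κ.adjTo D.T).toLinearMap) D.denseRange_adjTo_T zero_le_one D.norm_emb₁_le

lemma norm_adjoint_R₂_le : ‖ContinuousLinearMap.adjoint D.R₂‖ ≤ 1 := by
  rw [R₂, ContinuousLinearMap.adjoint_adjoint]
  exact LinearMap.opNorm_extendOfNorm_le (f := (κ.adjTo D.T₂).toLinearMap)
    (e := (κ.adjTo D.T).toLinearMap) D.denseRange_adjTo_T zero_le_one D.norm_emb₂_le

lemma opNorm_comp_adjoint_le {H H' : Type*} [NormedAddCommGroup H] [InnerProductSpace ℂ H]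
    [CompleteSpace H] [NormedAddCommGroup H'] [InnerProductSpace ℂ H'] [CompleteSpace H']
    {R : H →L[ℂ] H'} (h : ‖ContinuousLinearMap.adjoint R‖ ≤ 1) :
    ‖R ∘L ContinuousLinearMap.adjoint R‖ ≤ 1 := by
  refine (ContinuousLinearMap.opNorm_comp_le _ _).trans ?_
  have : ‖R‖ = ‖ContinuousLinearMap.adjoint R‖ :=
    (LinearIsometryEquiv.norm_map ContinuousLinearMap.adjoint R).symm
  rw [this]
  exact mul_le_one₀ h (norm_nonneg _) h

lemma norm_S₁_le : ‖D.S₁‖ ≤ 1 := opNorm_comp_adjoint_le D.norm_adjoint_R₁_le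

lemma norm_S₂_le : ‖D.S₂‖ ≤ 1 := opNorm_comp_adjoint_le D.norm_adjoint_R₂_le

lemma commute_Θ_S₁ (hC : Commute C (D.pA + D.qB)) (h : Commute C D.pA) :
    Commute (D.Θ C) D.S₁ := by
  refine D.Ξ_injective ?_
  rw [← D.mul_Ξ hC, ← D.Ξ_mul hC, Ξ_S₁, h.eq]

lemma commute_Θ_S₂ (hC : Commute C (D.pA + D.qB)) (h : Commute C D.qB) :
    Commute (D.Θ C) D.S₂ := by
  refine D.Ξ_injective ?_
  rw [← D.mul_Ξ hC, ← D.Ξ_mul hC, Ξ_S₂, h.eq]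

/-! ### The operators `A` and `B` -/

lemma N_eq : D.N = D.A + Complex.I • D.B := by
  have h1 : Complex.I * (1 / (2 * Complex.I)) = 1 / 2 := by
    field_simp
  rw [A, B, KreinStructure.realPart, KreinStructure.imagPart, smul_smul, h1, ← smul_add,
    add_add_sub_cancel, ← two_smul ℂ, smul_smul]
  norm_num

lemma adj_N_eq : κ.adj D.N = D.A - Complex.I • D.B := by
  have h1 : Complex.I * (1 / (2 * Complex.I)) = 1 / 2 := by
    field_simp
  rw [A, B, KreinStructure.realPart, KreinStructure.imagPart, smul_smul, h1, ← smul_sub,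
    add_sub_sub_cancel, ← two_smul ℂ, smul_smul]
  norm_num

lemma adj_A : κ.adj D.A = D.A := by
  rw [A, KreinStructure.realPart, κ.adj_smul, κ.adj_add, κ.adj_adj, add_comm]
  simp [map_ofNat]

lemma adj_B : κ.adj D.B = D.B := by
  rw [B, KreinStructure.imagPart, κ.adj_smul, κ.adj_sub, κ.adj_adj, ← neg_sub, smul_neg,
    ← neg_smul]
  simp [map_ofNat]

lemma commute_A_B : Commute D.A D.B := by
  have h : Commute D.N (κ.adj D.N) := D.normal
  rw [A, B, KreinStructure.realPart, KreinStructure.imagPart]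
  refine (Commute.smul_right ?_ _).smul_left _
  exact (((Commute.refl _).sub_right h).add_left (h.symm.sub_right (Commute.refl _)))

omit [CompleteSpace K] in
lemma commute_realPolyEval {C C' : K →L[ℂ] K} (h : Commute C C') (p : Polynomial ℝ) :
    Commute C (realPolyEval p C') := by
  rw [realPolyEval, Polynomial.aeval_eq_sum_range]
  exact Commute.sum_right _ _ _ fun i _ => (h.pow_right i).smul_right _

lemma commute_pA (h : Commute C D.A) : Commute C D.pA := commute_realPolyEval h D.p

lemma commute_qB (h : Commute C D.B) : Commute C D.qB := commute_realPolyEval h D.q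

lemma commute_sum (h : Commute C D.A) (h' : Commute C D.B) : Commute C (D.pA + D.qB) :=
  (D.commute_pA h).add_right (D.commute_qB h')

lemma commute_A_sum : Commute D.A (D.pA + D.qB) := D.commute_sum (Commute.refl _) D.commute_A_B

lemma commute_B_sum : Commute D.B (D.pA + D.qB) :=
  D.commute_sum D.commute_A_B.symm (Commute.refl _)

lemma commute_N_A : Commute D.N D.A := by
  rw [N_eq]
  exact (Commute.refl _).add_left (D.commute_A_B.symm.smul_left _)

lemma commute_N_B : Commute D.N D.B := by
  rw [N_eq]
  exact D.commute_A_B.add_left ((Commute.refl _).smul_left _)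

lemma commute_N_sum : Commute D.N (D.pA + D.qB) := D.commute_sum D.commute_N_A D.commute_N_B

lemma Θ_N_eq : D.Θ D.N = D.Θ D.A + Complex.I • D.Θ D.B := by
  conv_lhs => rw [N_eq]
  rw [D.Θ_add D.commute_A_sum (D.commute_B_sum.smul_left _), D.Θ_smul _ D.commute_B_sum]

lemma adjoint_Θ_A : ContinuousLinearMap.adjoint (D.Θ D.A) = D.Θ D.A := by
  rw [D.adjoint_Θ D.commute_A_sum, adj_A]

lemma adjoint_Θ_B : ContinuousLinearMap.adjoint (D.Θ D.B) = D.Θ D.B := by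
  rw [D.adjoint_Θ D.commute_B_sum, adj_B]

lemma adjoint_Θ_N :
    ContinuousLinearMap.adjoint (D.Θ D.N) = D.Θ D.A - Complex.I • D.Θ D.B := by
  rw [Θ_N_eq, map_add, adjoint_Θ_A, LinearIsometryEquiv.map_smulₛₗ, adjoint_Θ_B]
  simp [sub_eq_add_neg]

lemma isStarNormal_Θ_N : IsStarNormal (D.Θ D.N) := by
  refine ⟨?_⟩
  rw [ContinuousLinearMap.star_eq_adjoint, adjoint_Θ_N, Θ_N_eq]
  have h := D.commute_Θ D.commute_A_sum D.commute_B_sum D.commute_A_B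
  have h1 : Commute (D.Θ D.A) (D.Θ D.A + Complex.I • D.Θ D.B) :=
    (Commute.refl _).add_right (h.smul_right _)
  have h2 : Commute (D.Θ D.B) (D.Θ D.A + Complex.I • D.Θ D.B) :=
    h.symm.add_right ((Commute.refl _).smul_right _)
  exact h1.sub_left (h2.smul_left _)

lemma Θ_realPolyEval (hC : Commute C (D.pA + D.qB)) (p : Polynomial ℝ) :
    D.Θ (realPolyEval p C) = Polynomial.aeval (D.Θ C) (p.map Complex.ofRealHom) := by
  refine D.Θ_eq (commute_realPolyEval hC.symm p).symm fun v => ?_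
  rw [realPolyEval, Polynomial.aeval_eq_sum_range, Polynomial.aeval_eq_sum_range, sum_apply,
    sum_apply, map_sum]
  refine Finset.sum_congr rfl fun i _ => ?_
  rw [smul_apply, smul_apply, map_smul, ← D.Θ_pow hC, D.T_Θ (hC.pow_left i)]

/-- `Θ(p(A)) = R₁ R₁* Θ(p(A) + q(B))`. -/
lemma S₁_mul_Θ_sum : D.S₁ * D.Θ (D.pA + D.qB) = D.Θ D.pA := by
  symm
  refine D.Θ_eq (D.commute_sum ?_ ?_) fun v => ?_
  · exact (D.commute_pA (Commute.refl _)).symm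
  · exact (D.commute_pA D.commute_A_B.symm).symm
  · rw [mul_apply_eq_comp, ← emb_T, ← Ξ_apply, Ξ_S₁]

lemma S₂_mul_Θ_sum : D.S₂ * D.Θ (D.pA + D.qB) = D.Θ D.qB := by
  symm
  refine D.Θ_eq (D.commute_sum ?_ ?_) fun v => ?_
  · exact (D.commute_qB D.commute_A_B).symm
  · exact (D.commute_qB (Commute.refl _)).symm
  · rw [mul_apply_eq_comp, ← emb_T, ← Ξ_apply, Ξ_S₂]

end DefinitizableNormal

/-! ### Domination on the spectrum by a contraction -/

section SpectralDomination

variable {H : Type*} [NormedAddCommGroup H] [InnerProductSpace ℂ H] [CompleteSpace H]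

/-- The contraction gives `‖f(M) x‖ ≤ ‖g(M) x‖` for all `x`, so `(|g|² - |f|²)(M) ≥ 0`, and
positivity in the functional calculus is positivity on the spectrum. -/
lemma norm_le_norm_of_cfc_eq_mul {M S : H →L[ℂ] H} (hM : IsStarNormal M) {f g : ℂ → ℂ}
    (hf : Continuous f) (hg : Continuous g) (hS : ‖S‖ ≤ 1) (h : cfc f M = S * cfc g M) {z : ℂ}
    (hz : z ∈ spectrum ℂ M) : ‖f z‖ ≤ ‖g z‖ := by
  have h1 : cfc (fun z => star (g z) * g z - star (f z) * f z) M =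
      star (cfc g M) * cfc g M - star (cfc f M) * cfc f M := by
    rw [cfc_sub (R := ℂ) .., cfc_mul (R := ℂ) .., cfc_mul (R := ℂ) .., cfc_star, cfc_star]
  have h2 : 0 ≤ cfc (fun z => star (g z) * g z - star (f z) * f z) M := by
    rw [h1, ContinuousLinearMap.nonneg_iff_isPositive, ContinuousLinearMap.isPositive_iff_complex]
    intro x
    have h3 : inner ℂ ((star (cfc g M) * cfc g M - star (cfc f M) * cfc f M) x) x =
        ((‖cfc g M x‖ ^ 2 - ‖cfc f M x‖ ^ 2 : ℝ) : ℂ) := by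
      simp only [sub_apply, inner_sub_left, mul_apply_eq_comp, ContinuousLinearMap.star_eq_adjoint,
        ContinuousLinearMap.adjoint_inner_left, inner_self_eq_norm_sq_to_K]
      push_cast
      rfl
    have h4 : ‖cfc f M x‖ ≤ ‖cfc g M x‖ := by
      rw [h, mul_apply_eq_comp]
      exact (S.le_opNorm _).trans (mul_le_of_le_one_left (norm_nonneg _) hS)
    rw [h3]
    refine ⟨congrArg Complex.ofReal (Complex.ofReal_re _), ?_⟩
    change (0 : ℝ) ≤ (((‖cfc g M x‖ ^ 2 - ‖cfc f M x‖ ^ 2 : ℝ) : ℂ)).re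
    rw [Complex.ofReal_re, sub_nonneg]
    gcongr
  have h5 := (cfc_nonneg_iff (R := ℂ) _ M (by fun_prop) hM).mp h2 z hz
  have h6 : star (g z) * g z - star (f z) * f z = ((‖g z‖ ^ 2 - ‖f z‖ ^ 2 : ℝ) : ℂ) := by
    simp [Complex.conj_mul']
  rw [h6, Complex.zero_le_real, sub_nonneg] at h5
  exact le_of_sq_le_sq h5 (norm_nonneg _)

end SpectralDomination

/-! ### Polynomials of operators as spectral integrals -/

section JointPolynomials

variable {H : Type*} [NormedAddCommGroup H] [InnerProductSpace ℂ H] [CompleteSpace H]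

namespace ProjMeasure.IsSpectralMeasureOf

variable {E : ProjMeasure H} {M C C' : H →L[ℂ] H} {f g : ℂ → ℂ}

lemma isIntegral_add (_hE : E.IsSpectralMeasureOf M) (hf : Continuous f) (hg : Continuous g)
    (h : E.IsIntegral ((spectrum ℂ M).indicator f) C) (h' : E.IsIntegral ((spectrum ℂ M).indicator g) C') :
    E.IsIntegral ((spectrum ℂ M).indicator (fun z => f z + g z)) (C + C') := by
  have := h.add (isBoundedBorel_indicator_spectrum M hf) (isBoundedBorel_indicator_spectrum M hg) h'
  rwa [← Set.indicator_add'] at this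

lemma isIntegral_mul (_hE : E.IsSpectralMeasureOf M) (hf : Continuous f) (hg : Continuous g)
    (h : E.IsIntegral ((spectrum ℂ M).indicator f) C) (h' : E.IsIntegral ((spectrum ℂ M).indicator g) C') :
    E.IsIntegral ((spectrum ℂ M).indicator (fun z => f z * g z)) (C * C') := by
  have := h.mul (isBoundedBorel_indicator_spectrum M hf) (isBoundedBorel_indicator_spectrum M hg) h'
  have h1 : (spectrum ℂ M).indicator f * (spectrum ℂ M).indicator g = (spectrum ℂ M).indicator (fun z => f z * g z) :=
    (Set.indicator_mul _ f g).symm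
  rwa [h1] at this

lemma isIntegral_smul (_hE : E.IsSpectralMeasureOf M) (c : ℂ)
    (h : E.IsIntegral ((spectrum ℂ M).indicator f) C) :
    E.IsIntegral ((spectrum ℂ M).indicator (fun z => c * f z)) (c • C) := by
  have := h.smul c
  have h1 : c • (spectrum ℂ M).indicator f = (spectrum ℂ M).indicator (fun z => c * f z) :=
    (Set.indicator_const_smul _ c f).symm
  rwa [h1] at this

lemma isIntegral_pow (hE : E.IsSpectralMeasureOf M) (hf : Continuous f)
    (h : E.IsIntegral ((spectrum ℂ M).indicator f) C) (n : ℕ) :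
    E.IsIntegral ((spectrum ℂ M).indicator (fun z => f z ^ n)) (C ^ n) := by
  induction n with
  | zero => simpa using hE.isIntegral_one
  | succ n ih =>
    simp only [pow_succ]
    exact hE.isIntegral_mul (hf.pow n) hf ih h

lemma isIntegral_sum (hE : E.IsSpectralMeasureOf M) {ι : Type*} (s : Finset ι) {f : ι → ℂ → ℂ}
    {C : ι → H →L[ℂ] H} (hf : ∀ i, Continuous (f i))
    (h : ∀ i, E.IsIntegral ((spectrum ℂ M).indicator (f i)) (C i)) :
    E.IsIntegral ((spectrum ℂ M).indicator (fun z => ∑ i ∈ s, f i z)) (∑ i ∈ s, C i) := by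
  classical
  induction s using Finset.induction_on with
  | empty => intro x; simp
  | insert i s hi ih =>
    simp only [Finset.sum_insert hi]
    exact hE.isIntegral_add (hf i) (by fun_prop) (h i) ih

lemma isIntegral_aeval (hE : E.IsSpectralMeasureOf M) (hf : Continuous f)
    (h : E.IsIntegral ((spectrum ℂ M).indicator f) C) (p : Polynomial ℂ) :
    E.IsIntegral ((spectrum ℂ M).indicator (fun z => p.eval (f z))) (Polynomial.aeval C p) := by
  rw [Polynomial.aeval_eq_sum_range]
  simp only [Polynomial.eval_eq_sum_range]
  exact hE.isIntegral_sum _ (fun i => by fun_prop) fun i =>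
    hE.isIntegral_smul _ (hE.isIntegral_pow hf h i)

lemma isIntegral_mvPolyEval (hE : E.IsSpectralMeasureOf M) (hf : Continuous f) (hg : Continuous g)
    (h : E.IsIntegral ((spectrum ℂ M).indicator f) C) (h' : E.IsIntegral ((spectrum ℂ M).indicator g) C')
    (s : MvPolynomial (Fin 2) ℂ) :
    E.IsIntegral ((spectrum ℂ M).indicator (fun z => MvPolynomial.eval ![f z, g z] s))
      (mvPolyEval s C C') := by
  simp only [MvPolynomial.eval_eq', Fin.prod_univ_two, Matrix.cons_val_zero, Matrix.cons_val_one]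
  exact hE.isIntegral_sum _ (fun i => by fun_prop) fun m =>
    hE.isIntegral_smul _ (hE.isIntegral_mul (hf.pow _) (hg.pow _) (hE.isIntegral_pow hf h _)
      (hE.isIntegral_pow hg h' _))

end ProjMeasure.IsSpectralMeasureOf

end JointPolynomials

/-! ### Spectral representation of `Θ(A)`, `Θ(B)` and `Θ(p(A) + q(B))` -/

namespace DefinitizableNormal

variable {K : Type*} [NormedAddCommGroup K] [InnerProductSpace ℂ K] [CompleteSpace K]
variable {κ : KreinStructure K} (D : DefinitizableNormal κ)

lemma isSpectralMeasureOf_E : D.E.IsSpectralMeasureOf (D.Θ D.N) :=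
  Classical.epsilon_spec (exists_isSpectralMeasureOf _ D.isStarNormal_Θ_N)

lemma Θ_A_eq : D.Θ D.A = (1 / 2 : ℂ) • (D.Θ D.N + ContinuousLinearMap.adjoint (D.Θ D.N)) := by
  rw [adjoint_Θ_N, Θ_N_eq, add_add_sub_cancel, ← two_smul ℂ, smul_smul]
  norm_num

lemma Θ_B_eq : D.Θ D.B =
    (1 / (2 * Complex.I) : ℂ) • (D.Θ D.N - ContinuousLinearMap.adjoint (D.Θ D.N)) := by
  rw [adjoint_Θ_N, Θ_N_eq, add_sub_sub_cancel, ← two_smul ℂ, smul_smul, smul_smul]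
  have : 1 / (2 * Complex.I) * 2 * Complex.I = 1 := by field_simp
  rw [this, one_smul]

lemma re_eq_mul (z : ℂ) : (z.re : ℂ) = 1 / 2 * (z + starRingEnd ℂ z) := by
  rw [Complex.add_conj]
  push_cast
  ring

lemma im_eq_mul (z : ℂ) : (z.im : ℂ) = 1 / (2 * Complex.I) * (z - starRingEnd ℂ z) := by
  rw [Complex.sub_conj]
  push_cast
  field_simp

lemma cfc_re : cfc (fun z : ℂ => (z.re : ℂ)) (D.Θ D.N) = D.Θ D.A := by
  have hM := D.isStarNormal_Θ_N
  simp only [re_eq_mul]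
  have h1 : cfc (fun z : ℂ => starRingEnd ℂ z) (D.Θ D.N) = star (D.Θ D.N) := cfc_star_id ..
  rw [cfc_const_mul (R := ℂ) .., cfc_add (R := ℂ) .., cfc_id' .., h1, Θ_A_eq]
  rfl

lemma cfc_im : cfc (fun z : ℂ => (z.im : ℂ)) (D.Θ D.N) = D.Θ D.B := by
  have hM := D.isStarNormal_Θ_N
  simp only [im_eq_mul]
  have h1 : cfc (fun z : ℂ => starRingEnd ℂ z) (D.Θ D.N) = star (D.Θ D.N) := cfc_star_id ..
  rw [cfc_const_mul (R := ℂ) .., cfc_sub (R := ℂ) .., cfc_id' .., h1, Θ_B_eq]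
  rfl

lemma eval_map_ofReal (p : Polynomial ℝ) (x : ℝ) :
    (p.map Complex.ofRealHom).eval (x : ℂ) = ((p.eval x : ℝ) : ℂ) :=
  Polynomial.eval_map_apply Complex.ofRealHom x

lemma commute_pA_sum : Commute D.pA (D.pA + D.qB) :=
  D.commute_sum (D.commute_pA (Commute.refl _)).symm (D.commute_pA D.commute_A_B.symm).symm

lemma commute_qB_sum : Commute D.qB (D.pA + D.qB) :=
  D.commute_sum (D.commute_qB D.commute_A_B).symm (D.commute_qB (Commute.refl _)).symm

lemma Θ_pA : D.Θ D.pA = Polynomial.aeval (D.Θ D.A) (D.p.map Complex.ofRealHom) :=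
  D.Θ_realPolyEval D.commute_A_sum D.p

lemma Θ_qB : D.Θ D.qB = Polynomial.aeval (D.Θ D.B) (D.q.map Complex.ofRealHom) :=
  D.Θ_realPolyEval D.commute_B_sum D.q

lemma cfc_p : cfc (fun z : ℂ => ((D.p.eval z.re : ℝ) : ℂ)) (D.Θ D.N) = D.Θ D.pA := by
  have hM := D.isStarNormal_Θ_N
  simp only [← eval_map_ofReal]
  rw [cfc_map_polynomial .., cfc_re, Θ_pA]

lemma cfc_q : cfc (fun z : ℂ => ((D.q.eval z.im : ℝ) : ℂ)) (D.Θ D.N) = D.Θ D.qB := by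
  have hM := D.isStarNormal_Θ_N
  simp only [← eval_map_ofReal]
  rw [cfc_map_polynomial .., cfc_im, Θ_qB]

lemma cfc_p_add_q : cfc (fun z : ℂ => ((D.p.eval z.re : ℝ) : ℂ) + ((D.q.eval z.im : ℝ) : ℂ)) (D.Θ D.N) =
    D.Θ (D.pA + D.qB) := by
  rw [cfc_add (R := ℂ) .., cfc_p, cfc_q, Θ_add _ D.commute_pA_sum D.commute_qB_sum]

/-- Domination applies because `Θ(p(A)) = R₁R₁* Θ(p(A) + q(B))` with `‖R₁R₁*‖ ≤ 1`. Together with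
the estimate for `q` it excludes cancellation in `p + q` on `σ(Θ(N))`, whatever the signs of `p` and
`q`. -/
lemma abs_p_le {z : ℂ} (hz : z ∈ D.specΘ) :
    |D.p.eval z.re| ≤ |D.p.eval z.re + D.q.eval z.im| := by
  have := norm_le_norm_of_cfc_eq_mul D.isStarNormal_Θ_N (S := D.S₁)
    (f := fun z => ((D.p.eval z.re : ℝ) : ℂ))
    (g := fun z => ((D.p.eval z.re : ℝ) : ℂ) + ((D.q.eval z.im : ℝ) : ℂ)) (by fun_prop) (by fun_prop)
    D.norm_S₁_le (by rw [cfc_p, cfc_p_add_q, S₁_mul_Θ_sum]) hz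
  rwa [← Complex.ofReal_add, Complex.norm_real, Complex.norm_real] at this

lemma abs_q_le {z : ℂ} (hz : z ∈ D.specΘ) :
    |D.q.eval z.im| ≤ |D.p.eval z.re + D.q.eval z.im| := by
  have := norm_le_norm_of_cfc_eq_mul D.isStarNormal_Θ_N (S := D.S₂)
    (f := fun z => ((D.q.eval z.im : ℝ) : ℂ))
    (g := fun z => ((D.p.eval z.re : ℝ) : ℂ) + ((D.q.eval z.im : ℝ) : ℂ)) (by fun_prop) (by fun_prop)
    D.norm_S₂_le (by rw [cfc_q, cfc_p_add_q, S₂_mul_Θ_sum]) hz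
  rwa [← Complex.ofReal_add, Complex.norm_real, Complex.norm_real] at this

lemma isIntegral_Θ_A : D.E.IsIntegral (D.specΘ.indicator fun z => (z.re : ℂ)) (D.Θ D.A) := by
  have hE := D.isSpectralMeasureOf_E
  have h1 := hE.isIntegral_self
  have h2 := h1.adjoint
  have h3 : (fun z => starRingEnd ℂ ((spectrum ℂ (D.Θ D.N)).indicator (fun z => z) z)) =
      (spectrum ℂ (D.Θ D.N)).indicator fun z => starRingEnd ℂ z :=
    Set.indicator_comp_of_zero (g := starRingEnd ℂ) (map_zero _) |>.symm
  rw [h3] at h2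
  simp only [re_eq_mul]
  rw [Θ_A_eq]
  exact hE.isIntegral_smul _ (hE.isIntegral_add continuous_id Complex.continuous_conj h1 h2)

lemma isIntegral_Θ_B : D.E.IsIntegral (D.specΘ.indicator fun z => (z.im : ℂ)) (D.Θ D.B) := by
  have hE := D.isSpectralMeasureOf_E
  have h1 := hE.isIntegral_self
  have h3 := hE.isIntegral_smul (-Complex.I) h1
  have h4 := hE.isIntegral_smul Complex.I D.isIntegral_Θ_A
  have h5 := hE.isIntegral_add (by fun_prop) (by fun_prop) h3 h4
  have h6 : -Complex.I • D.Θ D.N + Complex.I • D.Θ D.A = D.Θ D.B := by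
    rw [Θ_N_eq, smul_add, smul_smul]
    simp
  rw [h6] at h5
  have h7 : (fun z : ℂ => (z.im : ℂ)) = fun z => -Complex.I * z + Complex.I * (z.re : ℂ) := by
    ext z
    apply Complex.ext <;> simp
  rw [h7]
  exact h5

lemma isIntegral_Θ_sum : D.E.IsIntegral
    (D.specΘ.indicator fun z => ((D.p.eval z.re : ℝ) : ℂ) + ((D.q.eval z.im : ℝ) : ℂ))
    (D.Θ (D.pA + D.qB)) := by
  have hE := D.isSpectralMeasureOf_E
  rw [D.Θ_add D.commute_pA_sum D.commute_qB_sum, Θ_pA, Θ_qB]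
  simp only [← eval_map_ofReal]
  exact hE.isIntegral_add (by fun_prop) (by fun_prop)
    (hE.isIntegral_aeval (by fun_prop) D.isIntegral_Θ_A _)
    (hE.isIntegral_aeval (by fun_prop) D.isIntegral_Θ_B _)

lemma isIntegral_mvPolyEval (s : MvPolynomial (Fin 2) ℂ) : D.E.IsIntegral
    (D.specΘ.indicator fun z => MvPolynomial.eval ![(z.re : ℂ), (z.im : ℂ)] s)
    (mvPolyEval s (D.Θ D.A) (D.Θ D.B)) :=
  D.isSpectralMeasureOf_E.isIntegral_mvPolyEval (by fun_prop) (by fun_prop) D.isIntegral_Θ_A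
    D.isIntegral_Θ_B s

end DefinitizableNormal

/-! ### Gelfand theory in the bicommutant -/

section Bicommutant

variable {R : Type*} [NormedRing R] [NormedAlgebra ℂ R]

/-- The bicommutant of a set. -/
abbrev bicommutant (S : Set R) : Subalgebra ℂ R := Subalgebra.centralizer ℂ S.centralizer

lemma mem_bicommutant {S : Set R} {a : R} :
    a ∈ bicommutant S ↔ ∀ c, (∀ b ∈ S, Commute c b) → Commute c a := by
  rw [Subalgebra.mem_centralizer_iff]
  refine forall_congr' fun c => imp_congr_left ?_
  rw [Set.mem_centralizer_iff]
  exact forall₂_congr fun b _ => eq_comm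

lemma subset_bicommutant (S : Set R) : S ⊆ bicommutant S := Set.subset_centralizer_centralizer

/-- Whatever commutes with `a` commutes with its inverse. Consequently characters of the bicommutant
take values in the spectrum relative to the full algebra. -/
lemma isUnit_of_isUnit_coe_bicommutant {S : Set R} {a : bicommutant S} (h : IsUnit (a : R)) :
    IsUnit a := by
  obtain ⟨u, hu⟩ := h
  have hmem : ((u⁻¹ : Rˣ) : R) ∈ bicommutant S := by
    rw [mem_bicommutant]
    intro c hc
    have h1 := mem_bicommutant.mp a.2 c hc
    rw [← hu] at h1
    exact h1.units_inv_right
  refine isUnit_iff_exists.mpr ⟨⟨_, hmem⟩, Subtype.ext ?_, Subtype.ext ?_⟩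
  · change (a : R) * ((u⁻¹ : Rˣ) : R) = 1
    rw [← hu, Units.mul_inv]
  · change ((u⁻¹ : Rˣ) : R) * (a : R) = 1
    rw [← hu, Units.inv_mul]

lemma apply_mem_spectrum_coe {S : Set R} (χ : bicommutant S →ₐ[ℂ] ℂ) (a : bicommutant S) :
    χ a ∈ spectrum ℂ (a : R) := by
  rw [spectrum.mem_iff]
  intro h
  have h1 : IsUnit (algebraMap ℂ (bicommutant S) (χ a) - a) := isUnit_of_isUnit_coe_bicommutant h
  have h2 := h1.map χ
  simp at h2

/-- Gelfand's theorem for the bicommutant of a commuting set of operators. -/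
lemma isUnit_of_forall_character [CompleteSpace R] {S : Set R}
    (hS : ∀ a ∈ S, ∀ b ∈ S, a * b = b * a) {a : bicommutant S}
    (h : ∀ χ : bicommutant S →ₐ[ℂ] ℂ, χ a ≠ 0) : IsUnit (a : R) := by
  have hcl : IsClosed (bicommutant S : Set R) := Set.isClosed_centralizer _
  have hcomp : CompleteSpace (bicommutant S) := hcl.completeSpace_coe
  -- The bicommutant of a commuting set is commutative; this and completeness are what Gelfand's
  -- theorem requires.
  let _ : NormedCommRing (bicommutant S) :=
    { (inferInstance : NormedRing (bicommutant S)) with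
      mul_comm := fun x y => Subtype.ext
        (Set.centralizer_centralizer_comm_of_comm hS _ x.2 _ y.2) }
  let _ : NormedAlgebra ℂ (bicommutant S) :=
    { (inferInstance : Algebra ℂ (bicommutant S)) with
      norm_smul_le := fun c x => norm_smul_le c (x : R) }
  by_contra hu
  have hu' : ¬ IsUnit a := fun h => hu (h.map (bicommutant S).subtype)
  obtain ⟨χ, hχ⟩ := WeakDual.CharacterSpace.exists_apply_eq_zero hu'
  exact h (WeakDual.CharacterSpace.toAlgHom χ) hχ

/-- `h₁` shows that `χ` kills `p(a) + q(b)`. This is a factor in `h₂` and `h₃`, so the squares of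
`χ(x)` and `p(χ(a))` vanish; what is left of `hχ` is the value of `s`. -/
lemma eval_eq_zero_of_character {𝒜 : Type*} [Ring 𝒜] [Algebra ℂ 𝒜] (χ : 𝒜 →ₐ[ℂ] ℂ)
    {p q : Polynomial ℂ} {s : MvPolynomial (Fin 2) ℂ} {a b x x' y w : 𝒜}
    (h₁ : ((∑ m ∈ s.support, s.coeff m • (a ^ m 0 * b ^ m 1)) + x) * y =
      Polynomial.aeval a p + Polynomial.aeval b q)
    (h₂ : x * x = (Polynomial.aeval a p + Polynomial.aeval b q) * x')
    (h₃ : Polynomial.aeval a p * Polynomial.aeval a p =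
      (Polynomial.aeval a p + Polynomial.aeval b q) * w)
    (hχ : χ ((∑ m ∈ s.support, s.coeff m • (a ^ m 0 * b ^ m 1)) + x) = 0) :
    p.eval (χ a) = 0 ∧ q.eval (χ b) = 0 ∧ MvPolynomial.eval ![χ a, χ b] s = 0 := by
  have hp : χ (Polynomial.aeval a p) = p.eval (χ a) := by
    rw [← Polynomial.coe_aeval_eq_eval]
    exact (Polynomial.aeval_algHom_apply χ a p).symm
  have hq : χ (Polynomial.aeval b q) = q.eval (χ b) := by
    rw [← Polynomial.coe_aeval_eq_eval]
    exact (Polynomial.aeval_algHom_apply χ b q).symm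
  have hP : p.eval (χ a) + q.eval (χ b) = 0 := by
    rw [← hp, ← hq, ← map_add, ← h₁, map_mul, hχ, zero_mul]
  have hx : χ x = 0 := by
    have := congrArg χ h₂
    rw [map_mul, map_mul, map_add, hp, hq, hP, zero_mul] at this
    exact mul_self_eq_zero.mp this
  have hp0 : p.eval (χ a) = 0 := by
    have := congrArg χ h₃
    rw [map_mul, map_mul, map_add, hp, hq, hP, zero_mul] at this
    exact mul_self_eq_zero.mp this
  refine ⟨hp0, by rwa [hp0, zero_add] at hP, ?_⟩
  rw [map_add, hx, add_zero, map_sum] at hχ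
  rw [← hχ, MvPolynomial.eval_eq']
  refine Finset.sum_congr rfl fun m _ => ?_
  rw [map_smul, map_mul, map_pow, map_pow, Fin.prod_univ_two]
  rfl

/-- Invertibility modulo an operator of the form `T G T*`, where `p(a) + q(b)` plays the role
of `T T*`. -/
lemma isUnit_of_joint_zeros [CompleteSpace R] {S : Set R}
    (hS : ∀ a ∈ S, ∀ b ∈ S, a * b = b * a) {p q : Polynomial ℂ} {s : MvPolynomial (Fin 2) ℂ}
    {a b x x' y w : R} (ha : a ∈ bicommutant S) (hb : b ∈ bicommutant S) (hx : x ∈ bicommutant S)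
    (hx' : x' ∈ bicommutant S) (hy : y ∈ bicommutant S) (hw : w ∈ bicommutant S)
    (h₁ : ((∑ m ∈ s.support, s.coeff m • (a ^ m 0 * b ^ m 1)) + x) * y =
      Polynomial.aeval a p + Polynomial.aeval b q)
    (h₂ : x * x = (Polynomial.aeval a p + Polynomial.aeval b q) * x')
    (h₃ : Polynomial.aeval a p * Polynomial.aeval a p =
      (Polynomial.aeval a p + Polynomial.aeval b q) * w)
    (hs : ∀ α β, p.eval α = 0 → q.eval β = 0 →
      α + Complex.I * β ∈ spectrum ℂ (a + Complex.I • b) →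
      α - Complex.I * β ∈ spectrum ℂ (a - Complex.I • b) → MvPolynomial.eval ![α, β] s ≠ 0) :
    IsUnit ((∑ m ∈ s.support, s.coeff m • (a ^ m 0 * b ^ m 1)) + x) := by
  -- All elements are lifted to the bicommutant, where characters live; the identities pull back
  -- because the inclusion is injective.
  obtain ⟨a, rfl⟩ : ∃ a' : bicommutant S, (bicommutant S).val a' = a := ⟨⟨a, ha⟩, rfl⟩
  obtain ⟨b, rfl⟩ : ∃ b' : bicommutant S, (bicommutant S).val b' = b := ⟨⟨b, hb⟩, rfl⟩
  obtain ⟨x, rfl⟩ : ∃ x₁ : bicommutant S, (bicommutant S).val x₁ = x := ⟨⟨x, hx⟩, rfl⟩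
  obtain ⟨x', rfl⟩ : ∃ x₁ : bicommutant S, (bicommutant S).val x₁ = x' := ⟨⟨x', hx'⟩, rfl⟩
  obtain ⟨y, rfl⟩ : ∃ y₁ : bicommutant S, (bicommutant S).val y₁ = y := ⟨⟨y, hy⟩, rfl⟩
  obtain ⟨w, rfl⟩ : ∃ w₁ : bicommutant S, (bicommutant S).val w₁ = w := ⟨⟨w, hw⟩, rfl⟩
  have hval : Function.Injective (bicommutant S).val := Subtype.val_injective
  simp only [Polynomial.aeval_algHom_apply, ← map_pow, ← map_mul, ← map_add, ← map_smul,
    ← map_sum, hval.eq_iff] at h₁ h₂ h₃ ⊢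
  change IsUnit (((∑ m ∈ s.support, s.coeff m • (a ^ m 0 * b ^ m 1)) + x : bicommutant S) : R)
  refine isUnit_of_forall_character hS fun χ hχ => ?_
  obtain ⟨h1, h2, h3⟩ := eval_eq_zero_of_character χ h₁ h₂
    (by simpa only [map_mul] using h₃) hχ
  refine hs _ _ h1 h2 ?_ ?_ h3
  · have := apply_mem_spectrum_coe χ (a + Complex.I • b)
    rwa [map_add, map_smul, smul_eq_mul] at this
  · have := apply_mem_spectrum_coe χ (a - Complex.I • b)
    rwa [map_sub, map_smul, smul_eq_mul] at this

end Bicommutant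

/-- The entry with index `(0,0)` of a product is the product of those entries. This is all that
invertibility in the local algebras is used for. -/
lemma LocAlg.IsInvertible.coeff_zero_ne_zero {I : Finset (ℕ × ℕ)} {a : LocAlg I}
    (h : a.IsInvertible) (hI : (0, 0) ∈ I) : a.coeff 0 0 ≠ 0 := by
  obtain ⟨b, hab, -⟩ := h
  have h1 := congrFun hab ⟨(0, 0), hI⟩
  have h2 : (a * b) ⟨(0, 0), hI⟩ = a.coeff 0 0 * b.coeff 0 0 := by
    change ∑ c ∈ Finset.range 1, ∑ d ∈ Finset.range 1, _ = _
    simp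
  have h3 : (1 : LocAlg I) ⟨(0, 0), hI⟩ = 1 := if_pos rfl
  rw [h2, h3] at h1
  exact left_ne_zero_of_mul_eq_one h1

lemma ProjMeasure.IsIntegral.mul_proj_singleton {H : Type*} [NormedAddCommGroup H]
    [InnerProductSpace ℂ H] [CompleteSpace H] {E : ProjMeasure H} {f : ℂ → ℂ} {F : H →L[ℂ] H}
    (hf : IsBoundedBorel f) (h : E.IsIntegral f F) (w : ℂ) :
    F * E.proj {w} = f w • E.proj {w} := by
  have hw : MeasurableSet ({w} : Set ℂ) := measurableSet_singleton w
  refine (h.mul_proj hf hw).unique ?_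
  have : ({w} : Set ℂ).indicator f = ({w} : Set ℂ).indicator fun _ => f w := by
    ext z
    by_cases hz : z = w
    · subst hz; simp
    · simp [hz]
  rw [this]
  exact IsIntegral.indicator_const _ hw

namespace DefinitizableNormal

variable {K : Type*} [NormedAddCommGroup K] [InnerProductSpace ℂ K] [CompleteSpace K]
variable {κ : KreinStructure K} (D : DefinitizableNormal κ)

/-! ### Critical points and local algebras -/

lemma p_map_ne_zero : D.p.map Complex.ofRealHom ≠ 0 :=
  (Polynomial.map_ne_zero_iff Complex.ofRealHom.injective).mpr D.definitizing_p.1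

lemma q_map_ne_zero : D.q.map Complex.ofRealHom ≠ 0 :=
  (Polynomial.map_ne_zero_iff Complex.ofRealHom.injective).mpr D.definitizing_q.1

lemma aeval_eq_eval_map (p : Polynomial ℝ) (ξ : ℂ) :
    Polynomial.aeval ξ p = (p.map Complex.ofRealHom).eval ξ := by
  rw [Polynomial.eval_map]
  rfl

lemma dp_pos {ξ : ℂ} (h : Polynomial.aeval ξ D.p = 0) : 0 < D.dp ξ :=
  (Polynomial.rootMultiplicity_pos D.p_map_ne_zero).mpr (by
    rw [Polynomial.IsRoot.def, ← aeval_eq_eval_map, h])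

lemma dq_pos {η : ℂ} (h : Polynomial.aeval η D.q = 0) : 0 < D.dq η :=
  (Polynomial.rootMultiplicity_pos D.q_map_ne_zero).mpr (by
    rw [Polynomial.IsRoot.def, ← aeval_eq_eval_map, h])

lemma mem_Zreal_iff {z : ℂ} : z ∈ D.Zreal ↔ D.p.eval z.re = 0 ∧ D.q.eval z.im = 0 := by
  change D.IsZeroPair z.re z.im ↔ _
  rw [IsZeroPair, aeval_eq_eval_map, aeval_eq_eval_map, eval_map_ofReal, eval_map_ofReal,
    Complex.ofReal_eq_zero, Complex.ofReal_eq_zero]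

lemma finite_Zreal : D.Zreal.Finite := by
  have h1 := Polynomial.finite_setOfPred_isRoot D.definitizing_p.1
  have h2 := Polynomial.finite_setOfPred_isRoot D.definitizing_q.1
  refine ((h1.prod h2).image fun x : ℝ × ℝ => (⟨x.1, x.2⟩ : ℂ)).subset fun z hz => ?_
  rw [mem_Zreal_iff] at hz
  exact ⟨(z.re, z.im), hz, rfl⟩

lemma finite_spec_inter_Zreal : (D.specΘ ∩ D.Zreal).Finite := D.finite_Zreal.inter_of_right _

lemma measurableSet_spec : MeasurableSet D.specΘ := ProjMeasure.measurableSet_spectrum _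

lemma measurableSet_spec_diff : MeasurableSet (D.specΘ \ D.Zreal) :=
  D.measurableSet_spec.diff D.finite_Zreal.measurableSet

lemma zero_mem_indexA (m n : ℕ) : (0, 0) ∈ indexA m n := by
  rcases Nat.eq_zero_or_pos m with rfl | hm
  · simp [indexA]
  rcases Nat.eq_zero_or_pos n with rfl | hn
  · simp [indexA]
  simp [indexA, hm, hn]

lemma zero_mem_index (ζ : D.Dom) : (0, 0) ∈ D.index ζ := by
  rcases ζ with z | w
  · simp only [index]
    split_ifs <;> exact zero_mem_indexA _ _
  · simp only [index, indexB, Finset.mem_product, Finset.mem_range]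
    exact ⟨D.dp_pos w.2.1.1, D.dq_pos w.2.1.2⟩

lemma coeff_ofPoly (s : MvPolynomial (Fin 2) ℂ) (ζ : D.Dom) {k l : ℕ} (h : (k, l) ∈ D.index ζ) :
    (D.ofPoly s ζ).coeff k l = (1 / ((k.factorial : ℂ) * (l.factorial : ℂ))) *
      MvPolynomial.eval ![(D.coord ζ).1, (D.coord ζ).2]
        ((MvPolynomial.pderiv 0)^[k] ((MvPolynomial.pderiv 1)^[l] s)) :=
  dif_pos h

lemma coeff_zero_ofPoly (s : MvPolynomial (Fin 2) ℂ) (ζ : D.Dom) :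
    (D.ofPoly s ζ).coeff 0 0 = MvPolynomial.eval ![(D.coord ζ).1, (D.coord ζ).2] s := by
  rw [D.coeff_ofPoly s ζ (D.zero_mem_index ζ)]
  simp

lemma coeff_add {I : Finset (ℕ × ℕ)} (a b : LocAlg I) (k l : ℕ) :
    (a + b).coeff k l = a.coeff k l + b.coeff k l := by
  unfold LocAlg.coeff
  split_ifs
  · rfl
  · simp

lemma coeff_sub {I : Finset (ℕ × ℕ)} (a b : LocAlg I) (k l : ℕ) :
    (a - b).coeff k l = a.coeff k l - b.coeff k l := by
  unfold LocAlg.coeff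
  split_ifs
  · rfl
  · simp

lemma eval_pPoly (v : Fin 2 → ℂ) :
    MvPolynomial.eval v D.pPoly = Polynomial.aeval (v 0) D.p := by
  rw [pPoly, ← MvPolynomial.coe_aeval_eq_eval, aeval_eq_eval_map, ← Polynomial.coe_aeval_eq_eval]
  change (MvPolynomial.aeval v) _ = _
  rw [← Polynomial.aeval_algHom_apply, MvPolynomial.aeval_X]

lemma eval_qPoly (v : Fin 2 → ℂ) :
    MvPolynomial.eval v D.qPoly = Polynomial.aeval (v 1) D.q := by
  rw [qPoly, ← MvPolynomial.coe_aeval_eq_eval, aeval_eq_eval_map, ← Polynomial.coe_aeval_eq_eval]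
  change (MvPolynomial.aeval v) _ = _
  rw [← Polynomial.aeval_algHom_apply, MvPolynomial.aeval_X]

variable {D} {φ : D.Symbol} {s : MvPolynomial (Fin 2) ℂ} {g : ℂ → ℂ} {h : ℂ → ℂ × ℂ}

/-- Both multiplicities are positive at a zero pair, so `(0,0)` is among the indices at which
elements of `ℛ` vanish. -/
lemma InR.coeff_zero_eq (hR : D.InR (φ - D.ofPoly s)) {ζ : D.Dom}
    (hζ : D.IsZeroPair (D.coord ζ).1 (D.coord ζ).2) :
    (φ ζ).coeff 0 0 = MvPolynomial.eval ![(D.coord ζ).1, (D.coord ζ).2] s := by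
  have h1 := hR ζ hζ 0 (D.dp_pos hζ.1) 0 (D.dq_pos hζ.2)
  rw [Pi.sub_apply, coeff_sub, D.coeff_zero_ofPoly, sub_eq_zero] at h1
  exact h1

namespace IsDecomposition

lemma planeVal_eq (hd : D.IsDecomposition φ s g h) {z : ℂ} (hz : z ∈ D.specΘ)
    (hz' : z ∉ D.Zreal) : D.planeVal φ z =
      MvPolynomial.eval ![(z.re : ℂ), (z.im : ℂ)] s +
        g z * (((D.p.eval z.re : ℝ) : ℂ) + ((D.q.eval z.im : ℝ) : ℂ)) := by
  have hmem : z ∈ D.specΘ ∪ D.Zreal := Or.inl hz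
  have h1 := congrArg (fun a => LocAlg.coeff a 0 0) (hd.eq z hz)
  simp only [coeff_add, D.coeff_zero_ofPoly] at h1
  rw [planeVal, planeCoeff, dif_pos hmem, h1]
  congr 1
  have h0 := D.zero_mem_index (Sum.inl ⟨z, hmem⟩)
  rw [LocAlg.coeff, dif_pos h0, mulRem, if_neg hz']
  have h2 : (D.ofPoly D.pPoly + D.ofPoly D.qPoly) (Sum.inl ⟨z, hmem⟩) ⟨(0, 0), h0⟩ =
      ((D.ofPoly D.pPoly) (Sum.inl ⟨z, hmem⟩)).coeff 0 0 +
        ((D.ofPoly D.qPoly) (Sum.inl ⟨z, hmem⟩)).coeff 0 0 := by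
    rw [← coeff_add, LocAlg.coeff, dif_pos h0]
    rfl
  rw [h2, coeff_zero_ofPoly, coeff_zero_ofPoly, eval_pPoly, eval_qPoly, aeval_eq_eval_map,
    aeval_eq_eval_map, mul_comm]
  simp only [Matrix.cons_val_zero, Matrix.cons_val_one, coord, eval_map_ofReal]

lemma isBoundedBorel (hd : D.IsDecomposition φ s g h) :
    IsBoundedBorel ((D.specΘ \ D.Zreal).indicator g) := by
  obtain ⟨C, hC⟩ := hd.bounded
  refine ⟨?_, max C 0, fun z => ?_⟩
  · refine measurable_of_restrict_of_restrict_compl D.measurableSet_spec_diff ?_ ?_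
    · convert! hd.measurable using 1
      ext z
      simp
    · convert! (measurable_const (a := (0 : ℂ))) using 1
      ext z
      simp [Set.indicator_of_notMem z.2]
  · by_cases hz : z ∈ D.specΘ \ D.Zreal
    · rw [Set.indicator_of_mem hz]
      exact (hC z hz).trans (le_max_left _ _)
    · rw [Set.indicator_of_notMem hz, norm_zero]
      exact le_max_right _ _

end IsDecomposition

end DefinitizableNormal

namespace DefinitizableNormal

variable {K : Type*} [NormedAddCommGroup K] [InnerProductSpace ℂ K] [CompleteSpace K]
variable {κ : KreinStructure K} {D : DefinitizableNormal κ}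
variable {φ : D.Symbol} {s : MvPolynomial (Fin 2) ℂ} {g : ℂ → ℂ} {h : ℂ → ℂ × ℂ}

/-! ### Commutation -/

variable (D) in
lemma commute_S₁_proj (w : ℂ) : Commute D.S₁ (D.E.proj {w}) :=
  D.isSpectralMeasureOf_E.commute_proj_singleton D.adjoint_S₁
    (D.commute_Θ_S₁ D.commute_N_sum (D.commute_pA D.commute_N_A)).symm w

variable (D) in
lemma commute_S₂_proj (w : ℂ) : Commute D.S₂ (D.E.proj {w}) :=
  D.isSpectralMeasureOf_E.commute_proj_singleton D.adjoint_S₂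
    (D.commute_Θ_S₂ D.commute_N_sum (D.commute_qB D.commute_N_B)).symm w

variable (D) in
lemma integralR_eq (g : ℂ → ℂ) (h : ℂ → ℂ × ℂ) : D.integralR g h =
    D.E.integral (D.specΘ \ D.Zreal) g + ∑ w ∈ D.finite_spec_inter_Zreal.toFinset,
      ((h w).1 • (D.S₁ * D.E.proj {w}) + (h w).2 • (D.S₂ * D.E.proj {w})) := by
  rw [integralR, finsum_mem_eq_finite_toFinset_sum _ D.finite_spec_inter_Zreal]
  rfl

/-- On the range of `E{w}` the integral `F` acts as the scalar `f w`, so it commutes with any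
operator that `E{w}` reduces. -/
lemma commute_mul_proj_of_isIntegral {S : D.V →L[ℂ] D.V} {w : ℂ} (hS : Commute S (D.E.proj {w}))
    {f : ℂ → ℂ} {F : D.V →L[ℂ] D.V} (hf : IsBoundedBorel f) (hF : D.E.IsIntegral f F) :
    Commute (S * D.E.proj {w}) F := by
  have hw : MeasurableSet ({w} : Set ℂ) := measurableSet_singleton w
  have h1 := hF.mul_proj_singleton hf w
  rw [commute_iff_eq, mul_assoc, ← (hF.commute_proj hf hw).eq, h1, hS.eq, ← mul_assoc, h1,
    mul_smul_comm, smul_mul_assoc, hS.eq]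

lemma commute_integralR (hg : IsBoundedBorel ((D.specΘ \ D.Zreal).indicator g))
    {f : ℂ → ℂ} {F : D.V →L[ℂ] D.V} (hf : IsBoundedBorel f) (hF : D.E.IsIntegral f F) :
    Commute (D.integralR g h) F := by
  rw [integralR_eq]
  refine Commute.add_left ?_ (Commute.sum_left _ _ _ fun w _ => Commute.add_left ?_ ?_)
  · exact (D.E.isIntegral_integral D.measurableSet_spec_diff hg).commute hg hf hF
  · exact (commute_mul_proj_of_isIntegral (D.commute_S₁_proj w) hf hF).smul_left _
  · exact (commute_mul_proj_of_isIntegral (D.commute_S₂_proj w) hf hF).smul_left _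

variable (D) in
lemma isBoundedBorel_sum : IsBoundedBorel
    (D.specΘ.indicator fun z => ((D.p.eval z.re : ℝ) : ℂ) + ((D.q.eval z.im : ℝ) : ℂ)) :=
  ProjMeasure.isBoundedBorel_indicator_spectrum _ (by fun_prop)

variable (D s) in
lemma isBoundedBorel_eval : IsBoundedBorel
    (D.specΘ.indicator fun z => MvPolynomial.eval ![(z.re : ℂ), (z.im : ℂ)] s) := by
  refine ProjMeasure.isBoundedBorel_indicator_spectrum _ ?_
  have h1 : Continuous fun z : ℂ => ![(z.re : ℂ), (z.im : ℂ)] := by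
    refine continuous_pi fun i => ?_
    fin_cases i
    · exact Complex.continuous_ofReal.comp Complex.continuous_re
    · exact Complex.continuous_ofReal.comp Complex.continuous_im
  exact (MvPolynomial.continuous_eval s).comp h1

variable (D) in
lemma proj_mul_Θ_sum {w : ℂ} (hw : w ∈ D.Zreal) :
    D.E.proj {w} * D.Θ (D.pA + D.qB) = 0 := by
  have h1 := D.isIntegral_Θ_sum
  have h2 := h1.mul_proj_singleton D.isBoundedBorel_sum w
  rw [← (h1.commute_proj D.isBoundedBorel_sum (measurableSet_singleton w)).eq, h2]
  rw [mem_Zreal_iff] at hw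
  by_cases hσ : w ∈ D.specΘ <;> simp [hσ, hw.1, hw.2]

/-- The symbol `p + q` is zero at critical points, so `Θ(p(A) + q(B))` annihilates the ranges of
`E{w}` there and the terms with `R₁` and `R₂` drop out of `Θ(φ(N))`. -/
lemma integralR_mul_Θ_sum : D.integralR g h * D.Θ (D.pA + D.qB) =
    D.E.integral (D.specΘ \ D.Zreal) g * D.Θ (D.pA + D.qB) := by
  rw [integralR_eq, add_mul, Finset.sum_mul, Finset.sum_eq_zero, add_zero]
  intro w hw
  rw [Set.Finite.mem_toFinset] at hw
  rw [add_mul, smul_mul_assoc, smul_mul_assoc, mul_assoc, mul_assoc, D.proj_mul_Θ_sum hw.2]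
  simp

/-- The function that represents `Θ(φ(N))`. -/
def symbolFunction (D : DefinitizableNormal κ) (s : MvPolynomial (Fin 2) ℂ) (g : ℂ → ℂ) : ℂ → ℂ :=
  (D.specΘ.indicator fun z => MvPolynomial.eval ![(z.re : ℂ), (z.im : ℂ)] s) +
    (D.specΘ \ D.Zreal).indicator g *
      (D.specΘ.indicator fun z => ((D.p.eval z.re : ℝ) : ℂ) + ((D.q.eval z.im : ℝ) : ℂ))

lemma isBoundedBorel_symbolFunction (hg : IsBoundedBorel ((D.specΘ \ D.Zreal).indicator g)) :
    IsBoundedBorel (D.symbolFunction s g) :=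
  (D.isBoundedBorel_eval s).add (hg.mul D.isBoundedBorel_sum)

lemma isIntegral_symbolFunction (hg : IsBoundedBorel ((D.specΘ \ D.Zreal).indicator g)) :
    D.E.IsIntegral (D.symbolFunction s g)
      (mvPolyEval s (D.Θ D.A) (D.Θ D.B) + D.integralR g h * D.Θ (D.pA + D.qB)) := by
  rw [integralR_mul_Θ_sum]
  exact (D.isIntegral_mvPolyEval s).add (D.isBoundedBorel_eval s) (hg.mul D.isBoundedBorel_sum)
    ((D.E.isIntegral_integral D.measurableSet_spec_diff hg).mul hg D.isBoundedBorel_sum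
      D.isIntegral_Θ_sum)

lemma symbolFunction_of_notMem {z : ℂ} (hz : z ∉ D.specΘ) : D.symbolFunction s g z = 0 := by
  simp [symbolFunction, hz]

lemma IsDecomposition.symbolFunction_eq_planeVal (hd : D.IsDecomposition φ s g h) {z : ℂ}
    (hz : z ∈ D.specΘ) (hz' : z ∉ D.Zreal) : D.symbolFunction s g z = D.planeVal φ z := by
  rw [hd.planeVal_eq hz hz']
  have : z ∈ D.specΘ \ D.Zreal := ⟨hz, hz'⟩
  simp [symbolFunction, hz, this]

lemma IsDecomposition.symbolFunction_eq_coeff (hd : D.IsDecomposition φ s g h) {z : ℂ}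
    (hz : z ∈ D.specΘ) (hz' : z ∈ D.Zreal) :
    D.symbolFunction s g z = (φ (Sum.inl ⟨z, Or.inl hz⟩)).coeff 0 0 := by
  rw [hd.sub_mem.coeff_zero_eq (ζ := Sum.inl ⟨z, Or.inl hz⟩) hz']
  have : z ∉ D.specΘ \ D.Zreal := fun h => h.2 hz'
  simp [symbolFunction, hz, this, coord]

/-- Off the critical points the closure hypothesis gives a bound. Only finitely many points remain,
and the value at each is the nonzero entry with index `(0,0)` of an invertible element. -/
lemma IsDecomposition.exists_le_norm_symbolFunction (hd : D.IsDecomposition φ s g h)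
    (hinv : ∀ ζ ∈ D.σN, (φ ζ).IsInvertible)
    (hzero : (0 : ℂ) ∉ closure (D.planeVal φ '' (D.specΘ \ D.Zreal))) :
    ∃ c > 0, ∀ z ∈ D.specΘ, c ≤ ‖D.symbolFunction s g z‖ := by
  rw [Metric.mem_closure_iff] at hzero
  push Not at hzero
  obtain ⟨c, hc, hcle⟩ := hzero
  have h1 : ∀ z ∈ D.specΘ ∩ D.Zreal, 0 < ‖D.symbolFunction s g z‖ := by
    rintro z ⟨hz, hz'⟩
    rw [hd.symbolFunction_eq_coeff hz hz', norm_pos_iff]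
    exact (hinv (Sum.inl ⟨z, Or.inl hz⟩) (Or.inl hz)).coeff_zero_ne_zero (D.zero_mem_index _)
  obtain ⟨c', hc', hcle'⟩ : ∃ c' > 0, ∀ z ∈ D.specΘ ∩ D.Zreal, c' ≤ ‖D.symbolFunction s g z‖ := by
    rcases (D.specΘ ∩ D.Zreal).eq_empty_or_nonempty with he | hne
    · exact ⟨1, one_pos, by simp [he]⟩
    · obtain ⟨w, hw, hmin⟩ := Set.exists_min_image _ (fun z => ‖D.symbolFunction s g z‖)
        D.finite_spec_inter_Zreal hne
      exact ⟨_, h1 w hw, hmin⟩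
  refine ⟨min c c', lt_min hc hc', fun z hz => ?_⟩
  by_cases hz' : z ∈ D.Zreal
  · exact (min_le_right _ _).trans (hcle' z ⟨hz, hz'⟩)
  · refine (min_le_left _ _).trans ?_
    have := hcle _ (Set.mem_image_of_mem (D.planeVal φ) ⟨hz, hz'⟩)
    rwa [dist_zero_left, ← hd.symbolFunction_eq_planeVal hz hz'] at this

/-- The inverse of `Θ(φ(N))`. -/
lemma IsDecomposition.exists_inverse (hd : D.IsDecomposition φ s g h)
    (hinv : ∀ ζ ∈ D.σN, (φ ζ).IsInvertible)
    (hzero : (0 : ℂ) ∉ closure (D.planeVal φ '' (D.specΘ \ D.Zreal))) :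
    ∃ (f : ℂ → ℂ) (Y : D.V →L[ℂ] D.V), IsBoundedBorel f ∧ D.E.IsIntegral f Y ∧
      (mvPolyEval s (D.Θ D.A) (D.Θ D.B) + D.integralR g h * D.Θ (D.pA + D.qB)) * Y = 1 := by
  obtain ⟨c, hc, hcle⟩ := hd.exists_le_norm_symbolFunction hinv hzero
  have hb := isBoundedBorel_symbolFunction (s := s) hd.isBoundedBorel
  have hf : IsBoundedBorel (D.symbolFunction s g)⁻¹ := by
    refine ⟨hb.1.inv, c⁻¹, fun z => ?_⟩
    by_cases hz : z ∈ D.specΘ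
    · rw [Pi.inv_apply, norm_inv]
      exact inv_anti₀ hc (hcle z hz)
    · rw [Pi.inv_apply, symbolFunction_of_notMem hz]
      simpa using hc.le
  obtain ⟨Y, hY⟩ := D.E.exists_isIntegral hf
  refine ⟨_, Y, hf, hY, ?_⟩
  have h1 := (isIntegral_symbolFunction (s := s) (h := h) hd.isBoundedBorel).mul hb hf hY
  refine h1.unique ?_
  -- Off the spectrum both factors are zero, by the convention `0⁻¹ = 0`. The product is therefore
  -- the indicator of the spectrum, whose integral is still the identity.
  have h2 : D.symbolFunction s g * (D.symbolFunction s g)⁻¹ =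
      (spectrum ℂ (D.Θ D.N)).indicator fun _ => 1 := by
    ext z
    by_cases hz : z ∈ D.specΘ
    · have h3 : D.symbolFunction s g z ≠ 0 := fun h0 => by
        have := hcle z hz
        rw [h0, norm_zero] at this
        linarith
      have h4 : z ∈ spectrum ℂ (D.Θ D.N) := hz
      simp [h4, h3]
    · have h4 : z ∉ spectrum ℂ (D.Θ D.N) := hz
      simp [h4, symbolFunction_of_notMem hz]
  rw [h2]
  exact D.isSpectralMeasureOf_E.isIntegral_one

/-! ### Multiplication rules for `Ξ` -/

variable (D) in
lemma commute_mvPolyEval {C : K →L[ℂ] K} (hA : Commute D.A C) (hB : Commute D.B C)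
    (s : MvPolynomial (Fin 2) ℂ) : Commute (mvPolyEval s D.A D.B) C :=
  Commute.sum_left _ _ _ fun _ _ => ((hA.pow_left _).mul_left (hB.pow_left _)).smul_left _

variable (D s) in
lemma Θ_mvPolyEval : D.Θ (mvPolyEval s D.A D.B) = mvPolyEval s (D.Θ D.A) (D.Θ D.B) := by
  refine D.Θ_eq (D.commute_mvPolyEval D.commute_A_sum D.commute_B_sum s) fun v => ?_
  rw [mvPolyEval, mvPolyEval, sum_apply, sum_apply, map_sum]
  refine Finset.sum_congr rfl fun m _ => ?_
  rw [smul_apply, smul_apply, map_smul, ← D.Θ_pow D.commute_A_sum, ← D.Θ_pow D.commute_B_sum,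
    ← D.Θ_mul (D.commute_A_sum.pow_left _) (D.commute_B_sum.pow_left _),
    D.T_Θ ((D.commute_A_sum.pow_left _).mul_left (D.commute_B_sum.pow_left _))]

/-- The bracket on the right is `Θ(φ(N))`. If `Y` inverts it, the product becomes `Ξ 1 = p(A) +
q(B)`, so `φ(N)` divides `p(A) + q(B)`. -/
lemma mvPolyEval_add_Ξ_mul_Ξ (G Y : D.V →L[ℂ] D.V) :
    (mvPolyEval s D.A D.B + D.Ξ G) * D.Ξ Y =
      D.Ξ ((mvPolyEval s (D.Θ D.A) (D.Θ D.B) + G * D.Θ (D.pA + D.qB)) * Y) := by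
  rw [add_mul, D.mul_Ξ (D.commute_mvPolyEval D.commute_A_sum D.commute_B_sum s), Θ_mvPolyEval,
    Ξ_mul_Ξ, add_mul, Ξ_add]

/-- The inner `T* T = Θ(T T*)` can be moved past `G` and out through `T`. A character that kills `T
T*` thus kills `T G T*`, its square being a multiple of `T T*`. -/
lemma Ξ_mul_Ξ_self {G : D.V →L[ℂ] D.V} (hG : Commute G (D.Θ (D.pA + D.qB))) :
    D.Ξ G * D.Ξ G = (D.pA + D.qB) * D.Ξ (G * G) := by
  rw [Ξ_mul_Ξ, D.mul_Ξ (Commute.refl _), hG.eq, mul_assoc]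

lemma commute_Ξ {C : K →L[ℂ] K} (hC : Commute C (D.pA + D.qB)) {F : D.V →L[ℂ] D.V}
    (h : Commute (D.Θ C) F) : Commute C (D.Ξ F) := by
  rw [commute_iff_eq, D.mul_Ξ hC, D.Ξ_mul hC, h.eq]

lemma commute_Ξ_Ξ {F F' : D.V →L[ℂ] D.V} (h : Commute F F') (hF : Commute F (D.Θ (D.pA + D.qB)))
    (hF' : Commute F' (D.Θ (D.pA + D.qB))) : Commute (D.Ξ F) (D.Ξ F') := by
  rw [commute_iff_eq, Ξ_mul_Ξ, Ξ_mul_Ξ, mul_assoc, ← hF'.eq, ← mul_assoc, h.eq, mul_assoc, hF.eq,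
    ← mul_assoc, hF'.eq]

lemma conj_mem_spectrum_N {z : ℂ} (hz : z ∈ spectrum ℂ (κ.adj D.N)) :
    (starRingEnd ℂ) z ∈ spectrum ℂ D.N := by
  rw [spectrum.mem_iff] at hz ⊢
  intro h
  have h1 := κ.isUnit_adj h
  rw [Algebra.algebraMap_eq_smul_one, κ.adj_sub, κ.adj_smul, κ.adj_one, Complex.conj_conj,
    ← Algebra.algebraMap_eq_smul_one] at h1
  exact hz h1

lemma mem_spectrum_union_Zreal_of_isZeroPair {α β : ℂ} (h : D.IsZeroPair α β) (hα : α.im = 0)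
    (hβ : β.im = 0) : α + Complex.I * β ∈ D.Zreal ∧
      ((α + Complex.I * β).re : ℂ) = α ∧ ((α + Complex.I * β).im : ℂ) = β := by
  have h1 : ((α + Complex.I * β).re : ℂ) = α := by apply Complex.ext <;> simp [hα, hβ]
  have h2 : ((α + Complex.I * β).im : ℂ) = β := by apply Complex.ext <;> simp [hα, hβ]
  refine ⟨?_, h1, h2⟩
  change D.IsZeroPair _ _
  rw [h1, h2]
  exact h

/-- Invertibility at the common zeros of `p` and `q`. -/
lemma InR.eval_ne_zero (hR : D.InR (φ - D.ofPoly s)) (hinv : ∀ ζ ∈ D.σN, (φ ζ).IsInvertible)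
    {α β : ℂ} (h : D.IsZeroPair α β) (h1 : α + Complex.I * β ∈ spectrum ℂ D.N)
    (h2 : (starRingEnd ℂ) α + Complex.I * (starRingEnd ℂ) β ∈ spectrum ℂ D.N) :
    MvPolynomial.eval ![α, β] s ≠ 0 := by
  -- A real pair is the critical point `α + iβ` of the plane, for which membership in `σ(N)`
  -- suffices. A nonreal pair belongs to `Z^i` and needs both spectral conditions.
  by_cases him : α.im = 0 ∧ β.im = 0
  · obtain ⟨hz, hre, him'⟩ := mem_spectrum_union_Zreal_of_isZeroPair h him.1 him.2
    have h3 := hR.coeff_zero_eq (ζ := Sum.inl ⟨α + Complex.I * β, Or.inr hz⟩) hz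
    simp only [coord, hre, him'] at h3
    rw [← h3]
    exact (hinv (Sum.inl ⟨α + Complex.I * β, Or.inr hz⟩) (Or.inr ⟨hz, h1⟩)).coeff_zero_ne_zero (D.zero_mem_index _)
  · have h3 := hR.coeff_zero_eq (ζ := Sum.inr ⟨(α, β), h, him⟩) h
    simp only [coord] at h3
    rw [← h3]
    exact (hinv (Sum.inr ⟨(α, β), h, him⟩) ⟨h1, h2⟩).coeff_zero_ne_zero (D.zero_mem_index _)

/-- A commuting set of operators whose bicommutant contains `φ(N)`. -/
def generators (D : DefinitizableNormal κ) (G Y : D.V →L[ℂ] D.V) : Set (K →L[ℂ] K) :=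
  {D.A, D.B, D.Ξ G, D.Ξ (G * G), D.Ξ Y}

lemma generators_commute {G Y : D.V →L[ℂ] D.V} (hGA : Commute G (D.Θ D.A))
    (hGB : Commute G (D.Θ D.B)) (hGP : Commute G (D.Θ (D.pA + D.qB))) (hYA : Commute Y (D.Θ D.A))
    (hYB : Commute Y (D.Θ D.B)) (hYP : Commute Y (D.Θ (D.pA + D.qB))) (hGY : Commute G Y) :
    ∀ a ∈ D.generators G Y, ∀ b ∈ D.generators G Y, a * b = b * a := by
  have hA := D.commute_A_sum
  have hB := D.commute_B_sum
  have h1 := commute_Ξ hA hGA.symm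
  have h2 := commute_Ξ hA (hGA.mul_left hGA).symm
  have h3 := commute_Ξ hA hYA.symm
  have h4 := commute_Ξ hB hGB.symm
  have h5 := commute_Ξ hB (hGB.mul_left hGB).symm
  have h6 := commute_Ξ hB hYB.symm
  have h7 := commute_Ξ_Ξ ((Commute.refl G).mul_right (Commute.refl G)) hGP (hGP.mul_left hGP)
  have h8 := commute_Ξ_Ξ hGY hGP hYP
  have h9 := commute_Ξ_Ξ (hGY.mul_left hGY) (hGP.mul_left hGP) hYP
  have h0 := D.commute_A_B
  simp only [commute_iff_eq] at *
  simp only [generators, Set.mem_insert_iff, Set.mem_singleton_iff]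
  rintro a (rfl | rfl | rfl | rfl | rfl) b (rfl | rfl | rfl | rfl | rfl) <;>
    first | rfl | assumption | (symm; assumption)

/-- Commuting with `A` and `B` already forces commuting with this operator, so it need not be a
generator and no commutation of `R₁R₁*` with `G` or `Y` has to be checked. -/
lemma Ξ_S₁_sq_mem_bicommutant (G Y : D.V →L[ℂ] D.V) :
    D.Ξ (D.S₁ * D.S₁) ∈ bicommutant (D.generators G Y) := by
  rw [mem_bicommutant]
  intro C hC
  have hA : Commute C D.A := hC _ (by simp [generators])
  have hB : Commute C D.B := hC _ (by simp [generators])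
  have h1 := D.commute_Θ_S₁ (D.commute_sum hA hB) (D.commute_pA hA)
  exact commute_Ξ (D.commute_sum hA hB) (h1.mul_right h1)

-- Since `p(A) = Ξ(R₁R₁*)`, this is the square rule for `Ξ`. It allows characters that kill `p(A) +
-- q(B)` to separate the two summands.
variable (D) in
lemma Ξ_S₁_mul_Ξ_S₁ : D.pA * D.pA = (D.pA + D.qB) * D.Ξ (D.S₁ * D.S₁) := by
  rw [← Ξ_mul_Ξ_self, Ξ_S₁]
  exact (D.commute_Θ_S₁ (Commute.refl _) D.commute_pA_sum.symm).symm

/-- The operators that are defined by decompositions of `φ` are invertible. -/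
theorem IsDecomposition.isUnit (hd : D.IsDecomposition φ s g h)
    (hinv : ∀ ζ ∈ D.σN, (φ ζ).IsInvertible)
    (hzero : (0 : ℂ) ∉ closure (D.planeVal φ '' (D.specΘ \ D.Zreal))) :
    IsUnit (mvPolyEval s D.A D.B + D.Ξ (D.integralR g h)) := by
  obtain ⟨f, Y, hf, hY, hone⟩ := hd.exists_inverse hinv hzero
  set G := D.integralR g h with hG
  have hbA : IsBoundedBorel (D.specΘ.indicator fun z => (z.re : ℂ)) :=
    ProjMeasure.isBoundedBorel_indicator_spectrum _ (by fun_prop)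
  have hbB : IsBoundedBorel (D.specΘ.indicator fun z => (z.im : ℂ)) :=
    ProjMeasure.isBoundedBorel_indicator_spectrum _ (by fun_prop)
  have hGc : ∀ {f : ℂ → ℂ} {F : D.V →L[ℂ] D.V}, IsBoundedBorel f → D.E.IsIntegral f F →
      Commute G F := fun hf hF => commute_integralR hd.isBoundedBorel hf hF
  have hGP := hGc D.isBoundedBorel_sum D.isIntegral_Θ_sum
  have hcomm := generators_commute (hGc hbA D.isIntegral_Θ_A) (hGc hbB D.isIntegral_Θ_B) hGP
    (hY.commute hf hbA D.isIntegral_Θ_A) (hY.commute hf hbB D.isIntegral_Θ_B)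
    (hY.commute hf D.isBoundedBorel_sum D.isIntegral_Θ_sum) (hGc hf hY)
  have hXY := mvPolyEval_add_Ξ_mul_Ξ (D := D) (s := s) G Y
  rw [hone, Ξ_one] at hXY
  have hsub := subset_bicommutant (D.generators G Y)
  refine isUnit_of_joint_zeros (p := D.p.map Complex.ofRealHom) (q := D.q.map Complex.ofRealHom)
    hcomm (hsub (by simp [generators])) (hsub (by simp [generators])) (hsub (by simp [generators]))
    (hsub (Or.inr (Or.inr (Or.inr (Or.inl rfl))))) (hsub (by simp [generators]))
    (Ξ_S₁_sq_mem_bicommutant G Y) hXY (Ξ_mul_Ξ_self hGP) D.Ξ_S₁_mul_Ξ_S₁ ?_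
  intro α β hα hβ h1 h2
  rw [← D.N_eq] at h1
  rw [← D.adj_N_eq] at h2
  -- `α - iβ` is a spectral point of the Krein adjoint `A - iB` of `N`; its conjugate is the second
  -- number occurring in the definition of `σ_N`.
  have h3 := conj_mem_spectrum_N h2
  rw [map_sub, map_mul, Complex.conj_I, neg_mul, sub_neg_eq_add] at h3
  refine hd.sub_mem.eval_ne_zero hinv ⟨?_, ?_⟩ h1 h3
  · rw [aeval_eq_eval_map, hα]
  · rw [aeval_eq_eval_map, hβ]

end DefinitizableNormal

/-! ### Hermite interpolation in one and two variables -/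

section Interpolation

open Polynomial in
/-- Hermite interpolation: polynomials with prescribed Taylor coefficients at the zeros of `P`. -/
lemma exists_taylor_coeff_eq {P : Polynomial ℂ} (hP : P ≠ 0) (c : ℂ → ℕ → ℂ) :
    ∃ e : Polynomial ℂ, ∀ ξ, P.IsRoot ξ → ∀ j < P.rootMultiplicity ξ,
      (taylor ξ e).coeff j = c ξ j := by
  -- Prescribing the Taylor coefficients at `ξ` below the multiplicity `m` prescribes a residue
  -- modulo `(X - ξ)^m`. These ideals are pairwise coprime, so the Chinese remainder theorem
  -- applies.
  let I : {ξ // P.IsRoot ξ} → Ideal ℂ[X] := fun ξ =>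
    Ideal.span {(X - Polynomial.C ξ.1) ^ P.rootMultiplicity ξ.1}
  have hfin : Finite {ξ // P.IsRoot ξ} := (Polynomial.finite_setOfPred_isRoot hP).to_subtype
  have hI : Pairwise fun i j => IsCoprime (I i) (I j) := by
    intro i j hij
    rw [Ideal.isCoprime_span_singleton_iff]
    exact (pairwise_coprime_X_sub_C (s := fun k : {ξ // P.IsRoot ξ} => k.1)
      Subtype.val_injective hij).pow
  let t : {ξ // P.IsRoot ξ} → ℂ[X] := fun ξ =>
    ∑ j ∈ Finset.range (P.rootMultiplicity ξ.1), Polynomial.C (c ξ.1 j) * (X - Polynomial.C ξ.1) ^ j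
  obtain ⟨e, he⟩ := Ideal.pi_quotient_surjective hI fun i => Ideal.Quotient.mk (I i) (t i)
  refine ⟨e, fun ξ hξ j hj => ?_⟩
  have h1 := he ⟨ξ, hξ⟩
  rw [Ideal.Quotient.eq, Ideal.mem_span_singleton] at h1
  obtain ⟨r, hr⟩ := h1
  have h2 : e = t ⟨ξ, hξ⟩ + (X - Polynomial.C ξ) ^ P.rootMultiplicity ξ * r := by
    rw [← hr]; ring
  have h3 : ∀ k, taylor ξ ((X - Polynomial.C ξ) ^ k) = X ^ k := by
    intro k
    rw [taylor_pow, map_sub, taylor_X, taylor_C, add_sub_cancel_right]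
  rw [h2, map_add, taylor_mul, h3, coeff_add, coeff_X_pow_mul', if_neg (not_le.mpr hj), add_zero]
  simp only [t, map_sum, taylor_mul, h3, taylor_C, finsetSum_coeff, coeff_C_mul, coeff_X_pow]
  simp [hj]

/-- Monomials are such products. Working with products `e(z) f(w)` makes Taylor coefficients factor
into those in one variable. -/
lemma MvPolynomial.induction_fin_two {P : MvPolynomial (Fin 2) ℂ → Prop}
    (mul : ∀ e f : Polynomial ℂ, P (Polynomial.aeval (X 0) e * Polynomial.aeval (X 1) f))
    (add : ∀ s t, P s → P t → P (s + t)) (s : MvPolynomial (Fin 2) ℂ) : P s := by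
  refine MvPolynomial.induction_on' s (fun u a => ?_) add
  have h := mul (Polynomial.C a * Polynomial.X ^ u 0) (Polynomial.X ^ u 1)
  have h1 : Polynomial.aeval (X 0 : MvPolynomial (Fin 2) ℂ) (Polynomial.C a * Polynomial.X ^ u 0) *
      Polynomial.aeval (X 1) (Polynomial.X ^ u 1 : Polynomial ℂ) = monomial u a := by
    rw [monomial_eq, Finsupp.prod_fintype _ _ fun i => pow_zero _, Fin.prod_univ_two]
    simp [mul_assoc, MvPolynomial.algebraMap_eq]
  rwa [h1] at h

/-- The Taylor coefficient of `s` with index `(k,l)` at `(ξ,η)`. -/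
def taylorCoeff (ξ η : ℂ) (k l : ℕ) (s : MvPolynomial (Fin 2) ℂ) : ℂ :=
  (1 / ((k.factorial : ℂ) * (l.factorial : ℂ))) * MvPolynomial.eval ![ξ, η]
    ((MvPolynomial.pderiv 0)^[k] ((MvPolynomial.pderiv 1)^[l] s))

lemma iterate_pderiv_add (i : Fin 2) (k : ℕ) (s t : MvPolynomial (Fin 2) ℂ) :
    (MvPolynomial.pderiv i)^[k] (s + t) =
      (MvPolynomial.pderiv i)^[k] s + (MvPolynomial.pderiv i)^[k] t :=
  iterate_map_add (MvPolynomial.pderiv i) k s t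

lemma taylorCoeff_add (ξ η : ℂ) (k l : ℕ) (s t : MvPolynomial (Fin 2) ℂ) :
    taylorCoeff ξ η k l (s + t) = taylorCoeff ξ η k l s + taylorCoeff ξ η k l t := by
  simp only [taylorCoeff, iterate_pderiv_add, map_add, mul_add]

lemma iterate_pderiv_zero_mul (e f : Polynomial ℂ) (k : ℕ) :
    (MvPolynomial.pderiv (R := ℂ) (0 : Fin 2))^[k] (Polynomial.aeval (MvPolynomial.X 0) e *
      Polynomial.aeval (MvPolynomial.X 1) f) =
    Polynomial.aeval (MvPolynomial.X 0) (Polynomial.derivative^[k] e) *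
      Polynomial.aeval (MvPolynomial.X 1) f := by
  induction k generalizing e with
  | zero => rfl
  | succ k ih =>
    rw [Function.iterate_succ_apply, Derivation.leibniz, Derivation.map_aeval,
      Derivation.map_aeval, MvPolynomial.pderiv_X_self, MvPolynomial.pderiv_X_of_ne (R := ℂ) (show (1 : Fin 2) ≠ 0 by decide)]
    rw [smul_zero, smul_zero, zero_add, smul_eq_mul, smul_eq_mul, mul_one, mul_comm, ih,
      Function.iterate_succ_apply]

lemma iterate_pderiv_one_mul (e f : Polynomial ℂ) (k : ℕ) :
    (MvPolynomial.pderiv (R := ℂ) (1 : Fin 2))^[k] (Polynomial.aeval (MvPolynomial.X 0) e *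
      Polynomial.aeval (MvPolynomial.X 1) f) =
    Polynomial.aeval (MvPolynomial.X 0) e *
      Polynomial.aeval (MvPolynomial.X 1) (Polynomial.derivative^[k] f) := by
  induction k generalizing f with
  | zero => rfl
  | succ k ih =>
    rw [Function.iterate_succ_apply, Derivation.leibniz, Derivation.map_aeval,
      Derivation.map_aeval, MvPolynomial.pderiv_X_self, MvPolynomial.pderiv_X_of_ne (R := ℂ) (show (0 : Fin 2) ≠ 1 by decide)]
    rw [smul_zero, smul_zero, add_zero, smul_eq_mul, smul_eq_mul, mul_one, ih,
      Function.iterate_succ_apply]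

lemma eval_aeval_X (v : Fin 2 → ℂ) (i : Fin 2) (e : Polynomial ℂ) :
    MvPolynomial.eval v (Polynomial.aeval (MvPolynomial.X i) e) = e.eval (v i) := by
  rw [← MvPolynomial.coe_aeval_eq_eval, ← Polynomial.coe_aeval_eq_eval]
  change (MvPolynomial.aeval v) _ = _
  rw [← Polynomial.aeval_algHom_apply, MvPolynomial.aeval_X]

lemma eval_iterate_derivative (e : Polynomial ℂ) (ξ : ℂ) (k : ℕ) :
    (Polynomial.derivative^[k] e).eval ξ = k.factorial * (Polynomial.taylor ξ e).coeff k := by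
  rw [Polynomial.taylor_coeff, ← Polynomial.factorial_smul_hasseDeriv]
  simp

lemma taylorCoeff_mul (ξ η : ℂ) (k l : ℕ) (e f : Polynomial ℂ) :
    taylorCoeff ξ η k l (Polynomial.aeval (MvPolynomial.X 0) e *
      Polynomial.aeval (MvPolynomial.X 1) f) =
    (Polynomial.taylor ξ e).coeff k * (Polynomial.taylor η f).coeff l := by
  rw [taylorCoeff, iterate_pderiv_one_mul, iterate_pderiv_zero_mul, map_mul, eval_aeval_X,
    eval_aeval_X]
  simp only [Matrix.cons_val_zero, Matrix.cons_val_one, eval_iterate_derivative]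
  have h1 : (k.factorial : ℂ) ≠ 0 := by exact_mod_cast k.factorial_ne_zero
  have h2 : (l.factorial : ℂ) ≠ 0 := by exact_mod_cast l.factorial_ne_zero
  field_simp

lemma taylorCoeff_sum {ι : Type*} (ξ η : ℂ) (k l : ℕ) (t : Finset ι)
    (s : ι → MvPolynomial (Fin 2) ℂ) :
    taylorCoeff ξ η k l (∑ i ∈ t, s i) = ∑ i ∈ t, taylorCoeff ξ η k l (s i) := by
  classical
  induction t using Finset.induction_on with
  | empty =>
    have h := taylorCoeff_add ξ η k l 0 0
    simpa using h
  | insert i t hi ih => rw [Finset.sum_insert hi, Finset.sum_insert hi, taylorCoeff_add, ih]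

open Polynomial in
/-- Hermite interpolation in two variables. -/
lemma exists_taylorCoeff_eq {P Q : Polynomial ℂ} (hP : P ≠ 0) (hQ : Q ≠ 0)
    (c : ℂ → ℂ → ℕ → ℕ → ℂ) : ∃ s : MvPolynomial (Fin 2) ℂ, ∀ ξ η, P.IsRoot ξ → Q.IsRoot η →
      ∀ k < P.rootMultiplicity ξ, ∀ l < Q.rootMultiplicity η,
        taylorCoeff ξ η k l s = c ξ η k l := by
  classical
  -- `e` and `f` are dual to the interpolation data: among the prescribed coefficients only the one
  -- at the given zero and of the given order is `1`, the others are `0`.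
  choose e he using fun i : ℂ × ℕ => exists_taylor_coeff_eq hP
    fun ξ j => if (ξ, j) = i then (1 : ℂ) else 0
  choose f hf using fun i : ℂ × ℕ => exists_taylor_coeff_eq hQ
    fun ξ j => if (ξ, j) = i then (1 : ℂ) else 0
  let I : Finset (ℂ × ℕ) := P.roots.toFinset.sigma
    (fun ξ => Finset.range (P.rootMultiplicity ξ)) |>.image fun x => (x.1, x.2)
  let I' : Finset (ℂ × ℕ) := Q.roots.toFinset.sigma
    (fun ξ => Finset.range (Q.rootMultiplicity ξ)) |>.image fun x => (x.1, x.2)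
  refine ⟨∑ i ∈ I, ∑ j ∈ I', Polynomial.aeval (MvPolynomial.X 0) (c i.1 j.1 i.2 j.2 • e i) *
    Polynomial.aeval (MvPolynomial.X 1) (f j), fun ξ η hξ hη k hk l hl => ?_⟩
  have hI : (ξ, k) ∈ I := by
    refine Finset.mem_image.mpr ⟨⟨ξ, k⟩, ?_, rfl⟩
    simpa [hP, hk] using hξ
  have hI' : (η, l) ∈ I' := by
    refine Finset.mem_image.mpr ⟨⟨η, l⟩, ?_, rfl⟩
    simpa [hQ, hl] using hη
  simp only [taylorCoeff_sum, taylorCoeff_mul]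
  simp only [map_smul, coeff_smul, he _ ξ hξ k hk, hf _ η hη l hl]
  rw [Finset.sum_eq_single_of_mem _ hI, Finset.sum_eq_single_of_mem _ hI']
  · simp
  · intro j _ hj
    simp [hj.symm]
  · intro i _ hi
    simp [hi.symm]

end Interpolation

/-! ### Taylor remainders in two variables -/

section TaylorEstimate

open Asymptotics Filter

lemma exists_eval_eq_taylor_sum (e : Polynomial ℂ) (ξ : ℂ) (m : ℕ) : ∃ r : Polynomial ℂ, ∀ z,
    e.eval z = ∑ k ∈ Finset.range m, (Polynomial.taylor ξ e).coeff k * (z - ξ) ^ k +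
      (z - ξ) ^ m * r.eval (z - ξ) := by
  have hdvd : Polynomial.X ^ m ∣ Polynomial.taylor ξ e -
      ∑ k ∈ Finset.range m, Polynomial.C ((Polynomial.taylor ξ e).coeff k) * Polynomial.X ^ k := by
    rw [Polynomial.X_pow_dvd_iff]
    intro d hd
    simp [Polynomial.coeff_X_pow, hd]
  obtain ⟨r, hr⟩ := hdvd
  refine ⟨r, fun z => ?_⟩
  have h1 := congrArg (Polynomial.eval (z - ξ)) hr
  rw [Polynomial.eval_sub, Polynomial.taylor_eval, sub_add_cancel, Polynomial.eval_finsetSum] at h1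
  simp only [Polynomial.eval_mul, Polynomial.eval_C, Polynomial.eval_pow, Polynomial.eval_X] at h1
  rw [← h1]
  ring

/-- The weight `max (|Re (z-w)|^m, |Im (z-w)|^n)`. -/
def critWeight (w : ℂ) (m n : ℕ) (z : ℂ) : ℝ := max (|(z - w).re| ^ m) (|(z - w).im| ^ n)

lemma critWeight_pos {w z : ℂ} (h : z ≠ w) (m n : ℕ) : 0 < critWeight w m n z := by
  by_cases hre : (z - w).re = 0
  · have him : (z - w).im ≠ 0 := fun him => h (sub_eq_zero.mp (Complex.ext hre him))
    exact lt_max_of_lt_right (by positivity)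
  · exact lt_max_of_lt_left (by positivity)

lemma isBigO_re_pow (w : ℂ) (m n : ℕ) (l : Filter ℂ) :
    (fun z : ℂ => ((z.re : ℂ) - (w.re : ℂ)) ^ m) =O[l] critWeight w m n := by
  refine IsBigO.of_bound 1 (Filter.Eventually.of_forall fun z => ?_)
  rw [one_mul, ← Complex.ofReal_sub, norm_pow, Complex.norm_real, Real.norm_eq_abs, Real.norm_eq_abs,
    ← Complex.sub_re]
  exact (le_max_left _ _).trans (le_abs_self _)

lemma isBigO_im_pow (w : ℂ) (m n : ℕ) (l : Filter ℂ) :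
    (fun z : ℂ => ((z.im : ℂ) - (w.im : ℂ)) ^ n) =O[l] critWeight w m n := by
  refine IsBigO.of_bound 1 (Filter.Eventually.of_forall fun z => ?_)
  rw [one_mul, ← Complex.ofReal_sub, norm_pow, Complex.norm_real, Real.norm_eq_abs, Real.norm_eq_abs,
    ← Complex.sub_im]
  exact (le_max_right _ _).trans (le_abs_self _)

lemma isBigO_mul_continuous {f u : ℂ → ℂ} {w : ℂ} {v : ℂ → ℝ} (hf : f =O[𝓝 w] v)
    (hu : Continuous u) : (fun z => f z * u z) =O[𝓝 w] v := by
  have h1 : u =O[𝓝 w] fun _ => (1 : ℝ) := (hu.tendsto w).isBigO_one ℝ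
  simpa using hf.mul h1

/-- For a product `e(z) f(w)` first `e` is expanded with `f` intact, then `f` is expanded against
the Taylor polynomial of `e`. Each remainder contains a full power, of order `m` in the real part or
of order `n` in the imaginary part. -/
lemma isBigO_eval_sub_taylor (s : MvPolynomial (Fin 2) ℂ) (w : ℂ) (m n : ℕ) :
    (fun z : ℂ => MvPolynomial.eval ![(z.re : ℂ), (z.im : ℂ)] s -
      ∑ k ∈ Finset.range m, ∑ l ∈ Finset.range n, taylorCoeff w.re w.im k l s *
        ((z - w).re : ℂ) ^ k * ((z - w).im : ℂ) ^ l) =O[𝓝 w] critWeight w m n := by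
  induction s using MvPolynomial.induction_fin_two with
  | mul e f =>
    obtain ⟨r, hr⟩ := exists_eval_eq_taylor_sum e w.re m
    obtain ⟨r', hr'⟩ := exists_eval_eq_taylor_sum f w.im n
    have h1 := isBigO_mul_continuous (isBigO_re_pow w m n (𝓝 w))
      (u := fun z => r.eval ((z.re : ℂ) - (w.re : ℂ)) * f.eval (z.im : ℂ)) (by fun_prop)
    have h2 := isBigO_mul_continuous (isBigO_im_pow w m n (𝓝 w))
      (u := fun z => r'.eval ((z.im : ℂ) - (w.im : ℂ)) *
        ∑ k ∈ Finset.range m, (Polynomial.taylor (w.re : ℂ) e).coeff k *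
          ((z.re : ℂ) - (w.re : ℂ)) ^ k) (by fun_prop)
    refine (h1.add h2).congr_left fun z => ?_
    rw [map_mul, eval_aeval_X, eval_aeval_X]
    simp only [Matrix.cons_val_zero, Matrix.cons_val_one, taylorCoeff_mul, Complex.sub_re,
      Complex.sub_im, Complex.ofReal_sub]
    have h3 : ∑ k ∈ Finset.range m, ∑ l ∈ Finset.range n, (Polynomial.taylor (w.re : ℂ) e).coeff k *
        (Polynomial.taylor (w.im : ℂ) f).coeff l * ((z.re : ℂ) - (w.re : ℂ)) ^ k *
          ((z.im : ℂ) - (w.im : ℂ)) ^ l =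
        (∑ k ∈ Finset.range m, (Polynomial.taylor (w.re : ℂ) e).coeff k *
          ((z.re : ℂ) - (w.re : ℂ)) ^ k) * ∑ l ∈ Finset.range n,
          (Polynomial.taylor (w.im : ℂ) f).coeff l * ((z.im : ℂ) - (w.im : ℂ)) ^ l := by
      rw [Finset.sum_mul_sum]
      refine Finset.sum_congr rfl fun k _ => Finset.sum_congr rfl fun l _ => ?_
      ring
    rw [h3, hr z.re, hr' z.im]
    ring
  | add s t hs ht =>
    refine (hs.add ht).congr_left fun z => ?_
    simp only [map_add, taylorCoeff_add, add_mul, Finset.sum_add_distrib]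
    ring

end TaylorEstimate

/-! ### Existence of decompositions -/

section Decomposition

open Asymptotics Filter

lemma LocAlg.ext {I : Finset (ℕ × ℕ)} {a b : LocAlg I}
    (h : ∀ k l, (k, l) ∈ I → a.coeff k l = b.coeff k l) : a = b := by
  funext i
  have h1 := h i.1.1 i.1.2 i.2
  rwa [coeff, coeff, dif_pos (show (i.1.1, i.1.2) ∈ I from i.2),
    dif_pos (show (i.1.1, i.1.2) ∈ I from i.2)] at h1

lemma Polynomial.taylor_coeff_rootMultiplicity_ne_zero {P : Polynomial ℂ} (hP : P ≠ 0) (ξ : ℂ) :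
    (Polynomial.taylor ξ P).coeff (P.rootMultiplicity ξ) ≠ 0 := by
  rw [Polynomial.rootMultiplicity_eq_natTrailingDegree, ← Polynomial.taylor_apply]
  change Polynomial.trailingCoeff _ ≠ 0
  rw [Ne, Polynomial.trailingCoeff_eq_zero]
  exact fun h => hP (Polynomial.taylor_injective ξ (by rw [h, map_zero]))

/-- The cofactor of `(z - ξ)^m` in `P` is nonzero at `ξ`, so its inverse is bounded nearby. -/
lemma Polynomial.isBigO_pow_rootMultiplicity {P : Polynomial ℂ} (hP : P ≠ 0) (ξ : ℂ) :
    (fun z : ℂ => (z - ξ) ^ P.rootMultiplicity ξ) =O[𝓝 ξ] fun z => P.eval z := by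
  obtain ⟨r, hr, hr0⟩ := P.exists_eq_pow_rootMultiplicity_mul_and_not_dvd hP ξ
  have h0 : r.eval ξ ≠ 0 := fun h => hr0 (Polynomial.dvd_iff_isRoot.mpr h)
  have hne : ∀ᶠ z in 𝓝 ξ, r.eval z ≠ 0 := r.continuous.continuousAt.eventually_ne h0
  have h1 : (fun z => (r.eval z)⁻¹) =O[𝓝 ξ] fun _ => (1 : ℂ) :=
    (r.continuous.continuousAt.inv₀ h0).tendsto.isBigO_one ℂ
  have h2 : (fun z => P.eval z * (r.eval z)⁻¹) =O[𝓝 ξ] fun z => P.eval z := by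
    simpa using (isBigO_refl (fun z => P.eval z) (𝓝 ξ)).mul h1
  refine h2.congr' ?_ EventuallyEq.rfl
  filter_upwards [hne] with z hz
  have h3 : P.eval z = (z - ξ) ^ P.rootMultiplicity ξ * r.eval z := by
    conv_lhs => rw [hr]
    simp
  rw [h3, mul_assoc, mul_inv_cancel₀ hz, mul_one]

lemma continuous_eval_re_im (s : MvPolynomial (Fin 2) ℂ) :
    Continuous fun z : ℂ => MvPolynomial.eval ![(z.re : ℂ), (z.im : ℂ)] s := by
  refine (MvPolynomial.continuous_eval s).comp (continuous_pi fun i => ?_)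
  fin_cases i
  · exact Complex.continuous_ofReal.comp Complex.continuous_re
  · exact Complex.continuous_ofReal.comp Complex.continuous_im

namespace DefinitizableNormal

variable {K : Type*} [NormedAddCommGroup K] [InnerProductSpace ℂ K] [CompleteSpace K]
  {κ : KreinStructure K} (D : DefinitizableNormal κ)

open Classical in
/-- The entries of `φ` at the critical points in terms of their coordinates. -/
def critCoeff (φ : D.Symbol) (ξ η : ℂ) (k l : ℕ) : ℂ :=
  if h : D.IsZeroPair ξ η then
    if h' : ξ.im = 0 ∧ η.im = 0 then D.planeCoeff φ ⟨ξ.re, η.re⟩ k l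
    else (φ (Sum.inr ⟨(ξ, η), h, h'⟩)).coeff k l
  else 0

lemma critCoeff_coord (φ : D.Symbol) {ζ : D.Dom}
    (hζ : D.IsZeroPair (D.coord ζ).1 (D.coord ζ).2) (k l : ℕ) :
    D.critCoeff φ (D.coord ζ).1 (D.coord ζ).2 k l = (φ ζ).coeff k l := by
  rw [critCoeff, dif_pos hζ]
  rcases ζ with z | w
  · rw [dif_pos ⟨Complex.ofReal_im _, Complex.ofReal_im _⟩]
    change D.planeCoeff φ (z : ℂ) k l = _
    rw [planeCoeff, dif_pos z.2]
  · exact dif_neg w.2.2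

lemma mem_index_of_lt {ζ : D.Dom} (hζ : D.IsZeroPair (D.coord ζ).1 (D.coord ζ).2) {k l : ℕ}
    (hk : k < D.dp (D.coord ζ).1) (hl : l < D.dq (D.coord ζ).2) : (k, l) ∈ D.index ζ := by
  have h : (k, l) ∈ indexB (D.dp (D.coord ζ).1) (D.dq (D.coord ζ).2) :=
    Finset.mem_product.mpr ⟨Finset.mem_range.mpr hk, Finset.mem_range.mpr hl⟩
  rcases ζ with z | w
  · have hz : (z : ℂ) ∈ D.Zreal := hζ
    rw [index, if_pos hz]
    exact Finset.mem_union_left _ h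
  · exact h

lemma exists_inR (φ : D.Symbol) : ∃ s, D.InR (φ - D.ofPoly s) := by
  obtain ⟨s, hs⟩ := exists_taylorCoeff_eq D.p_map_ne_zero D.q_map_ne_zero (D.critCoeff φ)
  refine ⟨s, fun ζ hζ k hk l hl => ?_⟩
  rw [Pi.sub_apply, coeff_sub, D.coeff_ofPoly s ζ (D.mem_index_of_lt hζ hk hl),
    ← D.critCoeff_coord φ hζ, sub_eq_zero]
  refine (hs _ _ ?_ ?_ k hk l hl).symm
  · rw [Polynomial.IsRoot.def, ← aeval_eq_eval_map, hζ.1]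
  · rw [Polynomial.IsRoot.def, ← aeval_eq_eval_map, hζ.2]

lemma p_add_q_ne_zero {z : ℂ} (hz : z ∈ D.specΘ \ D.Zreal) :
    D.p.eval z.re + D.q.eval z.im ≠ 0 := by
  intro h
  have h1 := D.abs_p_le hz.1
  have h2 := D.abs_q_le hz.1
  rw [h, abs_zero] at h1 h2
  exact hz.2 (D.mem_Zreal_iff.mpr ⟨abs_nonpos_iff.mp h1, abs_nonpos_iff.mp h2⟩)

lemma taylorCoeff_pPoly (ξ η : ℂ) (k l : ℕ) : taylorCoeff ξ η k l D.pPoly =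
    (Polynomial.taylor ξ (D.p.map Complex.ofRealHom)).coeff k * if l = 0 then 1 else 0 := by
  have h := taylorCoeff_mul ξ η k l (D.p.map Complex.ofRealHom) 1
  rwa [map_one, mul_one, Polynomial.taylor_one, Polynomial.coeff_C] at h

lemma taylorCoeff_qPoly (ξ η : ℂ) (k l : ℕ) : taylorCoeff ξ η k l D.qPoly =
    (if k = 0 then 1 else 0) *
      (Polynomial.taylor η (D.q.map Complex.ofRealHom)).coeff l := by
  have h := taylorCoeff_mul ξ η k l 1 (D.q.map Complex.ofRealHom)
  rwa [map_one, one_mul, Polynomial.taylor_one, Polynomial.coeff_C] at h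

/-- The entry is the first nonzero Taylor coefficient of `p`. As `dp > 0`, the polynomial `q(w)`,
free of the first variable, contributes nothing. Division by this entry yields the first component
of `g` at critical points. -/
lemma coeff_sum_left_ne_zero {z : ↥(D.specΘ ∪ D.Zreal)} (hz : (z : ℂ) ∈ D.Zreal) :
    ((D.ofPoly D.pPoly + D.ofPoly D.qPoly) (Sum.inl z)).coeff (D.dp (z : ℂ).re) 0 ≠ 0 := by
  have hi : (D.dp (z : ℂ).re, 0) ∈ D.index (Sum.inl z) := by
    rw [index, if_pos hz]
    simp [indexA]
  rw [Pi.add_apply, coeff_add, D.coeff_ofPoly _ _ hi, D.coeff_ofPoly _ _ hi]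
  change taylorCoeff (z : ℂ).re (z : ℂ).im _ _ _ + taylorCoeff (z : ℂ).re (z : ℂ).im _ _ _ ≠ 0
  rw [taylorCoeff_pPoly, taylorCoeff_qPoly, if_pos rfl, if_neg (D.dp_pos hz.1).ne', mul_one,
    zero_mul, add_zero]
  exact Polynomial.taylor_coeff_rootMultiplicity_ne_zero D.p_map_ne_zero _

lemma coeff_sum_right_ne_zero {z : ↥(D.specΘ ∪ D.Zreal)} (hz : (z : ℂ) ∈ D.Zreal) :
    ((D.ofPoly D.pPoly + D.ofPoly D.qPoly) (Sum.inl z)).coeff 0 (D.dq (z : ℂ).im) ≠ 0 := by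
  have hi : (0, D.dq (z : ℂ).im) ∈ D.index (Sum.inl z) := by
    rw [index, if_pos hz]
    simp [indexA]
  rw [Pi.add_apply, coeff_add, D.coeff_ofPoly _ _ hi, D.coeff_ofPoly _ _ hi]
  change taylorCoeff (z : ℂ).re (z : ℂ).im _ _ _ + taylorCoeff (z : ℂ).re (z : ℂ).im _ _ _ ≠ 0
  rw [taylorCoeff_pPoly, taylorCoeff_qPoly, if_pos rfl, if_neg (D.dq_pos hz.2).ne', one_mul,
    mul_zero, zero_add]
  exact Polynomial.taylor_coeff_rootMultiplicity_ne_zero D.q_map_ne_zero _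

/-- The quotient of `φ - s_N` by `p_N + q_N` at the points that are not critical. -/
def remQuotient (φ : D.Symbol) (s : MvPolynomial (Fin 2) ℂ) (z : ℂ) : ℂ :=
  (D.planeVal φ z - MvPolynomial.eval ![(z.re : ℂ), (z.im : ℂ)] s) /
    ((D.p.eval z.re + D.q.eval z.im : ℝ) : ℂ)

/-- The quotients of the entries of `φ - s_N` by those of `p_N + q_N` at critical points. -/
def remPair (φ : D.Symbol) (s : MvPolynomial (Fin 2) ℂ) (z : ℂ) : ℂ × ℂ :=
  (D.planeCoeff (φ - D.ofPoly s) z (D.dp z.re) 0 /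
      D.planeCoeff (D.ofPoly D.pPoly + D.ofPoly D.qPoly) z (D.dp z.re) 0,
    D.planeCoeff (φ - D.ofPoly s) z 0 (D.dq z.im) /
      D.planeCoeff (D.ofPoly D.pPoly + D.ofPoly D.qPoly) z 0 (D.dq z.im))

open Classical in
lemma coeff_mulRem (g : ℂ → ℂ) (h : ℂ → ℂ × ℂ) (z : ↥(D.specΘ ∪ D.Zreal))
    (a : LocAlg (D.index (Sum.inl z))) {k l : ℕ} (hkl : (k, l) ∈ D.index (Sum.inl z)) :
    (D.mulRem g h z a).coeff k l =
      if (z : ℂ) ∈ D.Zreal then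
        if (k, l) = (D.dp (z : ℂ).re, 0) then a.coeff k l * (h z).1
        else if (k, l) = (0, D.dq (z : ℂ).im) then a.coeff k l * (h z).2
        else 0
      else a.coeff k l * g z := by
  rw [LocAlg.coeff, dif_pos hkl, LocAlg.coeff, dif_pos hkl]
  rfl

/-- At a critical point the rectangle of indices is settled by `hR`, and the two extra indices by
division by nonzero entries. Elsewhere on `σ(Θ(N))` one divides by `p + q ≠ 0`. -/
lemma eq_add_mulRem {φ : D.Symbol} {s : MvPolynomial (Fin 2) ℂ} (hR : D.InR (φ - D.ofPoly s))
    (z : ℂ) (hz : z ∈ D.specΘ) : φ (Sum.inl ⟨z, Or.inl hz⟩) =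
      D.ofPoly s (Sum.inl ⟨z, Or.inl hz⟩) +
        D.mulRem (D.remQuotient φ s) (D.remPair φ s) ⟨z, Or.inl hz⟩
          ((D.ofPoly D.pPoly + D.ofPoly D.qPoly) (Sum.inl ⟨z, Or.inl hz⟩)) := by
  have hmem : z ∈ D.specΘ ∪ D.Zreal := Or.inl hz
  rw [← sub_eq_iff_eq_add']
  change (φ - D.ofPoly s) (Sum.inl ⟨z, hmem⟩) = _
  refine LocAlg.ext fun k l hkl => ?_
  rw [D.coeff_mulRem _ _ _ _ hkl]
  by_cases hcrit : z ∈ D.Zreal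
  · rw [if_pos hcrit]
    split_ifs with h1 h2
    · obtain ⟨rfl, rfl⟩ := Prod.mk.inj h1
      simp only [remPair, planeCoeff, dif_pos hmem]
      rw [mul_div_cancel₀ _ (D.coeff_sum_left_ne_zero (z := ⟨z, hmem⟩) hcrit)]
    · obtain ⟨rfl, rfl⟩ := Prod.mk.inj h2
      simp only [remPair, planeCoeff, dif_pos hmem]
      rw [mul_div_cancel₀ _ (D.coeff_sum_right_ne_zero (z := ⟨z, hmem⟩) hcrit)]
    · simp only [index, if_pos hcrit, indexA, Finset.mem_union, Finset.mem_product,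
        Finset.mem_range, Finset.mem_insert, Finset.mem_singleton] at hkl
      rcases hkl with hkl | hkl | hkl
      · exact hR (Sum.inl ⟨z, hmem⟩) hcrit _ hkl.1 _ hkl.2
      · exact absurd hkl h1
      · exact absurd hkl h2
  · rw [if_neg hcrit]
    simp only [index, if_neg hcrit, indexA, Finset.range_zero, Finset.product_empty,
      Finset.empty_union, Finset.mem_insert, Finset.mem_singleton, or_self] at hkl
    obtain ⟨rfl, rfl⟩ := Prod.mk.inj hkl
    have hne : ((D.p.eval z.re + D.q.eval z.im : ℝ) : ℂ) ≠ 0 :=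
      Complex.ofReal_ne_zero.mpr (D.p_add_q_ne_zero ⟨hz, hcrit⟩)
    rw [Pi.add_apply, coeff_add, Pi.sub_apply, coeff_sub, coeff_zero_ofPoly, coeff_zero_ofPoly,
      coeff_zero_ofPoly, eval_pPoly, eval_qPoly, remQuotient, planeVal, planeCoeff, dif_pos hmem]
    have h1 : Polynomial.aeval (z.re : ℂ) D.p + Polynomial.aeval (z.im : ℂ) D.q =
        ((D.p.eval z.re + D.q.eval z.im : ℝ) : ℂ) := by
      rw [aeval_eq_eval_map, aeval_eq_eval_map, eval_map_ofReal, eval_map_ofReal,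
        Complex.ofReal_add]
    change _ = (Polynomial.aeval (z.re : ℂ) D.p + Polynomial.aeval (z.im : ℂ) D.q) * _
    rw [h1, mul_div_cancel₀ _ hne]
    rfl

/-- The two powers in the weight are dominated near `w` by `p(Re z)` and `q(Im z)`, and each of
these by `p + q` as long as `z` stays in `σ(Θ(N))`. -/
lemma isBigO_critWeight {w : ℂ} :
    critWeight w (D.dp w.re) (D.dq w.im) =O[𝓝[D.specΘ] w]
      fun z => D.p.eval z.re + D.q.eval z.im := by
  have hre : Tendsto (fun z : ℂ => (z.re : ℂ)) (𝓝[D.specΘ] w) (𝓝 (w.re : ℂ)) :=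
    ((Complex.continuous_ofReal.comp Complex.continuous_re).tendsto w).mono_left nhdsWithin_le_nhds
  have him : Tendsto (fun z : ℂ => (z.im : ℂ)) (𝓝[D.specΘ] w) (𝓝 (w.im : ℂ)) :=
    ((Complex.continuous_ofReal.comp Complex.continuous_im).tendsto w).mono_left nhdsWithin_le_nhds
  have h1 := (Polynomial.isBigO_pow_rootMultiplicity D.p_map_ne_zero (w.re : ℂ)).comp_tendsto hre
  have h2 := (Polynomial.isBigO_pow_rootMultiplicity D.q_map_ne_zero (w.im : ℂ)).comp_tendsto him
  have h3 : (fun z => (D.p.map Complex.ofRealHom).eval (z.re : ℂ)) =O[𝓝[D.specΘ] w]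
      fun z => D.p.eval z.re + D.q.eval z.im := by
    refine IsBigO.of_bound 1 (eventually_mem_nhdsWithin.mono fun z hz => ?_)
    rw [eval_map_ofReal, Complex.norm_real, one_mul]
    exact D.abs_p_le hz
  have h4 : (fun z => (D.q.map Complex.ofRealHom).eval (z.im : ℂ)) =O[𝓝[D.specΘ] w]
      fun z => D.p.eval z.re + D.q.eval z.im := by
    refine IsBigO.of_bound 1 (eventually_mem_nhdsWithin.mono fun z hz => ?_)
    rw [eval_map_ofReal, Complex.norm_real, one_mul]
    exact D.abs_q_le hz
  refine IsBigO.trans ?_ ((h1.trans h3).norm_left.add (h2.trans h4).norm_left)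
  refine IsBigO.of_bound 1 (Eventually.of_forall fun z => ?_)
  simp only [Function.comp_apply, norm_pow, ← Complex.ofReal_sub, Complex.norm_real]
  rw [critWeight, one_mul, Real.norm_of_nonneg (by positivity), Real.norm_of_nonneg (by positivity)]
  exact max_le_add_of_nonneg (by positivity) (by positivity)

lemma InR.planeCoeff_eq {φ : D.Symbol} {s : MvPolynomial (Fin 2) ℂ}
    (hR : D.InR (φ - D.ofPoly s)) {w : ℂ} (hw : w ∈ D.Zreal) {k l : ℕ} (hk : k < D.dp w.re)
    (hl : l < D.dq w.im) : D.planeCoeff φ w k l = taylorCoeff w.re w.im k l s := by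
  have hmem : w ∈ D.specΘ ∪ D.Zreal := Or.inr hw
  have h1 := hR (Sum.inl ⟨w, hmem⟩) hw k hk l hl
  rw [Pi.sub_apply, coeff_sub, D.coeff_ofPoly s (Sum.inl ⟨w, hmem⟩)
    (D.mem_index_of_lt (ζ := Sum.inl ⟨w, hmem⟩) hw hk hl), sub_eq_zero] at h1
  rw [planeCoeff, dif_pos hmem, h1]
  rfl

/-- At a critical point `φ` and `s` share the Taylor polynomial on the rectangle of indices, so both
remainders are bounded by the weight, hence by `p + q`. At any other point of `σ(Θ(N))` the left
side is bounded and `p + q` stays away from zero nearby. -/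
lemma isBigO_planeVal_sub {φ : D.Symbol} (hφ : D.InF φ) {s : MvPolynomial (Fin 2) ℂ}
    (hR : D.InR (φ - D.ofPoly s)) {w : ℂ} (hw : w ∈ D.specΘ) :
    (fun z => D.planeVal φ z - MvPolynomial.eval ![(z.re : ℂ), (z.im : ℂ)] s)
      =O[𝓝[D.specΘ \ D.Zreal] w] fun z => D.p.eval z.re + D.q.eval z.im := by
  have hle : 𝓝[D.specΘ \ D.Zreal] w ≤ 𝓝[D.specΘ] w := nhdsWithin_mono _ Set.sdiff_subset
  by_cases hcrit : w ∈ D.Zreal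
  · refine IsBigO.trans ?_ (D.isBigO_critWeight.mono hle)
    obtain ⟨U, hU, C, hC⟩ := hφ.2.2 w ⟨hw, hcrit⟩
    have h1 : (fun z => D.planeVal φ z - ∑ k ∈ Finset.range (D.dp w.re),
        ∑ l ∈ Finset.range (D.dq w.im), taylorCoeff w.re w.im k l s * ((z - w).re : ℂ) ^ k *
          ((z - w).im : ℂ) ^ l) =O[𝓝[D.specΘ \ D.Zreal] w]
        critWeight w (D.dp w.re) (D.dq w.im) := by
      refine IsBigO.of_bound C ?_
      filter_upwards [eventually_mem_nhdsWithin, mem_nhdsWithin_of_mem_nhds hU] with z hz hzU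
      have hne : z ≠ w := fun h => hz.2 (h ▸ hcrit)
      have h2 := hC z ⟨⟨hz.1, hzU⟩, hne⟩
      have hpos := critWeight_pos hne (D.dp w.re) (D.dq w.im)
      rw [Real.norm_of_nonneg hpos.le, ← div_le_iff₀ hpos]
      convert! h2 using 6 with k hk l hl
      rw [InR.planeCoeff_eq D hR hcrit (Finset.mem_range.mp hk) (Finset.mem_range.mp hl)]
    have h3 := (isBigO_eval_sub_taylor s w (D.dp w.re) (D.dq w.im)).mono
      (nhdsWithin_le_nhds (s := D.specΘ \ D.Zreal))
    refine (h1.sub h3).congr_left fun z => ?_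
    ring
  · obtain ⟨C, hC⟩ := hφ.2.1
    have h1 : D.planeVal φ =O[𝓝[D.specΘ \ D.Zreal] w] fun _ => (1 : ℝ) := by
      refine IsBigO.of_bound C (eventually_mem_nhdsWithin.mono fun z hz => ?_)
      rw [norm_one, mul_one]
      exact hC z hz
    have h2 : (fun z : ℂ => MvPolynomial.eval ![(z.re : ℂ), (z.im : ℂ)] s)
        =O[𝓝[D.specΘ \ D.Zreal] w] fun _ => (1 : ℝ) :=
      (((continuous_eval_re_im s).tendsto w).mono_left nhdsWithin_le_nhds).isBigO_one ℝ
    refine (h1.sub h2).trans ?_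
    have hcont : Continuous fun z : ℂ => D.p.eval z.re + D.q.eval z.im := by fun_prop
    have hne := D.p_add_q_ne_zero ⟨hw, hcrit⟩
    have hlim := (hcont.tendsto w).norm.mono_left
      (nhdsWithin_le_nhds (a := w) (s := D.specΘ \ D.Zreal))
    exact (isBigO_const_left_iff_pos_le_norm one_ne_zero).mpr
      ⟨_, half_pos (norm_pos_iff.mpr hne), (hlim.eventually_const_lt
        (half_lt_self (norm_pos_iff.mpr hne))).mono fun _ h => h.le⟩

/-- The local estimates hold around every point of the compact set `σ(Θ(N))`, critical or not, and
finitely many neighbourhoods cover it. -/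
lemma exists_norm_remQuotient_le {φ : D.Symbol} (hφ : D.InF φ) {s : MvPolynomial (Fin 2) ℂ}
    (hR : D.InR (φ - D.ofPoly s)) :
    ∃ C : ℝ, ∀ z ∈ D.specΘ \ D.Zreal, ‖D.remQuotient φ s z‖ ≤ C := by
  have hcpt : IsCompact D.specΘ := spectrum.isCompact _
  suffices h : ∃ C : ℝ, ∀ z ∈ D.specΘ, z ∈ D.specΘ \ D.Zreal → ‖D.remQuotient φ s z‖ ≤ C by
    obtain ⟨C, hC⟩ := h
    exact ⟨C, fun z hz => hC z hz.1 hz⟩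
  refine hcpt.induction_on (p := fun S => ∃ C : ℝ, ∀ z ∈ S, z ∈ D.specΘ \ D.Zreal →
    ‖D.remQuotient φ s z‖ ≤ C) ⟨0, fun z hz => hz.elim⟩ ?_ ?_ fun w hw => ?_
  · rintro S S' hS ⟨C, hC⟩
    exact ⟨C, fun z hz => hC z (hS hz)⟩
  · rintro S S' ⟨C, hC⟩ ⟨C', hC'⟩
    refine ⟨max C C', fun z hz hz' => ?_⟩
    rcases hz with hz | hz
    · exact (hC z hz hz').trans (le_max_left _ _)
    · exact (hC' z hz hz').trans (le_max_right _ _)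
  · obtain ⟨C, hC0, hC⟩ := (D.isBigO_planeVal_sub hφ hR hw).exists_nonneg
    obtain ⟨U, hU, hwU, hsub⟩ := mem_nhdsWithin.mp hC.bound
    refine ⟨U, mem_nhdsWithin_of_mem_nhds (hU.mem_nhds hwU), C, fun z hz hz' => ?_⟩
    rw [remQuotient, norm_div, Complex.norm_real]
    exact div_le_of_le_mul₀ (norm_nonneg _) hC0 (hsub ⟨hz, hz'⟩)

lemma exists_isDecomposition {φ : D.Symbol} (hφ : D.InF φ) :
    ∃ s g h, D.IsDecomposition φ s g h := by
  obtain ⟨s, hR⟩ := D.exists_inR φ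
  refine ⟨s, D.remQuotient φ s, D.remPair φ s, hR, ?_, D.exists_norm_remQuotient_le hφ hR,
    D.eq_add_mulRem hR⟩
  have hcont : Continuous fun z : ℂ => ((D.p.eval z.re + D.q.eval z.im : ℝ) : ℂ) := by fun_prop
  exact (hφ.1.sub ((continuous_eval_re_im s).measurable.comp measurable_subtype_coe)).div
    (hcont.measurable.comp measurable_subtype_coe)

end DefinitizableNormal

end Decomposition

end

theorem mainTheorem5 {K : Type*} [NormedAddCommGroup K] [InnerProductSpace ℂ K] [CompleteSpace K]
    (κ : KreinStructure K) (D : DefinitizableNormal κ) (φ : D.Symbol) (hφ : D.InF φ)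
    (hinv : ∀ ζ ∈ D.σN, (φ ζ).IsInvertible)
    (hzero : (0 : ℂ) ∉ closure (D.planeVal φ '' (D.specΘ \ D.Zreal))) :
    IsUnit (D.funCalc φ) := by
  obtain ⟨s, g, h, hd⟩ := D.exists_isDecomposition hφ
  have H : ∃ t : MvPolynomial (Fin 2) ℂ × (ℂ → ℂ) × (ℂ → ℂ × ℂ),
      D.IsDecomposition φ t.1 t.2.1 t.2.2 := ⟨(s, g, h), hd⟩
  rw [DefinitizableNormal.funCalc, dif_pos H]
  -- Invertibility holds for every decomposition, so it applies to the one chosen in `funCalc`, and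
  -- independence of the choice is not needed.
  exact H.choose_spec.isUnit hinv hzero
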